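/- Let $H^{2,2}(\mathbb{R})$ be the completion of $C_0^\infty(\mathbb{R})$ (complex-valued functions) in the norm $$\|u\|_{H^{2,2}}=\Bigl(\|(1+|x|)^2u\|_{L^2}^2+\|u''\|_{L^2}^2\Bigr)^{1/2}.$$ Let $\varepsilon=-1$. For $q\in H^{2,2}(\mathbb{R})$ and $\lambda\in\mathbb{C}$ consider the linear system $\Psi_x=L\Psi$ for $2\times 2$ matrix-valued functions $\Psi(x)$ of $x\in\mathbb{R}$, where $$L=-i\lambda\sigma_3+\begin{pmatrix}0&q\\ \varepsilon\lambda\overline{q}&0\end{pmatrix}-\frac{i}{2}\sigma_3Q^2,\qquad \sigma_3=\begin{pmatrix}1&0\\0&-1\end{pmatrix},\qquad Q=\begin{pmatrix}0&q\\ \varepsilon\overline{q}&0\end{pmatrix}.$$ For $\lambda\in\mathbb{R}$ let $\Psi^\pm(x;\lambda)$ be the Jost solutions, that is, the unique solutions with $\lim_{x\to\pm\infty}\Psi^\pm(x;\lambda)e^{i\lambda x\sigma_3}=I$, and let $$T(\lambda)=\begin{pmatrix}\alpha(\lambda)&\beta(\lambda)\\ \breve\beta(\lambda)&\breve\alpha(\lambda)\end{pmatrix}$$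 be the matrix, independent of $x$, with $\Psi^+(x;\lambda)=\Psi^-(x;\lambda)T(\lambda)$. The function $\breve\alpha$ on $\mathbb{R}$ extends uniquely to a function, again denoted $\breve\alpha$, that is continuous on $\{\operatorname{Im}\lambda\ge 0\}$ and analytic on $\mathbb{C}^+=\{\operatorname{Im}\lambda>0\}$. Let $U$ be the set of those $q\in H^{2,2}(\mathbb{R})$ for which $\breve\alpha$ has no zeros on $\mathbb{R}$ and at most finitely many zeros in $\mathbb{C}^+$, all of them simple. Then $U$ is open and dense in $H^{2,2}(\mathbb{R})$. -/

import Mathlib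

open MeasureTheory Filter Topology
open scoped ContDiff

noncomputable section

namespace DNLS

/-- The Hilbert space `L²(ℝ) × L²(ℝ)` with norm `(‖f‖² + ‖g‖²)^{1/2}`. -/
abbrev PairSpace : Type :=
  WithLp 2 (Lp ℂ 2 (volume : Measure ℝ) × Lp ℂ 2 (volume : Measure ℝ))

/-- The image of `C₀^∞(ℝ)` (complex valued) in `L² × L²` under `u ↦ ((1 + |x|)² u, u'')`.
The norm of the image of `u` is `(‖(1 + |x|)² u‖² + ‖u''‖²)^{1/2}`, the `H^{2,2}` norm of `u`. -/
def testImage : Submodule ℂ PairSpace where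
  carrier := {p | ∃ u : ℝ → ℂ, ContDiff ℝ ∞ u ∧ HasCompactSupport u ∧
    (p.fst : ℝ → ℂ) =ᵐ[volume] (fun x => ((1 + |x|) ^ 2 : ℝ) * u x) ∧
    (p.snd : ℝ → ℂ) =ᵐ[volume] (fun x => deriv (deriv u) x)}
  zero_mem' := by
    refine ⟨fun _ => 0, contDiff_const, HasCompactSupport.zero, ?_, ?_⟩
    · filter_upwards [Lp.coeFn_zero ℂ 2 (volume : Measure ℝ)] with x hx
      simp
    · filter_upwards [Lp.coeFn_zero ℂ 2 (volume : Measure ℝ)] with x hx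
      simp
  add_mem' := by
    rintro p r ⟨u, hu, hcu, h1, h2⟩ ⟨v, hv, hcv, h3, h4⟩
    have du : Differentiable ℝ u := hu.differentiable (by simp)
    have dv : Differentiable ℝ v := hv.differentiable (by simp)
    have du' : Differentiable ℝ (deriv u) :=
      ((contDiff_infty_iff_deriv.1 hu).2).differentiable (by simp)
    have dv' : Differentiable ℝ (deriv v) :=
      ((contDiff_infty_iff_deriv.1 hv).2).differentiable (by simp)
    have e : deriv (u + v) = deriv u + deriv v := by
      ext x; exact deriv_add (du x) (dv x)
    refine ⟨u + v, hu.add hv, hcu.add hcv, ?_, ?_⟩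
    · filter_upwards [Lp.coeFn_add p.fst r.fst, h1, h3] with x hx hp hr
      simp only [WithLp.add_fst, hx, Pi.add_apply, hp, hr]
      ring
    · filter_upwards [Lp.coeFn_add p.snd r.snd, h2, h4] with x hx hp hr
      have e2 : deriv (deriv u + deriv v) x = deriv (deriv u) x + deriv (deriv v) x :=
        deriv_add (du' x) (dv' x)
      simp only [WithLp.add_snd, hx, Pi.add_apply, hp, hr, e, e2]
  smul_mem' := by
    rintro c p ⟨u, hu, hcu, h1, h2⟩
    have du : Differentiable ℝ u := hu.differentiable (by simp)
    have du' : Differentiable ℝ (deriv u) :=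
      ((contDiff_infty_iff_deriv.1 hu).2).differentiable (by simp)
    have e : deriv (c • u) = c • deriv u := by
      ext x; exact deriv_const_smul c (du x)
    refine ⟨c • u, hu.const_smul c, hcu.smul_left (f := fun _ => c), ?_, ?_⟩
    · filter_upwards [Lp.coeFn_smul c p.fst, h1] with x hx hp
      simp only [WithLp.smul_fst, hx, Pi.smul_apply, hp, smul_eq_mul]
      ring
    · filter_upwards [Lp.coeFn_smul c p.snd, h2] with x hx hp
      have e2 : deriv (c • deriv u) x = c • deriv (deriv u) x :=
        deriv_const_smul c (du' x)
      simp only [WithLp.smul_snd, hx, Pi.smul_apply, hp, e, e2]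

/-- `H^{2,2}(ℝ)`: the completion of `C₀^∞(ℝ)` in the norm
`(‖(1 + |x|)² u‖²_{L²} + ‖u''‖²_{L²})^{1/2}`, realized as the closure of the isometric image of
`C₀^∞(ℝ)` in the complete space `L² × L²`. An element is a pair `((1 + |x|)² q, q'')`, where `q''`
is the weak second derivative of `q` and hence is determined by `q`. -/
abbrev H22 : Type := ↥(testImage.topologicalClosure)

/-- The function `q` (up to a.e. equality) that an element of `H^{2,2}(ℝ)` stands for. -/
def potential (q : H22) (x : ℝ) : ℂ := (q : PairSpace).fst x / ((1 + |x|) ^ 2 : ℝ)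

/-- `σ₃`. -/
def sigma3 : Matrix (Fin 2) (Fin 2) ℂ := !![1, 0; 0, -1]

/-- `Q = (0, q; ε q̄, 0)` for the value `q` of the potential at a point. -/
def Qmat (ε : ℝ) (q : ℂ) : Matrix (Fin 2) (Fin 2) ℂ :=
  !![0, q; (ε : ℂ) * (starRingEnd ℂ) q, 0]

/-- `Q_λ = (0, q; ε λ q̄, 0)`. -/
def Qlam (ε : ℝ) (l : ℂ) (q : ℂ) : Matrix (Fin 2) (Fin 2) ℂ :=
  !![0, q; (ε : ℂ) * l * (starRingEnd ℂ) q, 0]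

/-- The Lax matrix `L = -iλσ₃ + Q_λ - (i/2) σ₃ Q²`. -/
def Lmat (ε : ℝ) (l : ℂ) (q : ℂ) : Matrix (Fin 2) (Fin 2) ℂ :=
  (-(Complex.I * l)) • sigma3 + Qlam ε l q - (Complex.I / 2) • (sigma3 * Qmat ε q ^ 2)

/-- `e^{iλxσ₃}`. -/
def expSigma (l : ℂ) (x : ℝ) : Matrix (Fin 2) (Fin 2) ℂ :=
  !![Complex.exp (Complex.I * l * x), 0; 0, Complex.exp (-(Complex.I * l * x))]

/-- `Ψ` is a (locally absolutely continuous) matrix solution of `Ψ_x = L Ψ` on `ℝ`. -/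
def IsSolution (ε : ℝ) (q : ℝ → ℂ) (l : ℂ) (Ψ : ℝ → Matrix (Fin 2) (Fin 2) ℂ) : Prop :=
  Continuous Ψ ∧ ∀ x y : ℝ, ∀ i j : Fin 2,
    Ψ y i j - Ψ x i j = ∫ s in x..y, (Lmat ε l (q s) * Ψ s) i j

/-- `Ψ` is the Jost solution normalized at the end `F` of the line (`F = atTop` for `Ψ⁺`,
`F = atBot` for `Ψ⁻`): `Ψ_x = L Ψ` and `Ψ(x) e^{iλxσ₃} → I` along `F`. -/
def IsJost (ε : ℝ) (q : ℝ → ℂ) (l : ℝ) (F : Filter ℝ)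
    (Ψ : ℝ → Matrix (Fin 2) (Fin 2) ℂ) : Prop :=
  IsSolution ε q l Ψ ∧ Tendsto (fun x => Ψ x * expSigma l x) F (𝓝 1)

/-- `T = (α, β; β̆, ᾰ)` is the transition matrix at the real point `l`: `Ψ⁺ = Ψ⁻ T`. -/
def IsTransition (ε : ℝ) (q : ℝ → ℂ) (l : ℝ) (T : Matrix (Fin 2) (Fin 2) ℂ) : Prop :=
  ∃ Ψp Ψm : ℝ → Matrix (Fin 2) (Fin 2) ℂ,
    IsJost ε q l atTop Ψp ∧ IsJost ε q l atBot Ψm ∧ ∀ x, Ψp x = Ψm x * T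

/-- On the closed upper half-plane, `a` is the scattering coefficient `ᾰ` of `q` with its analytic
continuation: `a` is continuous for `Im z ≥ 0`, analytic for `Im z > 0`, and for every real `l`
it is the lower right entry of the transition matrix. These properties determine `a` on the closed
upper half-plane; its values below the real axis play no role. -/
structure IsAlphaBreve (ε : ℝ) (q : ℝ → ℂ) (a : ℂ → ℂ) : Prop where
  continuousOn : ContinuousOn a {z | 0 ≤ z.im}
  analytic : DifferentiableOn ℂ a {z | 0 < z.im}
  real_eq : ∀ l : ℝ, ∃ T, IsTransition ε q l T ∧ a l = T 1 1

/-- The set `U` of those `q ∈ H^{2,2}(ℝ)` for which `ᾰ` has no zeros on `ℝ` and at most finitely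
many zeros in `ℂ⁺`, all of them simple. -/
def genericSet (ε : ℝ) : Set H22 :=
  {q | ∃ a : ℂ → ℂ, IsAlphaBreve ε (potential q) a ∧
    (∀ l : ℝ, a l ≠ 0) ∧
    {z : ℂ | 0 < z.im ∧ a z = 0}.Finite ∧
    ∀ z : ℂ, 0 < z.im → a z = 0 → deriv a z ≠ 0}

end DNLS

end

/-! Conjugating by $e^{i\lambda x\sigma_3}$ turns the system into $B'=VB$ with $V\in L^1$, that is,
a Volterra equation. It is uniquely solvable for every $V\in L^1$ (`isUnit_one_sub_volterra`), and
its scattering matrix $S$, the limit at $+\infty$ of the solution normalized at $-\infty$, is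
holomorphic in $V$ (`differentiable_scatter`). The transition matrix is $S^{-1}$
(`isTransition_iff`) and $\det S=1$, so $\breve\alpha=S_{00}$.

The potential contains the term $-\lambda\bar q$, which spoils uniformity in $\lambda$. For a test
function $u$ a gauge transformation equal to $I$ off the support of $u$ leads to a Zakharov–Shabat
system with potentials $u$ and $\frac i2\bar u'-\frac14|u|^2\bar u$ and with the same $S$
(`scat_knPot`). There $\lambda$ enters only through phases, so $S_{00}$ is entire, Lipschitz in the
$H^{2,2}$ norm on balls uniformly for $\operatorname{Im}\lambda\ge0$ (`exists_norm_testA_sub_le`),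
and tends to $1$ at infinity in the closed half-plane (`exists_norm_testA_sub_one_le`). Density of
test functions then yields $\breve\alpha$ for every $q$ as a uniform limit (`exists_isAlphaBreve`);
it is unique by a maximum principle argument (`IsAlphaBreve.eqOn`).

Openness (`isOpen_genericSet`): if $q_n\to r$ and each $\breve\alpha_{q_n}$ has a real or multiple
zero, these zeros stay bounded because $\breve\alpha_r$ is near $1$ far out, and a limit point is a
real or multiple zero of $\breve\alpha_r$. Finiteness of the zero set is automatic once no zero is
real (`finite_zeros`).

Density (`exists_mem_genericSet_near`): take a test function $u$ and a small bump $r$ supported to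
its right. For $|c|=1$ the scattering matrices multiply, and the coefficient of $u+cr$ is $A+cB$
with $A=S^r_{00}S^u_{00}$ and $B=S^r_{01}S^u_{10}$ (`testA_add_mul`). The bump can be chosen so that
$S^r_{00}\ne0$ on the closed half-plane and $S^r_{01}\ne0$ at the zeros of $S^u_{00}$ there
(`exists_zsScat_bump_ne_zero`); with $\det S^u=1$ this excludes common zeros of $A$ and $B$. A
multiple zero of $A+cB$ is a zero of the Wronskian $AB'-A'B$, and a real zero forces $|A|=|B|$, a
zero of another entire function. Neither function vanishes identically unless $B=0$, so only
countably many $c=-A/B$ are bad, and some $c$ on the unit circle is good (`exists_unimodular`). -/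

namespace DNLS

noncomputable section

/-! ### Volterra equations with integrable coefficients in a Banach algebra -/

section Volterra

set_option linter.unusedSectionVars false

open Set
open scoped BoundedContinuousFunction

lemma continuous_integral_Iic {E : Type*} [NormedAddCommGroup E] [NormedSpace ℝ E]
    {g : ℝ → E} (hg : Integrable g) : Continuous fun x => ∫ y in Iic x, g y := by
  have h : (fun x => ∫ y in Iic x, g y) = fun x => (∫ y in Iic 0, g y) + ∫ y in (0:ℝ)..x, g y := by
    ext x
    rw [← intervalIntegral.integral_Iic_sub_Iic hg.integrableOn hg.integrableOn]
    abel
  rw [h]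
  exact continuous_const.add (intervalIntegral.continuous_primitive
    (fun a b => hg.intervalIntegrable) 0)

lemma isUnit_one_sub_clm {E : Type*} [NormedAddCommGroup E] [NormedSpace ℂ E] [CompleteSpace E]
    (T : E →L[ℂ] E) (h : ‖T‖ < 1) : IsUnit (1 - T) :=
  isUnit_one_sub_of_norm_lt_one h

/-- The solution of `f - K V f = v`. -/
def resolventApply {E F : Type*} [NormedAddCommGroup E] [NormedSpace ℂ E]
    [NormedAddCommGroup F] [NormedSpace ℂ F] (K : F →L[ℂ] E →L[ℂ] E) (v : E) (V : F) : E :=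
  Ring.inverse (1 - K V) v

section Resolvent

variable {E F : Type*} [NormedAddCommGroup E] [NormedSpace ℂ E] [NormedAddCommGroup F]
  [NormedSpace ℂ F] {K : F →L[ℂ] E →L[ℂ] E}

lemma resolventApply_sub (v : E) {V : F} (h : IsUnit (1 - K V)) :
    resolventApply K v V - K V (resolventApply K v V) = v :=
  congrArg (fun T : E →L[ℂ] E => T v) (Ring.mul_inverse_cancel _ h)

lemma eq_resolventApply {v f : E} {V : F} (h : IsUnit (1 - K V)) (hf : f - K V f = v) :
    f = resolventApply K v V := by
  rw [resolventApply, ← hf]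
  exact (congrArg (fun T : E →L[ℂ] E => T f) (Ring.inverse_mul_cancel _ h)).symm

/-- Inversion is holomorphic on the units of a Banach algebra, and `K` is linear in `V`. -/
lemma differentiable_resolventApply [CompleteSpace E] (v : E) (h : ∀ V, IsUnit (1 - K V)) :
    Differentiable ℂ (resolventApply K v) := by
  intro V
  have h1 : DifferentiableAt ℂ (fun V => 1 - K V) V :=
    (differentiableAt_const _).sub K.differentiableAt
  exact ((differentiableAt_inverse (𝕜 := ℂ) (h V)).comp V h1).clm_apply (differentiableAt_const _)

end Resolvent

variable {A : Type*} [NormedRing A] [NormedAlgebra ℂ A] [CompleteSpace A]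

lemma integrable_mul_bounded {V : ℝ → A} (hV : Integrable V) (f : ℝ →ᵇ A) :
    Integrable fun y => V y * f y :=
  hV.mul_bdd (c := ‖f‖) f.continuous.aestronglyMeasurable
    (Eventually.of_forall f.norm_coe_le_norm)

lemma integral_norm_mul_le {V : ℝ → A} (hV : Integrable V) (f : ℝ →ᵇ A) :
    ∫ y, ‖V y * f y‖ ≤ (∫ y, ‖V y‖) * ‖f‖ := by
  rw [← integral_mul_const]
  refine integral_mono (integrable_mul_bounded hV f).norm (hV.norm.mul_const _) fun y => ?_
  exact (norm_mul_le _ _).trans (by gcongr; exact f.norm_coe_le_norm y)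

lemma norm_setIntegral_mul_le {V : ℝ → A} (hV : Integrable V) (f : ℝ →ᵇ A) (s : Set ℝ) :
    ‖∫ y in s, V y * f y‖ ≤ (∫ y, ‖V y‖) * ‖f‖ :=
  (norm_integral_le_integral_norm _).trans
    ((setIntegral_le_integral (integrable_mul_bounded hV f).norm
      (Eventually.of_forall fun _ => norm_nonneg _)).trans (integral_norm_mul_le hV f))

lemma integrable_coeFn (V : Lp A 1 (volume : Measure ℝ)) : Integrable (V : ℝ → A) :=
  L1.integrable_coeFn V

lemma norm_L1_eq (V : Lp A 1 (volume : Measure ℝ)) : ‖V‖ = ∫ y, ‖V y‖ :=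
  L1.norm_eq_integral_norm V

/-- The Volterra operator `f ↦ ∫_{-∞}^x V f`, as a bounded bilinear map in `V ∈ L¹` and the bounded
continuous function `f`. -/
def volterra : Lp A 1 (volume : Measure ℝ) →L[ℂ] (ℝ →ᵇ A) →L[ℂ] (ℝ →ᵇ A) :=
  LinearMap.mkContinuous₂
    (LinearMap.mk₂ ℂ
      (fun V f => BoundedContinuousFunction.ofNormedAddCommGroup
        (fun x => ∫ y in Iic x, V y * f y)
        (continuous_integral_Iic (integrable_mul_bounded (integrable_coeFn V) f))
        ((∫ y, ‖V y‖) * ‖f‖)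
        (fun x => norm_setIntegral_mul_le (integrable_coeFn V) f (Iic x)))
      (by
        intro V W f
        ext x
        simp only [BoundedContinuousFunction.coe_ofNormedAddCommGroup,
          BoundedContinuousFunction.coe_add, Pi.add_apply]
        rw [← integral_add (integrable_mul_bounded (integrable_coeFn V) f).integrableOn
          (integrable_mul_bounded (integrable_coeFn W) f).integrableOn]
        refine integral_congr_ae (ae_restrict_of_ae ?_)
        filter_upwards [Lp.coeFn_add V W] with y hy
        rw [hy, Pi.add_apply, add_mul])
      (by
        intro c V f
        ext x
        simp only [BoundedContinuousFunction.coe_ofNormedAddCommGroup,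
          BoundedContinuousFunction.coe_smul]
        rw [← integral_smul]
        refine integral_congr_ae (ae_restrict_of_ae ?_)
        filter_upwards [Lp.coeFn_smul c V] with y hy
        rw [hy, Pi.smul_apply, smul_mul_assoc])
      (by
        intro V f g
        ext x
        simp only [BoundedContinuousFunction.coe_ofNormedAddCommGroup,
          BoundedContinuousFunction.coe_add, Pi.add_apply]
        rw [← integral_add (integrable_mul_bounded (integrable_coeFn V) f).integrableOn
          (integrable_mul_bounded (integrable_coeFn V) g).integrableOn]
        simp only [mul_add])
      (by
        intro c V f
        ext x
        simp only [BoundedContinuousFunction.coe_ofNormedAddCommGroup,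
          BoundedContinuousFunction.coe_smul]
        rw [← integral_smul]
        simp only [mul_smul_comm]))
    1
    (by
      intro V f
      rw [one_mul, norm_L1_eq]
      exact (BoundedContinuousFunction.norm_le (by positivity)).2 fun x =>
        norm_setIntegral_mul_le (integrable_coeFn V) f (Iic x))

/-- `∫ V f`, as a bounded bilinear map in `V ∈ L¹` and the bounded continuous function `f`. -/
def pairing : Lp A 1 (volume : Measure ℝ) →L[ℂ] (ℝ →ᵇ A) →L[ℂ] A :=
  LinearMap.mkContinuous₂
    (LinearMap.mk₂ ℂ (fun V f => ∫ y, V y * f y)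
      (by
        intro V W f
        rw [← integral_add (integrable_mul_bounded (integrable_coeFn V) f)
          (integrable_mul_bounded (integrable_coeFn W) f)]
        refine integral_congr_ae ?_
        filter_upwards [Lp.coeFn_add V W] with y hy
        rw [hy, Pi.add_apply, add_mul])
      (by
        intro c V f
        rw [← integral_smul]
        refine integral_congr_ae ?_
        filter_upwards [Lp.coeFn_smul c V] with y hy
        rw [hy, Pi.smul_apply, smul_mul_assoc])
      (by
        intro V f g
        rw [← integral_add (integrable_mul_bounded (integrable_coeFn V) f)
          (integrable_mul_bounded (integrable_coeFn V) g)]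
        simp only [BoundedContinuousFunction.coe_add, Pi.add_apply, mul_add])
      (by
        intro c V f
        rw [← integral_smul]
        simp only [BoundedContinuousFunction.coe_smul, mul_smul_comm]))
    1
    (by
      intro V f
      rw [one_mul, norm_L1_eq]
      exact (norm_integral_le_integral_norm _).trans
        (integral_norm_mul_le (integrable_coeFn V) f))

lemma pairing_apply (V : Lp A 1 (volume : Measure ℝ)) (f : ℝ →ᵇ A) :
    pairing V f = ∫ y, V y * f y := rfl

/-- A positive continuous weight for which the Volterra operator of `V` is a contraction. -/
lemma exists_weight {g : ℝ → ℝ} (hg : Integrable g) :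
    ∃ w : ℝ → ℝ, Continuous w ∧ ∃ C : ℝ, (∀ x, 1 ≤ w x ∧ w x ≤ C) ∧ 
      ∀ x, ∫ y in Iic x, |g y| * w y ≤ w x / 2 := by
  -- Split $g$ into a continuous compactly supported $h_0$ and a remainder of $L^1$ norm at most
  -- $1/4$. For $w=e^{4H}$ with $H'=|h_0|$ one has $|h_0|w=w'/4$, so the first part contributes
  -- $(w-1)/4$; since $w$ is monotone, the remainder contributes at most $w/4$.
  obtain ⟨h0, -, hle, hc0, hi0⟩ :=
    hg.exists_hasCompactSupport_integral_sub_le (ε := 1 / 4) (by norm_num)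
  set h : ℝ → ℝ := fun x => |h0 x| with hh
  have hc : Continuous h := hc0.abs
  have hi : Integrable h := hi0.abs
  set H : ℝ → ℝ := fun x => ∫ y in Iic x, h y with hH
  have hH0 : ∀ x, 0 ≤ H x := fun x => setIntegral_nonneg measurableSet_Iic fun y _ => abs_nonneg _
  have hH1 : ∀ x, H x ≤ ∫ y, h y := fun x =>
    setIntegral_le_integral hi (Eventually.of_forall fun y => abs_nonneg _)
  have hHd : ∀ x, HasDerivAt H (h x) x := by
    intro x
    have e : H = fun x => (∫ y in Iic 0, h y) + ∫ y in (0:ℝ)..x, h y := by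
      ext x
      rw [← intervalIntegral.integral_Iic_sub_Iic hi.integrableOn hi.integrableOn]
      simp [hH]
    rw [e]
    exact (intervalIntegral.integral_hasDerivAt_right (hc.intervalIntegrable _ _)
      (hc.stronglyMeasurableAtFilter _ _) hc.continuousAt).const_add _
  have hHm : Monotone H := monotone_of_deriv_nonneg (fun x => (hHd x).differentiableAt)
    fun x => by rw [(hHd x).deriv]; exact abs_nonneg _
  have hHc : Continuous H := continuous_integral_Iic hi
  have hHbot : Tendsto H atBot (𝓝 0) := tendsto_integral_Iic_zero tendsto_id
  refine ⟨fun x => Real.exp (4 * H x), by fun_prop, Real.exp (4 * ∫ y, h y), fun x => ⟨?_, ?_⟩,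
    fun x => ?_⟩
  · exact Real.one_le_exp (by linarith [hH0 x])
  · exact Real.exp_le_exp.2 (by linarith [hH1 x])
  have hwd : ∀ y, HasDerivAt (fun x => Real.exp (4 * H x) / 4) (h y * Real.exp (4 * H y)) y := by
    intro y
    have := (((hHd y).const_mul 4).exp).div_const 4
    have e : h y * Real.exp (4 * H y) = Real.exp (4 * H y) * (4 * h y) / 4 := by ring
    rw [e]
    exact this
  have hbd : ∀ {k : ℝ → ℝ}, Integrable k → Integrable fun y => k y * Real.exp (4 * H y) := by
    intro k hk
    refine hk.mul_bdd (c := Real.exp (4 * ∫ y, h y)) (by fun_prop)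
      (Eventually.of_forall fun y => ?_)
    rw [Real.norm_eq_abs, abs_of_pos (Real.exp_pos _)]
    exact Real.exp_le_exp.2 (by linarith [hH1 y])
  have h1 : ∫ y in Iic x, h y * Real.exp (4 * H y) = Real.exp (4 * H x) / 4 - 1 / 4 := by
    refine integral_Iic_of_hasDerivAt_of_tendsto' (fun y _ => hwd y) (hbd hi).integrableOn ?_
    have := (Real.continuous_exp.tendsto _).comp (hHbot.const_mul 4)
    simpa using this.div_const 4
  have hd : Integrable fun y => |g y - h0 y| := (hg.sub hi0).abs
  have h2 : ∫ y in Iic x, |g y - h0 y| * Real.exp (4 * H y) ≤ 1 / 4 * Real.exp (4 * H x) := by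
    calc ∫ y in Iic x, |g y - h0 y| * Real.exp (4 * H y)
        ≤ ∫ y in Iic x, |g y - h0 y| * Real.exp (4 * H x) := by
          refine setIntegral_mono_on (hbd hd).integrableOn (hd.mul_const _).integrableOn
            measurableSet_Iic fun y hy => ?_
          gcongr
          exact hHm hy
      _ = (∫ y in Iic x, |g y - h0 y|) * Real.exp (4 * H x) := integral_mul_const _ _
      _ ≤ _ := by
          gcongr
          exact (setIntegral_le_integral hd (Eventually.of_forall fun y => abs_nonneg _)).trans hle
  calc ∫ y in Iic x, |g y| * Real.exp (4 * H y)
      ≤ ∫ y in Iic x, (|g y - h0 y| * Real.exp (4 * H y) + h y * Real.exp (4 * H y)) := by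
        refine setIntegral_mono_on (hbd hg.abs).integrableOn
          ((hbd hd).add (hbd hi)).integrableOn measurableSet_Iic fun y hy => ?_
        rw [← add_mul]
        gcongr
        have := abs_add_le (g y - h0 y) (h0 y)
        simpa [hh] using this
    _ = _ := integral_add (hbd hd).integrableOn (hbd hi).integrableOn
    _ ≤ _ := by rw [h1]; linarith

/-- Multiplication by a bounded continuous real weight. -/
def weightMul (w : ℝ → ℝ) (hw : Continuous w) (C : ℝ) (hC : ∀ x, |w x| ≤ C) :
    (ℝ →ᵇ A) →L[ℂ] (ℝ →ᵇ A) :=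
  LinearMap.mkContinuous
    { toFun := fun f => BoundedContinuousFunction.ofNormedAddCommGroup (fun x => (w x : ℂ) • f x)
        (by fun_prop) (C * ‖f‖) (fun x => by
          rw [norm_smul, Complex.norm_real, Real.norm_eq_abs]
          exact mul_le_mul (hC x) (f.norm_coe_le_norm x) (norm_nonneg _)
            ((abs_nonneg _).trans (hC x)))
      map_add' := fun f g => by ext x; simp
      map_smul' := fun c f => by
        ext x
        simp only [BoundedContinuousFunction.coe_ofNormedAddCommGroup,
          BoundedContinuousFunction.coe_smul, RingHom.id_apply]
        exact smul_comm _ _ _ }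
    C
    (fun f => (BoundedContinuousFunction.norm_le
      (mul_nonneg ((abs_nonneg _).trans (hC 0)) (norm_nonneg _))).2 fun x => by
        change ‖(w x : ℂ) • f x‖ ≤ _
        rw [norm_smul, Complex.norm_real, Real.norm_eq_abs]
        exact mul_le_mul (hC x) (f.norm_coe_le_norm x) (norm_nonneg _)
          ((abs_nonneg _).trans (hC x)))

/-- Conjugation by the weight of `exists_weight` brings the norm of the Volterra operator down to
$1/2$, so a Neumann series inverts the conjugated operator. No smallness of $V$ is needed, which is
what makes the solution holomorphic on all of $L^1$. -/
lemma isUnit_one_sub_volterra (V : Lp A 1 (volume : Measure ℝ)) :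
    IsUnit (1 - volterra V) := by
  obtain ⟨w, hwc, C, hw, hle⟩ := exists_weight (integrable_coeFn V).norm
  have hpos : ∀ x, 0 < w x := fun x => one_pos.trans_le (hw x).1
  have hwC : ∀ x, |w x| ≤ C := fun x => by rw [abs_of_pos (hpos x)]; exact (hw x).2
  have hwi : ∀ x, |(w x)⁻¹| ≤ 1 := fun x => by
    rw [abs_of_pos (inv_pos.2 (hpos x))]; exact inv_le_one_of_one_le₀ (hw x).1
  have hwic : Continuous fun x => (w x)⁻¹ := hwc.inv₀ fun x => (hpos x).ne'
  let W : (ℝ →ᵇ A) →L[ℂ] (ℝ →ᵇ A) := weightMul w hwc C hwC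
  let W' : (ℝ →ᵇ A) →L[ℂ] (ℝ →ᵇ A) := weightMul (fun x => (w x)⁻¹) hwic 1 hwi
  have hWW' : W * W' = 1 := by
    ext f x
    change ((w x : ℝ) : ℂ) • (((w x)⁻¹ : ℝ) : ℂ) • f x = f x
    rw [smul_smul, ← Complex.ofReal_mul, mul_inv_cancel₀ (hpos x).ne']; simp
  have hW'W : W' * W = 1 := by
    ext f x
    change (((w x)⁻¹ : ℝ) : ℂ) • ((w x : ℝ) : ℂ) • f x = f x
    rw [smul_smul, ← Complex.ofReal_mul, inv_mul_cancel₀ (hpos x).ne']; simp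
  let U : ((ℝ →ᵇ A) →L[ℂ] (ℝ →ᵇ A))ˣ := ⟨W, W', hWW', hW'W⟩
  have hnorm : ‖W' * volterra V * W‖ < 1 := by
    refine lt_of_le_of_lt (ContinuousLinearMap.opNorm_le_bound _ (by norm_num : (0:ℝ) ≤ 1 / 2)
      fun f => ?_) (by norm_num)
    rw [BoundedContinuousFunction.norm_le (by positivity)]
    intro x
    change ‖(((w x)⁻¹ : ℝ) : ℂ) • ∫ y in Iic x, V y * ((w y : ℂ) • f y)‖ ≤ 1 / 2 * ‖f‖
    have h1 : ‖∫ y in Iic x, V y * ((w y : ℂ) • f y)‖ ≤ ∫ y in Iic x, |‖V y‖| * w y * ‖f‖ := by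
      refine norm_integral_le_of_norm_le ?_ (Eventually.of_forall fun y => ?_)
      · refine Integrable.integrableOn (Integrable.mul_const ?_ _)
        exact (integrable_coeFn V).norm.abs.mul_bdd (c := C) hwc.aestronglyMeasurable
          (Eventually.of_forall hwC)
      · refine (norm_mul_le _ _).trans ?_
        rw [norm_smul, Complex.norm_real, Real.norm_eq_abs, abs_of_pos (hpos y), abs_norm,
          mul_assoc]
        gcongr
        · exact (hpos y).le
        · exact f.norm_coe_le_norm y
    rw [norm_smul, Complex.norm_real, Real.norm_eq_abs, abs_of_pos (inv_pos.2 (hpos x))]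
    rw [integral_mul_const] at h1
    calc (w x)⁻¹ * ‖∫ y in Iic x, V y * ((w y : ℂ) • f y)‖
        ≤ (w x)⁻¹ * (w x / 2 * ‖f‖) := by
          have := inv_pos.2 (hpos x)
          gcongr
          exact h1.trans (by gcongr; exact hle x)
      _ = 1 / 2 * ‖f‖ := by have := (hpos x).ne'; field_simp
  have hu : IsUnit (1 - W' * volterra V * W) := isUnit_one_sub_clm _ hnorm
  have e : 1 - volterra V = W * (1 - W' * volterra V * W) * W' := by
    have : W * (1 - W' * volterra V * W) * W' = W * W' - (W * W') * volterra V * (W * W') := by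
      rw [mul_sub, sub_mul, mul_one]
      simp only [mul_assoc]
    rw [this, hWW']; simp
  rw [e]
  exact (U.isUnit.mul hu).mul U⁻¹.isUnit

/-- The bounded solution of `f(x) = 1 + ∫_{-∞}^x V f`. -/
def fund (V : Lp A 1 (volume : Measure ℝ)) : ℝ →ᵇ A :=
  resolventApply volterra (BoundedContinuousFunction.const ℝ 1) V

/-- The limit at `+∞` of the bounded solution of `f(x) = 1 + ∫_{-∞}^x V f`. -/
def scatter (V : Lp A 1 (volume : Measure ℝ)) : A := 1 + pairing V (fund V)

lemma fund_spec (V : Lp A 1 (volume : Measure ℝ)) (x : ℝ) :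
    fund V x = 1 + ∫ y in Iic x, V y * fund V y := by
  have h : fund V - volterra V (fund V) = BoundedContinuousFunction.const ℝ 1 :=
    resolventApply_sub _ (isUnit_one_sub_volterra V)
  have h2 : fund V x - volterra V (fund V) x = 1 := by
    rw [← BoundedContinuousFunction.sub_apply, h, BoundedContinuousFunction.const_apply]
  exact sub_eq_iff_eq_add.1 h2

lemma eq_fund {V : Lp A 1 (volume : Measure ℝ)} {f : ℝ →ᵇ A}
    (hf : ∀ x, f x = 1 + ∫ y in Iic x, V y * f y) : f = fund V := by
  refine eq_resolventApply (isUnit_one_sub_volterra V) ?_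
  ext x
  exact sub_eq_iff_eq_add.2 (hf x)

lemma differentiable_fund :
    Differentiable ℂ (fund : Lp A 1 (volume : Measure ℝ) → (ℝ →ᵇ A)) := by
  have h := differentiable_resolventApply (K := volterra (A := A))
    (BoundedContinuousFunction.const ℝ 1) isUnit_one_sub_volterra
  exact h

/-- The single source of both the continuity of scattering matrices under $L^1$ perturbation and
their analyticity in the spectral parameter. -/
lemma differentiable_scatter : Differentiable ℂ (scatter : Lp A 1 (volume : Measure ℝ) → A) := by
  intro V
  exact (differentiableAt_const _).add
    ((pairing.differentiableAt).clm_apply (differentiable_fund V))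

lemma tendsto_fund_atBot (V : Lp A 1 (volume : Measure ℝ)) :
    Tendsto (fund V) atBot (𝓝 1) := by
  have h : Tendsto (fun x : ℝ => ∫ y in Iic x, V y * fund V y) atBot (𝓝 0) :=
    tendsto_integral_Iic_zero tendsto_id
  rw [funext (fund_spec V)]
  simpa using h.const_add 1

lemma tendsto_fund_atTop (V : Lp A 1 (volume : Measure ℝ)) :
    Tendsto (fund V) atTop (𝓝 (scatter V)) := by
  have h := (aecover_Iic (μ := volume) (tendsto_id (α := ℝ) (x := atTop))).integral_tendsto_of_countably_generated
    (integrable_mul_bounded (integrable_coeFn V) (fund V))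
  rw [funext (fund_spec V)]
  exact h.const_add 1

end Volterra

end

end DNLS

namespace DNLS

noncomputable section

/-! ### The evolution and its limit for potentials given as functions -/

section Evolution

open Set
open scoped BoundedContinuousFunction

set_option linter.unusedSectionVars false

variable {A : Type*} [NormedRing A] [NormedAlgebra ℂ A] [CompleteSpace A]

open Classical in
/-- The bounded solution of `f' = V f` with `f → 1` at `-∞`, for integrable `V`. -/
def evo (V : ℝ → A) : ℝ →ᵇ A :=
  if h : Integrable V then fund (h.toL1 V) else BoundedContinuousFunction.const ℝ 1

/-- The limit of `evo V` at `+∞`. -/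
def scat (V : ℝ → A) : A := 1 + ∫ y, V y * evo V y

lemma evo_eq_fund {V : ℝ → A} (hV : Integrable V) : evo V = fund (hV.toL1 V) := dif_pos hV

lemma evo_spec {V : ℝ → A} (hV : Integrable V) (x : ℝ) :
    evo V x = 1 + ∫ y in Iic x, V y * evo V y := by
  rw [evo_eq_fund hV, fund_spec]
  congr 1
  refine integral_congr_ae (ae_restrict_of_ae ?_)
  filter_upwards [hV.coeFn_toL1] with y hy
  rw [hy]

lemma scat_eq_scatter {V : ℝ → A} (hV : Integrable V) : scat V = scatter (hV.toL1 V) := by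
  rw [scat, evo_eq_fund hV, scatter, pairing_apply]
  congr 1
  refine integral_congr_ae ?_
  filter_upwards [hV.coeFn_toL1] with y hy
  rw [hy]

lemma eq_evo {V : ℝ → A} (hV : Integrable V) {f : ℝ → A} (hf : Continuous f) {C : ℝ}
    (hC : ∀ x, ‖f x‖ ≤ C) (h : ∀ x, f x = 1 + ∫ y in Iic x, V y * f y) : f = evo V := by
  have h0 : BoundedContinuousFunction.ofNormedAddCommGroup f hf C hC = fund (hV.toL1 V) := by
    refine eq_fund fun x => ?_
    simp only [BoundedContinuousFunction.coe_ofNormedAddCommGroup]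
    rw [h x]
    congr 1
    refine integral_congr_ae (ae_restrict_of_ae ?_)
    filter_upwards [hV.coeFn_toL1] with y hy
    rw [hy]
  rw [evo_eq_fund hV, ← h0]
  rfl

lemma tendsto_evo_atBot {V : ℝ → A} (hV : Integrable V) : Tendsto (evo V) atBot (𝓝 1) := by
  rw [evo_eq_fund hV]; exact tendsto_fund_atBot _

lemma tendsto_evo_atTop {V : ℝ → A} (hV : Integrable V) :
    Tendsto (evo V) atTop (𝓝 (scat V)) := by
  rw [evo_eq_fund hV, scat_eq_scatter hV]; exact tendsto_fund_atTop _

lemma evo_sub {V : ℝ → A} (hV : Integrable V) (x y : ℝ) :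
    evo V y - evo V x = ∫ s in x..y, V s * evo V s := by
  rw [evo_spec hV x, evo_spec hV y, ← intervalIntegral.integral_Iic_sub_Iic
    (integrable_mul_bounded hV _).integrableOn (integrable_mul_bounded hV _).integrableOn]
  abel

lemma hasDerivAt_evo {V : ℝ → A} (hV : Integrable V) (hc : Continuous V) (x : ℝ) :
    HasDerivAt (evo V) (V x * evo V x) x := by
  have hm : Continuous fun y => V y * evo V y := hc.mul (evo V).continuous
  have e : (evo V : ℝ → A) = fun x => evo V 0 + ∫ y in (0:ℝ)..x, V y * evo V y := by
    ext x
    rw [← evo_sub hV]; abel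
  have h := (intervalIntegral.integral_hasDerivAt_right (hm.intervalIntegrable 0 x)
      (hm.stronglyMeasurableAtFilter _ _) hm.continuousAt).const_add (evo V 0)
  rw [← e] at h
  exact h

lemma eq_evo_of_hasDerivAt {V : ℝ → A} (hV : Integrable V) {f : ℝ → A}
    {C : ℝ} (hC : ∀ x, ‖f x‖ ≤ C) (hd : ∀ x, HasDerivAt f (V x * f x) x)
    (hbot : Tendsto f atBot (𝓝 1)) : f = evo V := by
  have hf : Continuous f := continuous_iff_continuousAt.2 fun x => (hd x).continuousAt
  refine eq_evo hV hf hC fun x => ?_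
  have hi : Integrable fun y => V y * f y :=
    integrable_mul_bounded hV (BoundedContinuousFunction.ofNormedAddCommGroup f hf C hC)
  rw [integral_Iic_of_hasDerivAt_of_tendsto' (fun y _ => hd y) hi.integrableOn hbot]
  abel

lemma norm_toL1_sub {V W : ℝ → A} (hV : Integrable V volume) (hW : Integrable W volume) :
    ‖hV.toL1 V - hW.toL1 W‖ = ∫ y, ‖V y - W y‖ := by
  rw [← Integrable.toL1_sub V W hV hW, L1.norm_eq_integral_norm]
  refine integral_congr_ae ?_
  filter_upwards [(hV.sub hW).coeFn_toL1] with y hy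
  rw [hy]; rfl

lemma tendsto_scat {V : ℝ → A} {W : ℕ → ℝ → A} (hV : Integrable V) (hW : ∀ n, Integrable (W n))
    (h : Tendsto (fun n => ∫ y, ‖W n y - V y‖) atTop (𝓝 0)) :
    Tendsto (fun n => scat (W n)) atTop (𝓝 (scat V)) := by
  rw [scat_eq_scatter hV]
  have h1 : Tendsto (fun n => (hW n).toL1 (W n)) atTop (𝓝 (hV.toL1 V)) := by
    rw [tendsto_iff_norm_sub_tendsto_zero]
    simpa only [norm_toL1_sub] using h
  have h2 := (differentiable_scatter (A := A)).continuous.tendsto (hV.toL1 V)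
  exact (h2.comp h1).congr fun n => (scat_eq_scatter (hW n)).symm

/-- A pointwise second-order Taylor bound with integrable majorant makes $m\mapsto V_m$
differentiable into $L^1$; the chain rule with `differentiable_scatter` does the rest. -/
lemma differentiableAt_scat {V : ℂ → ℝ → A} (hV : ∀ l, Integrable (V l)) {l : ℂ} {W : ℝ → A}
    (hW : Integrable W) {k : ℝ → ℝ} (hk : Integrable k)
    (h : ∀ᶠ m in 𝓝 l, ∀ x, ‖V m x - V l x - (m - l) • W x‖ ≤ ‖m - l‖ ^ 2 * k x) :
    DifferentiableAt ℂ (fun m => scat (V m)) l := by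
  have h1 : HasDerivAt (fun m => (hV m).toL1 (V m)) (hW.toL1 W) l := by
    rw [hasDerivAt_iff_isLittleO]
    have hO : (fun m => (hV m).toL1 (V m) - (hV l).toL1 (V l) - (m - l) • hW.toL1 W) =O[𝓝 l]
        fun m => ‖m - l‖ ^ 2 := by
      refine Asymptotics.IsBigO.of_bound (∫ x, k x) ?_
      filter_upwards [h] with m hm
      rw [← Integrable.toL1_sub _ _ (hV m) (hV l),
        ← Integrable.toL1_smul W hW (m - l), norm_toL1_sub]
      rw [Real.norm_eq_abs, abs_of_nonneg (by positivity), mul_comm, ← integral_const_mul]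
      refine integral_mono_of_nonneg (Eventually.of_forall fun _ => norm_nonneg _)
        (hk.const_mul _) (Eventually.of_forall hm)
    refine hO.trans_isLittleO ?_
    have h3 : Tendsto (fun m : ℂ => ‖m - l‖) (𝓝 l) (𝓝 0) := by
      have : Continuous fun m : ℂ => ‖m - l‖ := by fun_prop
      simpa using this.tendsto l
    have := (Asymptotics.isLittleO_one_iff ℝ).2 h3
    have h4 := this.mul_isBigO (Asymptotics.isBigO_refl (fun m : ℂ => ‖m - l‖) (𝓝 l))
    simp only [one_mul, ← pow_two] at h4
    exact h4.of_norm_right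
  have h2 := (differentiable_scatter (A := A) ((hV l).toL1 (V l))).comp l h1.differentiableAt
  exact h2.congr_of_eventuallyEq (Eventually.of_forall fun m => scat_eq_scatter (hV m))

/-- The integral equation gives $\|f-1\|\le\delta\|f\|$, hence $\|f\|\le1+\delta\|f\|$ and so
$\|f\|\le2$ for $\delta\le1/2$; inserting this once more gives the bound. -/
lemma norm_evo_sub_one_le [NormOneClass A] {V : ℝ → A} (hV : Integrable V) {δ : ℝ}
    (hδ : ∫ y, ‖V y‖ ≤ δ) (h2 : δ ≤ 1 / 2) (x : ℝ) : ‖evo V x - 1‖ ≤ 2 * δ := by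
  have hb : ∀ x, ‖evo V x - 1‖ ≤ δ * ‖evo V‖ := fun x => by
    rw [evo_spec hV x, add_sub_cancel_left]
    exact (norm_setIntegral_mul_le hV _ _).trans (by gcongr)
  have hδ0 : 0 ≤ δ := le_trans (by positivity) hδ
  have hn : ‖evo V‖ ≤ 1 + δ * ‖evo V‖ := by
    refine (BoundedContinuousFunction.norm_le (by positivity)).2 fun x => ?_
    calc ‖evo V x‖ = ‖1 + (evo V x - 1)‖ := by congr 1; abel
      _ ≤ ‖(1:A)‖ + ‖evo V x - 1‖ := norm_add_le _ _
      _ ≤ _ := by rw [norm_one]; gcongr; exact hb x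
  have : ‖evo V‖ ≤ 2 := by nlinarith [norm_nonneg (evo V)]
  exact (hb x).trans (by nlinarith)

end Evolution

end

end DNLS

namespace DNLS

noncomputable section

/-! ### Products and conjugation of scattering matrices -/

section Algebra

open Set
open scoped BoundedContinuousFunction

set_option linter.unusedSectionVars false

variable {A : Type*} [NormedRing A] [NormedAlgebra ℂ A] [CompleteSpace A]

lemma evo_eq_one {V : ℝ → A} (hV : Integrable V) {c : ℝ} (h : ∀ x, x < c → V x = 0) {x : ℝ}
    (hx : x ≤ c) : evo V x = 1 := by
  rw [evo_spec hV x, setIntegral_eq_zero_of_ae_eq_zero, add_zero]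
  filter_upwards [compl_mem_ae_iff.2 (measure_singleton c)] with y hy hyx
  rw [h y (lt_of_le_of_ne (le_trans hyx hx) hy), zero_mul]

/-- The scattering matrix of a sum of potentials with separated supports is a product. -/
lemma scat_add {V W : ℝ → A} (hV : Integrable V) (hW : Integrable W) (hVc : Continuous V)
    (hWc : Continuous W) {c : ℝ} (hV0 : ∀ x, c < x → V x = 0) (hW0 : ∀ x, x < c → W x = 0) :
    scat (fun x => V x + W x) = scat W * scat V := by
  have h : (fun x => evo W x * evo V x) = evo (fun x => V x + W x) := by
    refine eq_evo_of_hasDerivAt (hV.add hW) (C := ‖evo W‖ * ‖evo V‖) (fun x => ?_) (fun x => ?_) ?_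
    · exact (norm_mul_le _ _).trans (by gcongr <;> exact BoundedContinuousFunction.norm_coe_le_norm _ x)
    -- The product rule puts $V$ to the right of the evolution of $W$. Left of $c$ that evolution is
    -- still $1$, and right of $c$ the potential $V$ vanishes, so the order does not matter.
    · have := (hasDerivAt_evo hW hWc x).mul (hasDerivAt_evo hV hVc x)
      convert! this using 1
      rw [Pi.add_apply, add_mul]
      rcases le_or_gt x c with hx | hx
      · rw [evo_eq_one hW hW0 hx]; simp only [mul_one, one_mul, add_comm]
      · rw [hV0 x hx]; simp only [zero_mul, mul_zero, zero_add, add_zero, mul_assoc]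
    · simpa using (tendsto_evo_atBot hW).mul (tendsto_evo_atBot hV)
  refine tendsto_nhds_unique (tendsto_evo_atTop (hV.add hW)) ?_
  rw [← h]
  exact (tendsto_evo_atTop hW).mul (tendsto_evo_atTop hV)

lemma scat_conj {V : ℝ → A} (hV : Integrable V) (hVc : Continuous V) (u : Aˣ) :
    scat (fun x => u * V x * ↑u⁻¹) = u * scat V * ↑u⁻¹ := by
  have hi : Integrable fun x => (u : A) * V x * ↑u⁻¹ := (hV.const_mul _).mul_const _
  have h : (fun x => (u : A) * evo V x * ↑u⁻¹) = evo (fun x => u * V x * ↑u⁻¹) := by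
    refine eq_evo_of_hasDerivAt hi (C := ‖(u : A)‖ * ‖evo V‖ * ‖(↑u⁻¹ : A)‖) (fun x => ?_)
      (fun x => ?_) ?_
    · refine (norm_mul_le _ _).trans ?_
      gcongr
      exact (norm_mul_le _ _).trans (by gcongr; exact BoundedContinuousFunction.norm_coe_le_norm _ x)
    · have := ((hasDerivAt_evo hV hVc x).const_mul (u : A)).mul_const (↑u⁻¹ : A)
      convert! this using 1
      simp only [mul_assoc, Units.inv_mul_cancel_left]
    · simpa using ((tendsto_evo_atBot hV).const_mul (u : A)).mul_const (↑u⁻¹ : A)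
  refine tendsto_nhds_unique (tendsto_evo_atTop hi) ?_
  rw [← h]
  exact ((tendsto_evo_atTop hV).const_mul (u : A)).mul_const (↑u⁻¹ : A)

end Algebra

/-! ### Grönwall's inequality on a half-line -/

section Gronwall

open Set

/-- Grönwall's inequality on `(-∞, x]` in integral form. -/
lemma le_mul_exp_of_le_add_integral {f g : ℝ → ℝ} {c C : ℝ} (hf : Continuous f)
    (hfC : ∀ x, |f x| ≤ C) (hg : Continuous g) (hgi : Integrable g) (hg0 : ∀ x, 0 ≤ g x)
    (h : ∀ x, f x ≤ c + ∫ y in Iic x, g y * f y) (x : ℝ) :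
    f x ≤ c * Real.exp (∫ y in Iic x, g y) := by
  have hgf : Integrable fun y => g y * f y :=
    hgi.mul_bdd (c := C) hf.aestronglyMeasurable (Eventually.of_forall hfC)
  have prim : ∀ {k : ℝ → ℝ}, Continuous k → Integrable k → ∀ x,
      HasDerivAt (fun x => ∫ y in Iic x, k y) (k x) x := by
    intro k hk hki x
    have e : (fun x => ∫ y in Iic x, k y) = fun x => (∫ y in Iic 0, k y) + ∫ y in (0:ℝ)..x, k y := by
      ext x
      rw [← intervalIntegral.integral_Iic_sub_Iic hki.integrableOn hki.integrableOn]
      abel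
    rw [e]
    exact (intervalIntegral.integral_hasDerivAt_right (hk.intervalIntegrable _ _)
      (hk.stronglyMeasurableAtFilter _ _) hk.continuousAt).const_add _
  set F : ℝ → ℝ := fun x => c + ∫ y in Iic x, g y * f y with hF
  set G : ℝ → ℝ := fun x => ∫ y in Iic x, g y with hG
  have hFd : ∀ x, HasDerivAt F (g x * f x) x := fun x => (prim (hg.mul hf) hgf x).const_add c
  have hGd : ∀ x, HasDerivAt G (g x) x := prim hg hgi
  have hE : ∀ x, HasDerivAt (fun x => F x * Real.exp (-G x))
      (g x * f x * Real.exp (-G x) + F x * (Real.exp (-G x) * -g x)) x := fun x =>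
    (hFd x).mul (hGd x).neg.exp
  -- $F'=gf\le gF=G'F$, so the integrating factor makes this function decrease from its limit $c$ at
  -- $-\infty$.
  have hanti : Antitone fun x => F x * Real.exp (-G x) := by
    refine antitone_of_deriv_nonpos (fun x => (hE x).differentiableAt) fun x => ?_
    rw [(hE x).deriv]
    have : g x * f x * Real.exp (-G x) + F x * (Real.exp (-G x) * -g x)
        = -(Real.exp (-G x) * (g x * (F x - f x))) := by ring
    rw [this, neg_nonpos]
    exact mul_nonneg (Real.exp_pos _).le (mul_nonneg (hg0 x) (sub_nonneg.2 (h x)))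
  have hlim : Tendsto (fun x => F x * Real.exp (-G x)) atBot (𝓝 c) := by
    have h1 : Tendsto F atBot (𝓝 c) := by
      simpa using (tendsto_integral_Iic_zero (f := fun y => g y * f y) (tendsto_id (α := ℝ))).const_add c
    have h2 : Tendsto G atBot (𝓝 0) := tendsto_integral_Iic_zero tendsto_id
    simpa using h1.mul ((Real.continuous_exp.tendsto _).comp h2.neg)
  have h3 : F x * Real.exp (-G x) ≤ c := hanti.ge_of_tendsto hlim x
  calc f x ≤ F x := h x
    _ = F x * Real.exp (-G x) * Real.exp (G x) := by
      rw [mul_assoc, ← Real.exp_add, neg_add_cancel, Real.exp_zero, mul_one]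
    _ ≤ c * Real.exp (G x) := by gcongr

end Gronwall

/-! ### Two by two matrices: entries and determinants -/

section Matrices

attribute [local instance] Matrix.linftyOpNormedRing Matrix.linftyOpNormedAlgebra

/-- Complex `2 × 2` matrices. -/
abbrev M2 : Type := Matrix (Fin 2) (Fin 2) ℂ

/-- The norm topology of `M2`, in a form that unfolds at instance transparency. -/
abbrev normTopology : TopologicalSpace M2 := PseudoMetricSpace.toUniformSpace.toTopologicalSpace

attribute [local instance] normTopology

lemma norm_entry_le (M : M2) (i j : Fin 2) : ‖M i j‖ ≤ ‖M‖ := by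
  rw [Matrix.linfty_opNorm_def]
  have h1 : ‖M i j‖₊ ≤ ∑ j, ‖M i j‖₊ :=
    Finset.single_le_sum (f := fun j => ‖M i j‖₊) (fun _ _ => bot_le) (Finset.mem_univ j)
  have h2 : ∑ j, ‖M i j‖₊ ≤ Finset.univ.sup fun i => ∑ j, ‖M i j‖₊ :=
    Finset.le_sup (f := fun i => ∑ j, ‖M i j‖₊) (Finset.mem_univ i)
  exact_mod_cast h1.trans h2

lemma norm_le_sum_entries (M : M2) : ‖M‖ ≤ ‖M 0 0‖ + ‖M 0 1‖ + ‖M 1 0‖ + ‖M 1 1‖ := by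
  rw [Matrix.linfty_opNorm_def]
  have : (Finset.univ.sup fun i => ∑ j, ‖M i j‖₊) ≤
      ‖M 0 0‖₊ + ‖M 0 1‖₊ + ‖M 1 0‖₊ + ‖M 1 1‖₊ := by
    refine Finset.sup_le fun i _ => ?_
    rw [Fin.sum_univ_two]
    fin_cases i
    · exact le_add_right (le_add_right le_rfl)
    · rw [add_assoc (‖M 0 0‖₊ + ‖M 0 1‖₊)]
      exact le_add_left le_rfl
  exact_mod_cast this

lemma norm_M2_one : ‖(1 : M2)‖ = 1 := norm_one

/-- The entry of a matrix as a continuous linear map. -/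
def entry (i j : Fin 2) : M2 →L[ℂ] ℂ := LinearMap.toContinuousLinearMap (Matrix.entryLinearMap ℂ ℂ i j)

lemma hasDerivAt_entry {f : ℝ → M2} {f' : M2} {x : ℝ} (h : HasDerivAt f f' x) (i j : Fin 2) :
    HasDerivAt (fun x => f x i j) (f' i j) x :=
  ((entry i j).restrictScalars ℝ).hasFDerivAt.comp_hasDerivAt x h

lemma integral_entry {f : ℝ → M2} {μ : Measure ℝ} (hf : Integrable f μ) (i j : Fin 2) :
    (∫ x, f x ∂μ) i j = ∫ x, f x i j ∂μ :=
  ((entry i j).integral_comp_comm hf).symm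

lemma continuous_entry (i j : Fin 2) : Continuous fun M : M2 => M i j := (entry i j).continuous

lemma integrable_of_entries {f : ℝ → M2} (h : ∀ i j, Integrable fun x => f x i j) :
    Integrable f := by
  have e : f = fun x => ∑ i, ∑ j, (f x i j) • Matrix.single i j (1 : ℂ) := by
    ext x : 1
    conv_lhs => rw [Matrix.matrix_eq_sum_single (f x)]
    simp
  rw [e]
  exact integrable_finsetSum _ fun i _ => integrable_finsetSum _ fun j _ => (h i j).smul_const _

lemma continuous_of_entries {X : Type*} [TopologicalSpace X] {f : X → M2}
    (h : ∀ i j, Continuous fun x => f x i j) : Continuous f :=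
  continuous_matrix h

lemma hasDerivAt_of_entries {f : ℝ → M2} {f' : M2} {x : ℝ}
    (h : ∀ i j, HasDerivAt (fun x => f x i j) (f' i j) x) : HasDerivAt f f' x :=
  hasDerivAt_pi.2 fun i => hasDerivAt_pi.2 fun j => h i j

/-- Liouville's formula: the determinant has derivative trace times determinant, which is zero here,
and it tends to $1$ at $-\infty$. -/
lemma det_evo {V : ℝ → M2} (hV : Integrable V) (hc : Continuous V)
    (htr : ∀ x, V x 0 0 + V x 1 1 = 0) (x : ℝ) : (evo V x).det = 1 := by
  have hd : ∀ x, HasDerivAt (fun x => (evo V x).det) 0 x := by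
    intro x
    have h := fun i j => hasDerivAt_entry (hasDerivAt_evo hV hc x) i j
    have h2 := ((h 0 0).mul (h 1 1)).sub ((h 0 1).mul (h 1 0))
    simp only [Matrix.det_fin_two]
    convert! h2 using 1
    simp only [Matrix.mul_apply, Fin.sum_univ_two]
    linear_combination (-(evo V x 0 0 * evo V x 1 1 - evo V x 0 1 * evo V x 1 0)) * htr x
  have hconst : ∀ y, (evo V y).det = (evo V x).det := fun y =>
    is_const_of_deriv_eq_zero (fun x => (hd x).differentiableAt) (fun x => (hd x).deriv) y x
  have hlim : Tendsto (fun y => (evo V y).det) atBot (𝓝 (1 : M2).det) :=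
    ((Continuous.matrix_det continuous_id).tendsto _).comp (tendsto_evo_atBot hV)
  rw [Matrix.det_one] at hlim
  exact tendsto_nhds_unique ((tendsto_const_nhds (x := (evo V x).det)).congr fun y => (hconst y).symm) hlim

lemma det_scat {V : ℝ → M2} (hV : Integrable V) (hc : Continuous V)
    (htr : ∀ x, V x 0 0 + V x 1 1 = 0) : (scat V).det = 1 := by
  have hlim : Tendsto (fun y => (evo V y).det) atTop (𝓝 (scat V).det) :=
    ((Continuous.matrix_det continuous_id).tendsto _).comp (tendsto_evo_atTop hV)
  exact tendsto_nhds_unique hlim (tendsto_const_nhds.congr fun y => (det_evo hV hc htr y).symm)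

end Matrices

end

end DNLS

namespace DNLS

noncomputable section

/-! ### The Zakharov–Shabat system with continuous compactly supported potentials -/

section ZakharovShabat

open Set

attribute [local instance] Matrix.linftyOpNormedRing Matrix.linftyOpNormedAlgebra normTopology

/-- The Zakharov–Shabat potential with off-diagonal entries `q`, `p` in the interaction picture. -/
def zsPot (q p : ℝ → ℂ) (l : ℂ) (x : ℝ) : M2 :=
  !![0, q x * Complex.exp (2 * Complex.I * l * x);
    p x * Complex.exp (-(2 * Complex.I * l * x)), 0]

/-- Scattering matrix of the Zakharov–Shabat system. -/
def zsScat (q p : ℝ → ℂ) (l : ℂ) : M2 := scat (zsPot q p l)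

/-- A pair of continuous compactly supported functions. -/
structure IsTestPair (q p : ℝ → ℂ) : Prop where
  contq : Continuous q
  contp : Continuous p
  suppq : HasCompactSupport q
  suppp : HasCompactSupport p

variable {q p q' p' : ℝ → ℂ}

lemma IsTestPair.integrable_left (h : IsTestPair q p) : Integrable q :=
  h.contq.integrable_of_hasCompactSupport h.suppq

lemma IsTestPair.integrable_right (h : IsTestPair q p) : Integrable p :=
  h.contp.integrable_of_hasCompactSupport h.suppp

lemma continuous_zsPot (h : IsTestPair q p) (l : ℂ) : Continuous (zsPot q p l) := by
  have := h.contq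
  have := h.contp
  refine continuous_of_entries fun i j => ?_
  fin_cases i <;> fin_cases j <;> simp [zsPot] <;> fun_prop

lemma integrable_zsPot (h : IsTestPair q p) (l : ℂ) : Integrable (zsPot q p l) := by
  have h1 := h.contq
  have h2 := h.contp
  refine integrable_of_entries fun i j => ?_
  fin_cases i <;> fin_cases j <;> simp [zsPot]
  · exact Continuous.integrable_of_hasCompactSupport (by fun_prop) (h.suppq.mul_right)
  · exact Continuous.integrable_of_hasCompactSupport (by fun_prop) (h.suppp.mul_right)

lemma det_zsScat (h : IsTestPair q p) (l : ℂ) : (zsScat q p l).det = 1 :=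
  det_scat (integrable_zsPot h l) (continuous_zsPot h l) fun x => by simp [zsPot]

lemma exists_support_bound {f : ℝ → ℂ} (h : HasCompactSupport f) :
    ∃ R : ℝ, 0 ≤ R ∧ ∀ x, R < |x| → f x = 0 := by
  obtain ⟨R, hR⟩ := h.isCompact.isBounded.subset_closedBall 0
  refine ⟨max R 0, le_max_right _ _, fun x hx => ?_⟩
  by_contra hne
  have := hR (subset_tsupport f hne)
  rw [mem_closedBall_zero_iff, Real.norm_eq_abs] at this
  exact absurd (lt_of_le_of_lt (le_max_left _ _) hx) (not_lt.2 this)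

lemma norm_exp_quadratic {c w z : ℂ} (hw : ‖w‖ ≤ 1) (hz : z = c + w) :
    ‖Complex.exp z - Complex.exp c - w * Complex.exp c‖ ≤ ‖Complex.exp c‖ * ‖w‖ ^ 2 := by
  have : Complex.exp z - Complex.exp c - w * Complex.exp c =
      Complex.exp c * (Complex.exp w - 1 - w) := by rw [hz, Complex.exp_add]; ring
  rw [this, norm_mul]
  gcongr
  exact Complex.norm_exp_sub_one_sub_id_le hw

lemma differentiable_zsScat (h : IsTestPair q p) : Differentiable ℂ (zsScat q p) := by
  intro l
  obtain ⟨R, hR0, hR⟩ := exists_support_bound h.suppq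
  obtain ⟨R', hR0', hR'⟩ := exists_support_bound h.suppp
  set S := R + R' with hS
  have hcq := h.contq
  have hcp := h.contp
  set W : ℝ → M2 := fun x =>
    !![0, q x * (2 * Complex.I * x * Complex.exp (2 * Complex.I * l * x));
      p x * (-(2 * Complex.I * x) * Complex.exp (-(2 * Complex.I * l * x))), 0] with hW
  set k : ℝ → ℝ := fun x => ‖q x‖ * (‖Complex.exp (2 * Complex.I * l * x)‖ * (2 * |x|) ^ 2) +
    ‖p x‖ * (‖Complex.exp (-(2 * Complex.I * l * x))‖ * (2 * |x|) ^ 2) with hk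
  have hWi : Integrable W := by
    refine integrable_of_entries fun i j => ?_
    fin_cases i <;> fin_cases j <;> simp [hW]
    · exact Continuous.integrable_of_hasCompactSupport (by fun_prop) (h.suppq.mul_right)
    · exact (Continuous.integrable_of_hasCompactSupport (by fun_prop) (h.suppp.mul_right))
  have hki : Integrable k := by
    refine Integrable.add ?_ ?_
    · exact Continuous.integrable_of_hasCompactSupport (by fun_prop) (h.suppq.norm.mul_right)
    · exact Continuous.integrable_of_hasCompactSupport (by fun_prop) (h.suppp.norm.mul_right)
  refine differentiableAt_scat (fun l => integrable_zsPot h l) hWi hki ?_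
  -- The radius keeps $2|m-l||x|\le1$ on $|x|\le S$, outside of which both potentials vanish; this
  -- is the range in which `norm_exp_quadratic` applies.
  have hball : Metric.closedBall l (1 / (2 * S + 1)) ∈ 𝓝 l :=
    Metric.closedBall_mem_nhds _ (by positivity)
  filter_upwards [hball] with m hm x
  rw [mem_closedBall_iff_norm] at hm
  have hsmall : |x| ≤ S → ‖m - l‖ * (2 * |x|) ≤ 1 := fun hx => by
    calc ‖m - l‖ * (2 * |x|) ≤ 1 / (2 * S + 1) * (2 * S + 1) := by gcongr; linarith
      _ = 1 := by have : 2 * S + 1 ≠ 0 := by positivity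
                  field_simp
  have key : ∀ (f : ℂ) (s : ℂ), ‖s‖ = 1 → (S < |x| → f = 0) →
      ‖f * Complex.exp (s * (2 * Complex.I * m * x)) - f * Complex.exp (s * (2 * Complex.I * l * x))
        - (m - l) * (f * (s * (2 * Complex.I * x) * Complex.exp (s * (2 * Complex.I * l * x))))‖ ≤
      ‖m - l‖ ^ 2 * (‖f‖ * (‖Complex.exp (s * (2 * Complex.I * l * x))‖ * (2 * |x|) ^ 2)) := by
    intro f s hs hf
    rcases le_or_gt |x| S with hx | hx
    · have hn : ‖(m - l) * (s * (2 * Complex.I * x))‖ = ‖m - l‖ * (2 * |x|) := by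
        simp [hs]
      have h1 := norm_exp_quadratic (c := s * (2 * Complex.I * l * x))
        (w := (m - l) * (s * (2 * Complex.I * x))) (z := s * (2 * Complex.I * m * x))
        (by rw [hn]; exact hsmall hx) (by ring)
      rw [hn] at h1
      calc _ = ‖f * (Complex.exp (s * (2 * Complex.I * m * x)) -
              Complex.exp (s * (2 * Complex.I * l * x)) - (m - l) * (s * (2 * Complex.I * x)) *
              Complex.exp (s * (2 * Complex.I * l * x)))‖ := by congr 1; ring
        _ ≤ ‖f‖ * (‖Complex.exp (s * (2 * Complex.I * l * x))‖ * (‖m - l‖ * (2 * |x|)) ^ 2) := by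
          rw [norm_mul]; gcongr
        _ = _ := by ring
    · rw [hf hx]; simp
  have hq := key (q x) 1 norm_one (fun hx => hR x (by linarith))
  have hp := key (p x) (-1) (by simp) (fun hx => hR' x (by linarith))
  simp only [one_mul, neg_one_mul] at hq hp
  refine (norm_le_sum_entries _).trans ?_
  simp only [zsPot, hW, Matrix.sub_apply, Matrix.smul_apply, smul_eq_mul, Matrix.of_apply,
    Matrix.cons_val', Matrix.cons_val_zero, Matrix.cons_val_one, Matrix.cons_val_fin_one,
    sub_self, mul_zero, norm_zero, zero_add, add_zero]
  rw [hk]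
  dsimp only
  rw [mul_add]
  exact add_le_add hq hp

lemma zsScat_add (h : IsTestPair q p) (h' : IsTestPair q' p') {c : ℝ}
    (hq : ∀ x, c < x → q x = 0) (hp : ∀ x, c < x → p x = 0)
    (hq' : ∀ x, x < c → q' x = 0) (hp' : ∀ x, x < c → p' x = 0) (l : ℂ) :
    zsScat (fun x => q x + q' x) (fun x => p x + p' x) l = zsScat q' p' l * zsScat q p l := by
  have e : zsPot (fun x => q x + q' x) (fun x => p x + p' x) l =
      fun x => zsPot q p l x + zsPot q' p' l x := by
    ext x i j
    fin_cases i <;> fin_cases j <;> simp [zsPot, add_mul]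
  rw [zsScat, e]
  refine scat_add (integrable_zsPot h l) (integrable_zsPot h' l) (continuous_zsPot h l)
    (continuous_zsPot h' l) (c := c) (fun x hx => ?_) (fun x hx => ?_)
  · ext i j
    fin_cases i <;> fin_cases j <;> simp [zsPot, hq x hx, hp x hx]
  · ext i j
    fin_cases i <;> fin_cases j <;> simp [zsPot, hq' x hx, hp' x hx]

/-- Conjugating the potential by $\operatorname{diag}(c,1)$ multiplies its off-diagonal entries by
$c$ and $c^{-1}$, and the scattering matrix is conjugated along with it. -/
lemma zsScat_rotate (h : IsTestPair q p) {c : ℂ} (hc : c ≠ 0) (l : ℂ) :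
    zsScat (fun x => c * q x) (fun x => c⁻¹ * p x) l =
      !![zsScat q p l 0 0, c * zsScat q p l 0 1; c⁻¹ * zsScat q p l 1 0, zsScat q p l 1 1] := by
  let u : M2ˣ := ⟨!![c, 0; 0, 1], !![c⁻¹, 0; 0, 1],
    by ext i j; fin_cases i <;> fin_cases j <;> simp [hc],
    by ext i j; fin_cases i <;> fin_cases j <;> simp [hc]⟩
  have hconj : ∀ M : M2, (u : M2) * M * (↑u⁻¹ : M2) =
      !![M 0 0, c * M 0 1; c⁻¹ * M 1 0, M 1 1] := by
    intro M
    change !![c, 0; 0, 1] * M * !![c⁻¹, 0; 0, 1] = _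
    rw [Matrix.eta_fin_two M]
    ext i j
    fin_cases i <;> fin_cases j <;> simp [Matrix.mul_apply, Fin.sum_univ_two, mul_comm, hc]
  rw [← hconj, zsScat, zsScat, ← scat_conj (integrable_zsPot h l) (continuous_zsPot h l)]
  congr 1
  ext x : 1
  rw [hconj]
  ext i j
  fin_cases i <;> fin_cases j <;> simp [zsPot, mul_assoc]

lemma zsScat_zero (l : ℂ) : zsScat 0 0 l = 1 := by
  have : zsPot 0 0 l = 0 := by
    ext x i j
    fin_cases i <;> fin_cases j <;> simp [zsPot]
  simp [zsScat, scat, this]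

/-- First entry of the solution decaying to `e₁` at `-∞`. -/
def zsFst (q p : ℝ → ℂ) (l : ℂ) (x : ℝ) : ℂ := evo (zsPot q p l) x 0 0

/-- Second entry of that solution, with its oscillation removed. -/
def zsSnd (q p : ℝ → ℂ) (l : ℂ) (x : ℝ) : ℂ :=
  Complex.exp (2 * Complex.I * l * x) * evo (zsPot q p l) x 1 0

lemma integrable_pot_mul_evo (h : IsTestPair q p) (l : ℂ) :
    Integrable fun x => zsPot q p l x * evo (zsPot q p l) x :=
  integrable_mul_bounded (integrable_zsPot h l) _

lemma continuous_zsFst (q p : ℝ → ℂ) (l : ℂ) : Continuous (zsFst q p l) :=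
  (continuous_entry 0 0).comp (evo (zsPot q p l)).continuous

lemma continuous_zsSnd (q p : ℝ → ℂ) (l : ℂ) : Continuous (zsSnd q p l) := by
  have h : Continuous fun x => evo (zsPot q p l) x 1 0 :=
    (continuous_entry 1 0).comp (evo (zsPot q p l)).continuous
  unfold zsSnd
  fun_prop

lemma zsPot_mul_zero (l : ℂ) (x : ℝ) (M : M2) :
    (zsPot q p l x * M) 0 0 = q x * (Complex.exp (2 * Complex.I * l * x) * M 1 0) := by
  simp [zsPot, Matrix.mul_apply, Fin.sum_univ_two, mul_assoc]

lemma zsPot_mul_one (l : ℂ) (x : ℝ) (M : M2) :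
    (zsPot q p l x * M) 1 0 = p x * Complex.exp (-(2 * Complex.I * l * x)) * M 0 0 := by
  simp [zsPot, Matrix.mul_apply, Fin.sum_univ_two]

lemma zsFst_eq (h : IsTestPair q p) (l : ℂ) (x : ℝ) :
    zsFst q p l x = 1 + ∫ y in Iic x, q y * zsSnd q p l y := by
  rw [zsFst, evo_spec (integrable_zsPot h l), Matrix.add_apply,
    integral_entry (integrable_pot_mul_evo h l).integrableOn]
  simp only [zsPot_mul_zero]
  rfl

lemma zsScat_fst_eq (h : IsTestPair q p) (l : ℂ) :
    zsScat q p l 0 0 = 1 + ∫ y, q y * zsSnd q p l y := by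
  rw [zsScat, scat, Matrix.add_apply, integral_entry (integrable_pot_mul_evo h l)]
  simp only [zsPot_mul_zero]
  rfl

lemma zsScat_snd_eq (h : IsTestPair q p) (l : ℂ) :
    zsScat q p l 0 1 =
      ∫ y, q y * Complex.exp (2 * Complex.I * l * y) * evo (zsPot q p l) y 1 1 := by
  rw [zsScat, scat, Matrix.add_apply, integral_entry (integrable_pot_mul_evo h l)]
  simp [zsPot, Matrix.mul_apply, Fin.sum_univ_two]

/-- With the phase absorbed into the second entry, the kernel is $e^{2i\lambda(x-y)}$ with $y\le x$,
bounded by $1$ for $\operatorname{Im}\lambda\ge0$. All estimates uniform in the half-plane rest on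
this form. -/
lemma zsSnd_eq (h : IsTestPair q p) (l : ℂ) (x : ℝ) :
    zsSnd q p l x =
      ∫ y in Iic x, Complex.exp (2 * Complex.I * l * (x - y)) * (p y * zsFst q p l y) := by
  rw [zsSnd, evo_spec (integrable_zsPot h l), Matrix.add_apply,
    integral_entry (integrable_pot_mul_evo h l).integrableOn]
  simp only [zsPot_mul_one, Matrix.one_apply_ne (one_ne_zero : (1 : Fin 2) ≠ 0), zero_add]
  rw [← integral_const_mul]
  refine integral_congr_ae (Eventually.of_forall fun y => ?_)
  simp only [zsFst]
  rw [show 2 * Complex.I * l * (x - y) = 2 * Complex.I * l * x + -(2 * Complex.I * l * y) by ring,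
    Complex.exp_add]
  ring

lemma norm_exp_le_one {l : ℂ} (hl : 0 ≤ l.im) {t : ℝ} (ht : 0 ≤ t) :
    ‖Complex.exp (2 * Complex.I * l * t)‖ ≤ 1 := by
  rw [Complex.norm_exp]
  have : (2 * Complex.I * l * t).re = -(2 * l.im * t) := by simp
  rw [this, Real.exp_le_one_iff]
  have := mul_nonneg hl ht
  linarith

/-- Oscillatory Volterra integrals are bounded by the `L¹` norm for `Im λ ≥ 0`. -/
lemma norm_oscillatory_le {l : ℂ} (hl : 0 ≤ l.im) {f : ℝ → ℂ} {g : ℝ → ℝ} (hg : Integrable g)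
    (hfg : ∀ x, ‖f x‖ ≤ g x) (x : ℝ) :
    ‖∫ y in Iic x, Complex.exp (2 * Complex.I * l * (x - y)) * f y‖ ≤ ∫ y in Iic x, g y := by
  refine norm_integral_le_of_norm_le hg.integrableOn ?_
  filter_upwards [ae_restrict_mem measurableSet_Iic] with y hy
  rw [norm_mul]
  have h1 := norm_exp_le_one hl (t := x - y) (sub_nonneg.2 hy)
  push_cast at h1
  calc _ ≤ 1 * g y := by gcongr; exact hfg y
    _ = g y := one_mul _

lemma exists_bound_zsFst (q p : ℝ → ℂ) (l : ℂ) : ∃ C, ∀ x, ‖zsFst q p l x‖ ≤ C :=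
  ⟨‖evo (zsPot q p l)‖, fun x => (norm_entry_le _ _ _).trans
    (BoundedContinuousFunction.norm_coe_le_norm _ x)⟩

lemma exists_bound_zsSnd (h : IsTestPair q p) {l : ℂ} (hl : 0 ≤ l.im) :
    ∃ C, ∀ x, ‖zsSnd q p l x‖ ≤ C := by
  obtain ⟨C, hC⟩ := exists_bound_zsFst q p l
  have hi : Integrable fun y => ‖p y‖ * C := h.integrable_right.norm.mul_const C
  have hC0 : 0 ≤ C := (norm_nonneg _).trans (hC 0)
  refine ⟨∫ y, ‖p y‖ * C, fun x => ?_⟩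
  rw [zsSnd_eq h]
  refine (norm_oscillatory_le hl hi (fun y => ?_) x).trans
    (setIntegral_le_integral hi (Eventually.of_forall fun y => by positivity))
  rw [norm_mul]
  gcongr
  exact hC y

end ZakharovShabat

end

end DNLS

namespace DNLS

noncomputable section

/-! ### Bounds uniform in the closed upper half-plane, and decay at infinity -/

section ZakharovShabatBounds

open Set

attribute [local instance] Matrix.linftyOpNormedRing Matrix.linftyOpNormedAlgebra normTopology

variable {q p q' p' : ℝ → ℂ}

lemma tendsto_zsFst (h : IsTestPair q p) (l : ℂ) :
    Tendsto (zsFst q p l) atTop (𝓝 (zsScat q p l 0 0)) :=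
  ((continuous_entry 0 0).tendsto _).comp (tendsto_evo_atTop (integrable_zsPot h l))

lemma integrable_mul_of_bound {f u : ℝ → ℂ} (hf : Integrable f) (hu : Continuous u) {C : ℝ}
    (hC : ∀ x, ‖u x‖ ≤ C) : Integrable fun x => f x * u x :=
  hf.mul_bdd hu.aestronglyMeasurable (Eventually.of_forall hC)

/-- Subtract the two pairs of Volterra equations, writing $qv-q'v'=q(v-v')+(q-q')v'$ and likewise
for $pn$. The kernels are bounded by $1$, so Grönwall applies to the sum of both differences with a
bound independent of $\lambda$. -/
lemma norm_zs_sub_le (h : IsTestPair q p) (h' : IsTestPair q' p') {l : ℂ} (hl : 0 ≤ l.im) {M : ℝ}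
    (hn : ∀ x, ‖zsFst q' p' l x‖ ≤ M) (hv : ∀ x, ‖zsSnd q' p' l x‖ ≤ M) (x : ℝ) :
    ‖zsFst q p l x - zsFst q' p' l x‖ + ‖zsSnd q p l x - zsSnd q' p' l x‖ ≤
      (∫ y, (‖q y - q' y‖ + ‖p y - p' y‖)) * M * Real.exp (∫ y, (‖q y‖ + ‖p y‖)) := by
  have hM : 0 ≤ M := (norm_nonneg _).trans (hn 0)
  have := h.contq
  have := h.contp
  have cn := continuous_zsFst q p l
  have cv := continuous_zsSnd q p l
  have cn' := continuous_zsFst q' p' l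
  have cv' := continuous_zsSnd q' p' l
  obtain ⟨C1, hC1⟩ := exists_bound_zsFst q p l
  obtain ⟨C2, hC2⟩ := exists_bound_zsSnd h hl
  set n := zsFst q p l with hn_def
  set v := zsSnd q p l with hv_def
  set n' := zsFst q' p' l with hn'_def
  set v' := zsSnd q' p' l with hv'_def
  have bn : ∀ x, ‖n x - n' x‖ ≤ C1 + M := fun x =>
    (norm_sub_le _ _).trans (add_le_add (hC1 x) (hn x))
  have bv : ∀ x, ‖v x - v' x‖ ≤ C2 + M := fun x =>
    (norm_sub_le _ _).trans (add_le_add (hC2 x) (hv x))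
  have iq := h.integrable_left
  have ip := h.integrable_right
  have idq : Integrable fun y => q y - q' y := iq.sub h'.integrable_left
  have idp : Integrable fun y => p y - p' y := ip.sub h'.integrable_right
  set g : ℝ → ℝ := fun y => ‖q y‖ + ‖p y‖ with hg
  set d : ℝ → ℝ := fun y => ‖q y - q' y‖ + ‖p y - p' y‖ with hd
  set f : ℝ → ℝ := fun y => ‖n y - n' y‖ + ‖v y - v' y‖ with hf
  have cf : Continuous f := by fun_prop
  have bf : ∀ x, |f x| ≤ (C1 + M) + (C2 + M) := fun x => by
    rw [abs_of_nonneg (by positivity)]; exact add_le_add (bn x) (bv x)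
  have ig : Integrable g := iq.norm.add ip.norm
  have id' : Integrable d := idq.norm.add idp.norm
  have hd0 : 0 ≤ (∫ y, d y) * M := mul_nonneg (integral_nonneg fun y => by positivity) hM
  have igf : Integrable fun y => g y * f y :=
    ig.mul_bdd cf.aestronglyMeasurable (Eventually.of_forall bf)
  have i1 : Integrable fun y => ‖q y * (v y - v' y)‖ :=
    (integrable_mul_of_bound iq (by fun_prop) bv).norm
  have i2 : Integrable fun y => ‖p y * (n y - n' y)‖ :=
    (integrable_mul_of_bound ip (by fun_prop) bn).norm
  have i3 : Integrable fun y => ‖q y - q' y‖ * M := idq.norm.mul_const _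
  have i4 : Integrable fun y => ‖p y - p' y‖ * M := idp.norm.mul_const _
  have key : ∀ x, f x ≤ (∫ y, d y) * M + ∫ y in Iic x, g y * f y := by
    intro x
    have e1 : ‖n x - n' x‖ ≤ ∫ y in Iic x, (‖q y * (v y - v' y)‖ + ‖q y - q' y‖ * M) := by
      rw [hn_def, hn'_def, zsFst_eq h, zsFst_eq h', add_sub_add_left_eq_sub, ← integral_sub
        (integrable_mul_of_bound iq cv hC2).integrableOn
        (integrable_mul_of_bound h'.integrable_left cv' hv).integrableOn]
      refine norm_integral_le_of_norm_le (i1.add i3).integrableOn (Eventually.of_forall fun y => ?_)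
      calc ‖q y * v y - q' y * v' y‖ = ‖q y * (v y - v' y) + (q y - q' y) * v' y‖ := by
            congr 1; ring
        _ ≤ _ := (norm_add_le _ _).trans (by rw [norm_mul (q y - q' y)]; gcongr; exact hv y)
    have e2 : ‖v x - v' x‖ ≤ ∫ y in Iic x, (‖p y * (n y - n' y)‖ + ‖p y - p' y‖ * M) := by
      have j1 : IntegrableOn (fun y : ℝ => Complex.exp (2 * Complex.I * l * (x - y)) * (p y * n y))
          (Iic x) := by
        refine (integrable_mul_of_bound ip cn hC1).integrableOn.bdd_mul (c := 1) (by fun_prop) ?_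
        filter_upwards [ae_restrict_mem measurableSet_Iic] with y hy
        have h1 := norm_exp_le_one hl (t := x - y) (sub_nonneg.2 hy)
        push_cast at h1
        exact h1
      have j2 : IntegrableOn
          (fun y : ℝ => Complex.exp (2 * Complex.I * l * (x - y)) * (p' y * n' y)) (Iic x) := by
        refine (integrable_mul_of_bound h'.integrable_right cn' hn).integrableOn.bdd_mul (c := 1)
          (by fun_prop) ?_
        filter_upwards [ae_restrict_mem measurableSet_Iic] with y hy
        have h1 := norm_exp_le_one hl (t := x - y) (sub_nonneg.2 hy)
        push_cast at h1
        exact h1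
      rw [hv_def, hv'_def, zsSnd_eq h, zsSnd_eq h', ← integral_sub j1 j2]
      simp only [← mul_sub]
      refine norm_oscillatory_le hl (i2.add i4) (fun y => ?_) x
      calc ‖p y * n y - p' y * n' y‖ = ‖p y * (n y - n' y) + (p y - p' y) * n' y‖ := by
            congr 1; ring
        _ ≤ ‖p y * (n y - n' y)‖ + ‖p y - p' y‖ * M := (norm_add_le _ _).trans
          (by rw [norm_mul (p y - p' y)]; gcongr; exact hn y)
    have e3 : ∫ y in Iic x, d y * M ≤ (∫ y, d y) * M := by
      rw [← integral_mul_const]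
      exact setIntegral_le_integral (id'.mul_const _) (Eventually.of_forall fun y => by positivity)
    calc f x ≤ (∫ y in Iic x, (‖q y * (v y - v' y)‖ + ‖q y - q' y‖ * M)) +
          ∫ y in Iic x, (‖p y * (n y - n' y)‖ + ‖p y - p' y‖ * M) := add_le_add e1 e2
      _ = ∫ y in Iic x, ((‖q y * (v y - v' y)‖ + ‖q y - q' y‖ * M) +
          (‖p y * (n y - n' y)‖ + ‖p y - p' y‖ * M)) :=
        (integral_add (i1.add i3).integrableOn (i2.add i4).integrableOn).symm
      _ ≤ ∫ y in Iic x, (d y * M + g y * f y) := by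
        refine integral_mono ((i1.add i3).add (i2.add i4)).integrableOn
          ((id'.mul_const _).add igf).integrableOn fun y => ?_
        simp only [norm_mul, hd, hg, hf]
        nlinarith [mul_nonneg (norm_nonneg (q y)) (norm_nonneg (n y - n' y)),
          mul_nonneg (norm_nonneg (p y)) (norm_nonneg (v y - v' y))]
      _ = (∫ y in Iic x, d y * M) + ∫ y in Iic x, g y * f y :=
        integral_add (id'.mul_const _).integrableOn igf.integrableOn
      _ ≤ _ := by linarith [e3]
  refine (le_mul_exp_of_le_add_integral cf bf (by fun_prop) ig (fun y => by positivity) key x).trans ?_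
  exact mul_le_mul_of_nonneg_left (Real.exp_le_exp.2 (setIntegral_le_integral ig
    (Eventually.of_forall fun y => by positivity))) hd0

lemma isTestPair_zero : IsTestPair 0 0 :=
  ⟨continuous_zero, continuous_zero, HasCompactSupport.zero, HasCompactSupport.zero⟩

lemma evo_zsPot_zero (l : ℂ) (x : ℝ) : evo (zsPot 0 0 l) x = 1 :=
  evo_eq_one (c := x) (integrable_zsPot isTestPair_zero l)
    (fun y _ => by ext i j; fin_cases i <;> fin_cases j <;> simp [zsPot]) le_rfl

/-- Uniform bound for the solution decaying at `-∞`. -/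
lemma norm_zs_le (h : IsTestPair q p) {l : ℂ} (hl : 0 ≤ l.im) {K : ℝ}
    (hK : ∫ y, (‖q y‖ + ‖p y‖) ≤ K) (x : ℝ) :
    ‖zsFst q p l x‖ ≤ 1 + K * Real.exp K ∧ ‖zsSnd q p l x‖ ≤ 1 + K * Real.exp K := by
  have hf : ∀ x, zsFst 0 0 l x = 1 := fun x => by simp [zsFst, evo_zsPot_zero]
  have hs : ∀ x, zsSnd 0 0 l x = 0 := fun x => by simp [zsSnd, evo_zsPot_zero]
  have key := norm_zs_sub_le h isTestPair_zero hl (M := 1) (fun x => by simp [hf])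
    (fun x => by simp [hs]) x
  simp only [hf, hs, Pi.zero_apply, sub_zero, mul_one] at key
  have hKe : (∫ y, (‖q y‖ + ‖p y‖)) * Real.exp (∫ y, (‖q y‖ + ‖p y‖)) ≤ K * Real.exp K := by
    have : 0 ≤ ∫ y, (‖q y‖ + ‖p y‖) := integral_nonneg fun y => by positivity
    have : 0 ≤ K := this.trans hK
    gcongr
  have h1 : ‖zsFst q p l x‖ ≤ 1 + ‖zsFst q p l x - 1‖ := by
    have := norm_add_le 1 (zsFst q p l x - 1)
    simpa using this
  constructor
  · linarith [norm_nonneg (zsSnd q p l x)]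
  · linarith [norm_nonneg (zsFst q p l x - 1)]

/-- Lipschitz dependence of the first diagonal entry of the scattering matrix on the potential,
uniformly in the closed upper half-plane. -/
lemma norm_zsScat_sub_le (h : IsTestPair q p) (h' : IsTestPair q' p') {l : ℂ} (hl : 0 ≤ l.im)
    {K : ℝ} (hK : ∫ y, (‖q y‖ + ‖p y‖) ≤ K) (hK' : ∫ y, (‖q' y‖ + ‖p' y‖) ≤ K) :
    ‖zsScat q p l 0 0 - zsScat q' p' l 0 0‖ ≤
      (∫ y, (‖q y - q' y‖ + ‖p y - p' y‖)) * (1 + K * Real.exp K) * Real.exp K := by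
  refine le_of_tendsto ((tendsto_zsFst h l).sub (tendsto_zsFst h' l)).norm
    (Eventually.of_forall fun x => ?_)
  have key := norm_zs_sub_le h h' hl (fun x => (norm_zs_le h' hl hK' x).1)
    (fun x => (norm_zs_le h' hl hK' x).2) x
  have hK0 : 0 ≤ K := le_trans (integral_nonneg fun y => by positivity) hK
  have : 0 ≤ ∫ y, (‖q y - q' y‖ + ‖p y - p' y‖) := integral_nonneg fun y => by positivity
  calc _ ≤ _ := le_add_of_nonneg_right (norm_nonneg _)
    _ ≤ _ := key
    _ ≤ _ := by gcongr

/-- Integration by parts removes the oscillation at the cost of a factor `1 / λ`. -/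
lemma exists_norm_zsScat_sub_one_le (h : IsTestPair q p) {dp : ℝ → ℂ}
    (hdp : ∀ x, HasDerivAt p (dp x) x) (hdpc : Continuous dp) :
    ∃ C : ℝ, ∀ l : ℂ, 0 ≤ l.im → l ≠ 0 → ‖zsScat q p l 0 0 - 1‖ ≤ C / ‖l‖ := by
  have hdps : HasCompactSupport dp := by
    have e : dp = deriv p := funext fun x => (hdp x).deriv.symm
    rw [e]; exact h.suppp.deriv
  have hcq := h.contq
  have hcp := h.contp
  set K := ∫ y, (‖q y‖ + ‖p y‖) with hKdef
  set M := 1 + K * Real.exp K with hM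
  have hK0 : 0 ≤ K := integral_nonneg fun y => by positivity
  have hM0 : 0 ≤ M := by positivity
  set w : ℝ → ℝ := fun y => ‖dp y‖ * M + ‖p y‖ * ‖q y‖ * M with hw
  have hwi : Integrable w := by
    refine Integrable.add ?_ ?_
    · exact (hdpc.integrable_of_hasCompactSupport hdps).norm.mul_const _
    · exact (Continuous.integrable_of_hasCompactSupport (by fun_prop)
        (h.suppp.norm.mul_right)).mul_const _
  obtain ⟨P, hP⟩ := h.contp.bounded_above_of_compact_support h.suppp
  -- $PM$ bounds the boundary term of the integration by parts and $\int w$ the remaining integral;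
  -- the $2$ is that of the divisor $2i\lambda$.
  set B := (P * M + ∫ y, w y) / 2 with hB
  refine ⟨(∫ y, ‖q y‖) * B, fun l hl hl0 => ?_⟩
  have hlp : 0 < ‖l‖ := norm_pos_iff.2 hl0
  have h2l : (2 * Complex.I * l) ≠ 0 := by simp [hl0]
  have hn := fun x => (norm_zs_le h hl le_rfl x).1
  have hv := fun x => (norm_zs_le h hl le_rfl x).2
  set N := evo (zsPot q p l) with hN
  have hNd := fun x i j => hasDerivAt_entry
    (hasDerivAt_evo (integrable_zsPot h l) (continuous_zsPot h l) x) i j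
  have hv_bound : ∀ x, ‖zsSnd q p l x‖ ≤ B / ‖l‖ := by
    intro x
    -- The integration by parts in differential form: $N_{10}'=e^{-2i\lambda y}pN_{00}$ is cancelled
    -- by the derivative of the phase in the added term. What is left is $e^{-2i\lambda y}r$, where
    -- $r$ carries the factor $1/(2i\lambda)$.
    set u : ℝ → ℂ := fun y => N y 1 0 +
      Complex.exp (-(2 * Complex.I * l * y)) * (p y * N y 0 0) / (2 * Complex.I * l) with hu
    set r : ℝ → ℂ := fun y => (dp y * zsFst q p l y + p y * (q y * zsSnd q p l y)) /
      (2 * Complex.I * l) with hr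
    have hud : ∀ y : ℝ, HasDerivAt u (Complex.exp (-(2 * Complex.I * l * y)) * r y) y := by
      intro y
      have he : HasDerivAt (fun y : ℝ => Complex.exp (-(2 * Complex.I * l * y)))
          (Complex.exp (-(2 * Complex.I * l * y)) * (-(2 * Complex.I * l))) y := by
        have h1 : HasDerivAt (fun y : ℝ => -(2 * Complex.I * l * (y : ℂ))) (-(2 * Complex.I * l)) y := by
          have := ((Complex.ofRealCLM.hasDerivAt (x := y)).const_mul (2 * Complex.I * l)).fun_neg
          simpa using this
        exact h1.cexp
      have h1 := (hNd y 1 0).add ((he.mul ((hdp y).mul (hNd y 0 0))).div_const (2 * Complex.I * l))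
      rw [zsPot_mul_one, zsPot_mul_zero] at h1
      refine h1.congr_deriv ?_
      simp only [hr, zsFst, zsSnd]
      rw [← hN, Complex.exp_neg, Pi.mul_apply]
      have := Complex.exp_ne_zero (2 * Complex.I * l * y)
      field_simp
      ring
    have hub : Tendsto u atBot (𝓝 0) := by
      obtain ⟨R, -, hR⟩ := exists_support_bound h.suppp
      have h1 : Tendsto (fun y => N y 1 0) atBot (𝓝 ((1 : M2) 1 0)) :=
        ((continuous_entry 1 0).tendsto _).comp (tendsto_evo_atBot (integrable_zsPot h l))
      rw [Matrix.one_apply_ne (by decide)] at h1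
      refine h1.congr' ?_
      filter_upwards [eventually_lt_atBot (-R)] with y hy
      have : p y = 0 := hR y (by rw [lt_abs]; right; linarith)
      simp [hu, this]
    have hrb : ∀ y, ‖r y‖ ≤ w y / (2 * ‖l‖) := by
      intro y
      rw [hr]
      simp only [norm_div, norm_mul, Complex.norm_I, Complex.norm_ofNat, mul_one]
      gcongr
      refine (norm_add_le _ _).trans ?_
      rw [norm_mul, norm_mul, norm_mul, hw]
      dsimp only
      rw [mul_assoc ‖p y‖]
      gcongr
      · exact hn y
      · exact hv y
    have hrc : Continuous r := by
      have := continuous_zsFst q p l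
      have := continuous_zsSnd q p l
      simp only [hr]
      fun_prop
    have hrs : HasCompactSupport r := by
      have e : r = fun y => dp y * (zsFst q p l y / (2 * Complex.I * l)) +
          p y * (q y * zsSnd q p l y / (2 * Complex.I * l)) := by
        ext y; simp only [hr]; ring
      rw [e]
      exact (hdps.mul_right).add (h.suppp.mul_right)
    have hri : Integrable fun y : ℝ => Complex.exp (-(2 * Complex.I * l * y)) * r y :=
      Continuous.integrable_of_hasCompactSupport (by fun_prop) hrs.mul_left
    have hint := integral_Iic_of_hasDerivAt_of_tendsto' (a := x) (fun y _ => hud y)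
      hri.integrableOn hub
    have hsnd : zsSnd q p l x = (∫ y in Iic x, Complex.exp (2 * Complex.I * l * (x - y)) * r y) -
        p x * zsFst q p l x / (2 * Complex.I * l) := by
      have e : ∫ y in Iic x, Complex.exp (2 * Complex.I * l * (x - y)) * r y =
          Complex.exp (2 * Complex.I * l * x) * u x := by
        rw [← sub_zero (u x), ← hint, ← integral_const_mul]
        refine integral_congr_ae (Eventually.of_forall fun y => ?_)
        dsimp only
        rw [show 2 * Complex.I * l * (x - y) = 2 * Complex.I * l * x + -(2 * Complex.I * l * y) by
          ring, Complex.exp_add]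
        ring
      rw [e, zsSnd, zsFst, ← hN, hu]
      dsimp only
      rw [Complex.exp_neg]
      have := Complex.exp_ne_zero (2 * Complex.I * l * x)
      field_simp
      ring
    have hb1 := norm_oscillatory_le hl (hwi.div_const (2 * ‖l‖)) hrb x
    have hb2 : ∫ y in Iic x, w y / (2 * ‖l‖) ≤ (∫ y, w y) / (2 * ‖l‖) := by
      rw [← integral_div]
      exact setIntegral_le_integral (hwi.div_const _)
        (Eventually.of_forall fun y => by simp only [hw]; positivity)
    have hb3 : ‖p x * zsFst q p l x / (2 * Complex.I * l)‖ ≤ P * M / (2 * ‖l‖) := by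
      simp only [norm_div, norm_mul, Complex.norm_I, Complex.norm_ofNat, mul_one]
      have := (norm_nonneg _).trans (hP x)
      gcongr
      · exact hP x
      · exact hn x
    rw [hsnd]
    calc _ ≤ (∫ y, w y) / (2 * ‖l‖) + P * M / (2 * ‖l‖) :=
          (norm_sub_le _ _).trans (add_le_add (hb1.trans hb2) hb3)
      _ = B / ‖l‖ := by rw [hB]; field_simp; ring
  rw [zsScat_fst_eq h, add_sub_cancel_left]
  calc _ ≤ ∫ y, ‖q y‖ * (B / ‖l‖) := by
        refine norm_integral_le_of_norm_le (h.integrable_left.norm.mul_const _)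
          (Eventually.of_forall fun y => ?_)
        rw [norm_mul]; gcongr; exact hv_bound y
    _ = _ := by rw [integral_mul_const]; ring

end ZakharovShabatBounds

end

end DNLS

namespace DNLS

noncomputable section

/-! ### Integrability of elements of $H^{2,2}$ and of derivatives of test functions -/

section Sobolev

open Set

lemma norm_sq_eq_integral (f : Lp ℂ 2 (volume : Measure ℝ)) : ‖f‖ ^ 2 = ∫ x, ‖f x‖ ^ 2 := by
  have h1 := inner_self_eq_norm_sq_to_K (𝕜 := ℂ) f
  rw [L2.inner_def] at h1
  simp only [inner_self_eq_norm_sq_to_K] at h1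
  have h2 : ∫ x, (((‖f x‖ ^ 2 : ℝ)) : ℂ) = ((‖f‖ ^ 2 : ℝ) : ℂ) := by
    push_cast; exact h1
  exact (Complex.ofReal_injective (integral_complex_ofReal.symm.trans h2)).symm

lemma integral_mul_le_sqrt {f g : ℝ → ℝ} (hf0 : ∀ x, 0 ≤ f x) (hg0 : ∀ x, 0 ≤ g x)
    (hf : MemLp f 2) (hg : MemLp g 2) :
    ∫ x, f x * g x ≤ √(∫ x, f x ^ 2) * √(∫ x, g x ^ 2) := by
  have := integral_mul_le_Lp_mul_Lq_of_nonneg (μ := volume) Real.HolderConjugate.two_two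
    (Eventually.of_forall hf0) (Eventually.of_forall hg0) (by simpa using hf) (by simpa using hg)
  simpa [Real.sqrt_eq_rpow] using this

lemma one_le_weight (x : ℝ) : 1 ≤ (1 + |x|) ^ 2 := by nlinarith [abs_nonneg x]

lemma one_add_sq_le_weight (x : ℝ) : 1 + x ^ 2 ≤ (1 + |x|) ^ 2 := by
  nlinarith [abs_nonneg x, sq_abs x]

lemma memLp_sqrt_inv_weight : MemLp (fun x : ℝ => √((1 + x ^ 2)⁻¹)) 2 := by
  rw [memLp_two_iff_integrable_sq (by
    refine Continuous.aestronglyMeasurable ?_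
    exact (Continuous.inv₀ (by fun_prop) fun x => by positivity).sqrt)]
  refine integrable_inv_one_add_sq.congr (Eventually.of_forall fun x => ?_)
  exact (Real.sq_sqrt (by positivity)).symm

lemma integral_sqrt_inv_weight_sq : ∫ x : ℝ, √((1 + x ^ 2)⁻¹) ^ 2 = Real.pi := by
  rw [← integral_univ_inv_one_add_sq]
  exact integral_congr_ae (Eventually.of_forall fun x => Real.sq_sqrt (by positivity))

lemma norm_fst_le (q : H22) : ‖(q : PairSpace).fst‖ ≤ ‖q‖ := by
  have := WithLp.prod_norm_sq_eq_of_L2 (q : PairSpace)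
  refine abs_le_of_sq_le_sq' ?_ (norm_nonneg _) |>.2
  change _ ≤ ‖(q : PairSpace)‖ ^ 2
  nlinarith [sq_nonneg ‖(q : PairSpace).snd‖]

lemma norm_snd_le (q : H22) : ‖(q : PairSpace).snd‖ ≤ ‖q‖ := by
  have := WithLp.prod_norm_sq_eq_of_L2 (q : PairSpace)
  refine abs_le_of_sq_le_sq' ?_ (norm_nonneg _) |>.2
  change _ ≤ ‖(q : PairSpace)‖ ^ 2
  nlinarith [sq_nonneg ‖(q : PairSpace).fst‖]

lemma norm_potential (q : H22) (x : ℝ) :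
    ‖potential q x‖ = ‖(q : PairSpace).fst x‖ / (1 + |x|) ^ 2 := by
  rw [potential, norm_div, Complex.norm_real, Real.norm_eq_abs, abs_of_nonneg (by positivity)]

lemma aestronglyMeasurable_potential (q : H22) : AEStronglyMeasurable (potential q) volume := by
  have h1 : Continuous fun x : ℝ => ((((1 + |x|) ^ 2 : ℝ) : ℂ))⁻¹ := by
    refine Continuous.inv₀ (by fun_prop) fun x => ?_
    have := one_le_weight x
    exact_mod_cast (by positivity : (1 + |x|) ^ 2 ≠ 0)
  exact ((Lp.aestronglyMeasurable _).mul h1.aestronglyMeasurable).congr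
    (Eventually.of_forall fun x => (div_eq_mul_inv _ _).symm)

lemma integrable_norm_sq_Lp (f : Lp ℂ 2 (volume : Measure ℝ)) : Integrable fun x => ‖f x‖ ^ 2 :=
  (memLp_two_iff_integrable_sq_norm (Lp.aestronglyMeasurable f)).1 (Lp.memLp f)

lemma norm_potential_le (q : H22) (x : ℝ) : ‖potential q x‖ ≤ ‖(q : PairSpace).fst x‖ := by
  rw [norm_potential]
  exact div_le_self (norm_nonneg _) (one_le_weight x)

lemma integrable_norm_sq_potential (q : H22) : Integrable fun x => ‖potential q x‖ ^ 2 := by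
  refine (integrable_norm_sq_Lp (q : PairSpace).fst).mono
    ((aestronglyMeasurable_potential q).norm.pow 2) (Eventually.of_forall fun x => ?_)
  rw [Real.norm_eq_abs, Real.norm_eq_abs, abs_of_nonneg (by positivity),
    abs_of_nonneg (by positivity)]
  have := norm_potential_le q x
  gcongr

lemma memLp_potential (q : H22) : MemLp (potential q) 2 :=
  (memLp_two_iff_integrable_sq_norm (aestronglyMeasurable_potential q)).2
    (integrable_norm_sq_potential q)

lemma integral_norm_sq_potential_le (q : H22) : ∫ x, ‖potential q x‖ ^ 2 ≤ ‖q‖ ^ 2 := by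
  calc ∫ x, ‖potential q x‖ ^ 2 ≤ ∫ x, ‖(q : PairSpace).fst x‖ ^ 2 := by
        refine integral_mono (integrable_norm_sq_potential q) (integrable_norm_sq_Lp _) fun x => ?_
        have := norm_potential_le q x
        dsimp only
        gcongr
    _ = ‖(q : PairSpace).fst‖ ^ 2 := (norm_sq_eq_integral _).symm
    _ ≤ ‖q‖ ^ 2 := by gcongr; exact norm_fst_le q

/-- The weight is weakened from $(1+|x|)^{-2}$ to $(1+x^2)^{-1/2}$, whose square has integral $\pi$;
Cauchy–Schwarz then bounds the $L^1$ norm with constant $\sqrt\pi$. -/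
lemma norm_potential_le_mul (q : H22) (x : ℝ) :
    ‖potential q x‖ ≤ √((1 + x ^ 2)⁻¹) * ‖(q : PairSpace).fst x‖ := by
  rw [norm_potential, div_eq_mul_inv, mul_comm]
  have h1 : (0:ℝ) < 1 + x ^ 2 := by positivity
  gcongr
  calc ((1 + |x|) ^ 2)⁻¹ ≤ (1 + x ^ 2)⁻¹ := inv_anti₀ h1 (one_add_sq_le_weight x)
    _ ≤ √((1 + x ^ 2)⁻¹) := by
      refine Real.le_sqrt_of_sq_le ?_
      have h2 : (1 + x ^ 2)⁻¹ ≤ 1 := inv_le_one_of_one_le₀ (by nlinarith [sq_nonneg x])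
      have h3 : 0 < (1 + x ^ 2)⁻¹ := inv_pos.2 h1
      nlinarith

lemma integrable_potential (q : H22) : Integrable (potential q) := by
  have h := memLp_sqrt_inv_weight.integrable_mul (Lp.memLp (q : PairSpace).fst).norm
  refine h.mono (aestronglyMeasurable_potential q) (Eventually.of_forall fun x => ?_)
  refine (norm_potential_le_mul q x).trans (le_of_eq ?_)
  simp [abs_of_nonneg (Real.sqrt_nonneg _)]

lemma integral_norm_potential_le (q : H22) : ∫ x, ‖potential q x‖ ≤ √Real.pi * ‖q‖ := by
  have h := memLp_sqrt_inv_weight.integrable_mul (Lp.memLp (q : PairSpace).fst).norm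
  calc ∫ x, ‖potential q x‖ ≤ ∫ x, √((1 + x ^ 2)⁻¹) * ‖(q : PairSpace).fst x‖ :=
        integral_mono (integrable_potential q).norm h (norm_potential_le_mul q)
    _ ≤ √(∫ x : ℝ, √((1 + x ^ 2)⁻¹) ^ 2) * √(∫ x, ‖(q : PairSpace).fst x‖ ^ 2) :=
        integral_mul_le_sqrt (fun x => Real.sqrt_nonneg _) (fun x => norm_nonneg _)
          memLp_sqrt_inv_weight (Lp.memLp _).norm
    _ = √Real.pi * ‖(q : PairSpace).fst‖ := by
        rw [integral_sqrt_inv_weight_sq, ← norm_sq_eq_integral, Real.sqrt_sq (norm_nonneg _)]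
    _ ≤ _ := by gcongr; exact norm_fst_le q

lemma potential_sub (q r : H22) :
    potential (q - r) =ᵐ[volume] fun x => potential q x - potential r x := by
  filter_upwards [Lp.coeFn_sub (q : PairSpace).fst (r : PairSpace).fst] with x hx
  simp only [potential]
  have : ((q - r : H22) : PairSpace).fst = (q : PairSpace).fst - (r : PairSpace).fst := rfl
  rw [this, hx, Pi.sub_apply, sub_div]

/-- Test functions: smooth with compact support. -/
structure IsTest (u : ℝ → ℂ) : Prop where
  smooth : ContDiff ℝ ∞ u
  supp : HasCompactSupport u

variable {u v : ℝ → ℂ}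

lemma IsTest.add (hu : IsTest u) (hv : IsTest v) : IsTest (fun x => u x + v x) :=
  ⟨hu.smooth.add hv.smooth, hu.supp.add hv.supp⟩

lemma IsTest.const_mul (hu : IsTest u) (c : ℂ) : IsTest (fun x => c * u x) :=
  ⟨contDiff_const.mul hu.smooth, hu.supp.mul_left⟩

lemma IsTest.sub (hu : IsTest u) (hv : IsTest v) : IsTest (fun x => u x - v x) :=
  ⟨hu.smooth.sub hv.smooth, hu.supp.sub hv.supp⟩

lemma IsTest.smooth_deriv (hu : IsTest u) : ContDiff ℝ ∞ (deriv u) :=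
  (contDiff_infty_iff_deriv.1 hu.smooth).2

lemma IsTest.deriv (hu : IsTest u) : IsTest (deriv u) := ⟨hu.smooth_deriv, hu.supp.deriv⟩

lemma IsTest.hasDerivAt (hu : IsTest u) (x : ℝ) : HasDerivAt u (_root_.deriv u x) x :=
  ((hu.smooth.differentiable (by simp)) x).hasDerivAt

lemma IsTest.continuous (hu : IsTest u) : Continuous u := hu.smooth.continuous

lemma IsTest.integrable (hu : IsTest u) : Integrable u :=
  hu.continuous.integrable_of_hasCompactSupport hu.supp

lemma IsTest.memLp_weight (hu : IsTest u) : MemLp (fun x => (((1 + |x|) ^ 2 : ℝ) : ℂ) * u x) 2 := by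
  have := hu.continuous
  exact Continuous.memLp_of_hasCompactSupport (by fun_prop) hu.supp.mul_left

lemma IsTest.memLp (hu : IsTest u) : MemLp u 2 :=
  hu.continuous.memLp_of_hasCompactSupport hu.supp

/-- The element of `H^{2,2}` given by a test function. -/
def emb (hu : IsTest u) : H22 :=
  ⟨WithLp.toLp 2 (hu.memLp_weight.toLp _, hu.deriv.deriv.memLp.toLp _),
    subset_closure ⟨u, hu.smooth, hu.supp, hu.memLp_weight.coeFn_toLp,
      hu.deriv.deriv.memLp.coeFn_toLp⟩⟩

lemma exists_emb_near (q : H22) {ε : ℝ} (hε : 0 < ε) :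
    ∃ (u : ℝ → ℂ) (hu : IsTest u), ‖emb hu - q‖ < ε := by
  obtain ⟨p, ⟨u, hu, hc, h1, h2⟩, hp⟩ := Metric.mem_closure_iff.1 q.2 ε hε
  refine ⟨u, ⟨hu, hc⟩, ?_⟩
  have e : ((emb ⟨hu, hc⟩ : H22) : PairSpace) = p := by
    refine WithLp.ofLp_injective 2 (Prod.ext ?_ ?_)
    · exact Lp.ext ((IsTest.memLp_weight ⟨hu, hc⟩).coeFn_toLp.trans h1.symm)
    · exact Lp.ext ((IsTest.deriv (IsTest.deriv ⟨hu, hc⟩)).memLp.coeFn_toLp.trans h2.symm)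
  change ‖((emb ⟨hu, hc⟩ : H22) : PairSpace) - (q : PairSpace)‖ < ε
  rw [e, ← dist_eq_norm, dist_comm]
  exact hp

lemma emb_sub (hu : IsTest u) (hv : IsTest v) : emb hu - emb hv = emb (hu.sub hv) := by
  refine Subtype.ext (WithLp.ofLp_injective 2 (Prod.ext ?_ ?_))
  · change hu.memLp_weight.toLp _ - hv.memLp_weight.toLp _ = (hu.sub hv).memLp_weight.toLp _
    rw [← MemLp.toLp_sub]
    congr 1
    ext x
    simp [mul_sub]
  · change hu.deriv.deriv.memLp.toLp _ - hv.deriv.deriv.memLp.toLp _ =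
      (hu.sub hv).deriv.deriv.memLp.toLp _
    rw [← MemLp.toLp_sub]
    congr 1
    have e : _root_.deriv (fun x => u x - v x) = fun x => _root_.deriv u x - _root_.deriv v x :=
      funext fun x => ((hu.hasDerivAt x).sub (hv.hasDerivAt x)).deriv
    rw [e]
    exact (funext fun x => ((hu.deriv.hasDerivAt x).sub (hv.deriv.hasDerivAt x)).deriv).symm

lemma emb_const_mul (hu : IsTest u) (c : ℂ) : emb (hu.const_mul c) = c • emb hu := by
  refine Subtype.ext (WithLp.ofLp_injective 2 (Prod.ext ?_ ?_))
  · change (hu.const_mul c).memLp_weight.toLp _ = c • hu.memLp_weight.toLp _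
    rw [← MemLp.toLp_const_smul]
    congr 1
    ext x
    simp only [Pi.smul_apply, smul_eq_mul]
    ring
  · change (hu.const_mul c).deriv.deriv.memLp.toLp _ = c • hu.deriv.deriv.memLp.toLp _
    rw [← MemLp.toLp_const_smul]
    congr 1
    have e : _root_.deriv (fun x => c * u x) = fun x => c * _root_.deriv u x :=
      funext fun x => ((hu.hasDerivAt x).const_mul c).deriv
    rw [e]
    exact funext fun x => ((hu.deriv.hasDerivAt x).const_mul c).deriv

lemma potential_emb (hu : IsTest u) : potential (emb hu) =ᵐ[volume] u := by
  filter_upwards [hu.memLp_weight.coeFn_toLp] with x hx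
  rw [potential]
  change (hu.memLp_weight.toLp _ : ℝ → ℂ) x / _ = _
  rw [hx]
  have h : (((1 + |x|) ^ 2 : ℝ) : ℂ) ≠ 0 := by
    have := one_le_weight x
    exact_mod_cast (by positivity : (1 + |x|) ^ 2 ≠ 0)
  field_simp

lemma integral_norm_le_emb (hu : IsTest u) : ∫ x, ‖u x‖ ≤ √Real.pi * ‖emb hu‖ := by
  refine le_of_eq_of_le (integral_congr_ae ?_) (integral_norm_potential_le (emb hu))
  filter_upwards [potential_emb hu] with x hx
  rw [hx]

lemma integral_weight_norm_sq (hu : IsTest u) :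
    ∫ x, (((1 + |x|) ^ 2) * ‖u x‖) ^ 2 ≤ ‖emb hu‖ ^ 2 := by
  have h1 : ∫ x, (((1 + |x|) ^ 2) * ‖u x‖) ^ 2 = ‖((emb hu : H22) : PairSpace).fst‖ ^ 2 := by
    rw [norm_sq_eq_integral]
    refine integral_congr_ae ?_
    filter_upwards [hu.memLp_weight.coeFn_toLp] with x hx
    change _ = ‖(hu.memLp_weight.toLp _ : ℝ → ℂ) x‖ ^ 2
    rw [hx, norm_mul, Complex.norm_real, Real.norm_eq_abs,
      abs_of_nonneg (zero_le_one.trans (one_le_weight x))]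
  rw [h1]
  gcongr
  exact norm_fst_le _

lemma integral_norm_sq_deriv_deriv (hu : IsTest u) :
    ∫ x, ‖deriv (deriv u) x‖ ^ 2 ≤ ‖emb hu‖ ^ 2 := by
  have h1 : ∫ x, ‖deriv (deriv u) x‖ ^ 2 = ‖((emb hu : H22) : PairSpace).snd‖ ^ 2 := by
    rw [norm_sq_eq_integral]
    refine integral_congr_ae ?_
    filter_upwards [hu.deriv.deriv.memLp.coeFn_toLp] with x hx
    change _ = ‖(hu.deriv.deriv.memLp.toLp _ : ℝ → ℂ) x‖ ^ 2
    rw [hx]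
  rw [h1]
  gcongr
  exact norm_snd_le _

lemma hasDerivAt_star {f : ℝ → ℂ} {f' : ℂ} {x : ℝ} (h : HasDerivAt f f' x) :
    HasDerivAt (fun x => (starRingEnd ℂ) (f x)) ((starRingEnd ℂ) f') x := by
  have := (Complex.conjCLE.toContinuousLinearMap.hasFDerivAt (x := f x)).comp_hasDerivAt x h
  exact this

lemma integrable_weight_mul_deriv_deriv (hu : IsTest u) : Integrable fun x : ℝ => ‖u x‖ ^ 2 -
    (1 + x ^ 2) * (deriv (deriv u) x * (starRingEnd ℂ) (u x)).re := by
  have c0 := hu.continuous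
  have c2 := hu.deriv.deriv.continuous
  refine Integrable.sub ?_ ?_
  · simp only [sq]
    exact Continuous.integrable_of_hasCompactSupport (by fun_prop) hu.supp.norm.mul_right
  · refine Continuous.integrable_of_hasCompactSupport (by fun_prop) ?_
    refine HasCompactSupport.mul_left ?_
    exact (hu.deriv.deriv.supp.mul_right (f' := fun x => (starRingEnd ℂ) (u x))).comp_left
      (g := Complex.re) rfl

/-- Two integrations by parts: the derivative is moved off one factor $u'$, and the derivative of
the weight then falls on $|u|^2$. -/
lemma integral_weight_norm_sq_deriv (hu : IsTest u) :
    ∫ x, (1 + x ^ 2) * ‖deriv u x‖ ^ 2 =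
      ∫ x, (‖u x‖ ^ 2 - (1 + x ^ 2) * (deriv (deriv u) x * (starRingEnd ℂ) (u x)).re) := by
  have c0 := hu.continuous
  have c1 := hu.deriv.continuous
  have c2 := hu.deriv.deriv.continuous
  have i1 : Integrable fun x : ℝ => (1 + x ^ 2) * ‖deriv u x‖ ^ 2 := by
    have : (fun x : ℝ => (1 + x ^ 2) * ‖deriv u x‖ ^ 2) =
        fun x : ℝ => ‖deriv u x‖ * ((1 + x ^ 2) * ‖deriv u x‖) := by ext x; ring
    rw [this]
    exact Continuous.integrable_of_hasCompactSupport (by fun_prop) hu.deriv.supp.norm.mul_right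
  have i2 := integrable_weight_mul_deriv_deriv hu
  rw [← sub_eq_zero, ← integral_sub i1 i2]
  set s : ℂ → ℂ := DFunLike.coe (starRingEnd ℂ) with hs
  -- The function $\frac12(1+x^2)(|u|^2)'-x|u|^2$ is a compactly supported antiderivative of the
  -- difference of the two integrands, so that difference integrates to zero.
  set F : ℝ → ℂ := fun x => (1 + (x:ℂ) ^ 2) * (deriv u x * s (u x) + u x * s (deriv u x)) / 2 -
    x * (u x * s (u x)) with hF
  have hFd : ∀ x, HasDerivAt F (((1 + x ^ 2) * ‖deriv u x‖ ^ 2 - (‖u x‖ ^ 2 -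
      (1 + x ^ 2) * (deriv (deriv u) x * s (u x)).re) : ℝ) : ℂ) x := by
    intro x
    have hx : HasDerivAt (fun x : ℝ => (x : ℂ)) 1 x := by
      simpa using (hasDerivAt_id x).ofReal_comp
    have h0 := hu.hasDerivAt x
    have h1 := hu.deriv.hasDerivAt x
    have h0s := hasDerivAt_star h0
    have h1s := hasDerivAt_star h1
    have hw := (hx.pow 2).const_add 1
    have := ((hw.mul ((h1.mul h0s).add (h0.mul h1s))).div_const 2).sub (hx.mul (h0.mul h0s))
    refine this.congr_deriv ?_
    have e1 : ((‖deriv u x‖ ^ 2 : ℝ) : ℂ) = deriv u x * s (deriv u x) := by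
      rw [hs, Complex.mul_conj, Complex.normSq_eq_norm_sq]
    have e2 : ((‖u x‖ ^ 2 : ℝ) : ℂ) = u x * s (u x) := by
      rw [hs, Complex.mul_conj, Complex.normSq_eq_norm_sq]
    have e3 : (((deriv (deriv u) x * s (u x)).re : ℝ) : ℂ) =
        (deriv (deriv u) x * s (u x) + u x * s (deriv (deriv u) x)) / 2 := by
      rw [Complex.re_eq_add_conj, hs, map_mul, Complex.conj_conj]
      ring
    have e4 : (((1 + x ^ 2) * ‖deriv u x‖ ^ 2 - (‖u x‖ ^ 2 -
      (1 + x ^ 2) * (deriv (deriv u) x * s (u x)).re) : ℝ) : ℂ) =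
      (1 + (x:ℂ) ^ 2) * ((‖deriv u x‖ ^ 2 : ℝ) : ℂ) - (((‖u x‖ ^ 2 : ℝ) : ℂ) -
      (1 + (x:ℂ) ^ 2) * (((deriv (deriv u) x * s (u x)).re : ℝ) : ℂ)) := by push_cast; rfl
    rw [e4, e1, e2, e3]
    simp only [Pi.mul_apply, Pi.add_apply, Pi.pow_apply]
    ring
  have hFi : Integrable F := by
    have cs : Continuous s := Complex.continuous_conj
    refine Integrable.sub ?_ ?_
    · refine Continuous.integrable_of_hasCompactSupport (by fun_prop) ?_
      have : (fun x : ℝ => (1 + (x:ℂ) ^ 2) * (deriv u x * s (u x) + u x * s (deriv u x)) / 2) =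
        fun x : ℝ => (deriv u x * s (u x) + u x * s (deriv u x)) * ((1 + (x:ℂ) ^ 2) / 2) := by
        ext x; ring
      rw [this]
      exact (hu.deriv.supp.mul_right.add hu.supp.mul_right).mul_right
    · exact Continuous.integrable_of_hasCompactSupport (by fun_prop) hu.supp.mul_right.mul_left
  have h := integral_eq_zero_of_hasDerivAt_of_integrable hFd (i1.sub i2).ofReal hFi
  exact Complex.ofReal_injective (integral_complex_ofReal.symm.trans h)

/-- The norm sees only $u$ and $u''$. The identity above and Cauchy–Schwarz bound
$\int(1+x^2)|u'|^2$ by $2\|u\|^2$ in the $H^{2,2}$ norm, and the weight $(1+x^2)^{-1/2}\in L^2$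
passes from there to $L^1$. -/
lemma integral_norm_deriv_le_emb (hu : IsTest u) :
    ∫ x, ‖deriv u x‖ ≤ √(2 * Real.pi) * ‖emb hu‖ := by
  have c0 := hu.continuous
  have c1 := hu.deriv.continuous
  have c2 := hu.deriv.deriv.continuous
  set a : ℝ → ℝ := fun x => (1 + |x|) ^ 2 * ‖u x‖ with ha
  have ca : Continuous a := by fun_prop
  have ma : MemLp a 2 := ca.memLp_of_hasCompactSupport hu.supp.norm.mul_left
  have mb : MemLp (fun x => ‖deriv (deriv u) x‖) 2 := hu.deriv.deriv.memLp.norm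
  have ha0 : ∀ x, 0 ≤ a x := fun x => by positivity
  have ia := ma.integrable_sq
  have iab := mb.integrable_mul ma
  have hJ : ∫ x, (1 + x ^ 2) * ‖deriv u x‖ ^ 2 ≤ 2 * ‖emb hu‖ ^ 2 := by
    rw [integral_weight_norm_sq_deriv hu]
    calc _ ≤ ∫ x, (a x ^ 2 + ‖deriv (deriv u) x‖ * a x) := by
          refine integral_mono (integrable_weight_mul_deriv_deriv hu) (ia.add iab) fun x => ?_
          have h1 : ‖u x‖ ≤ a x := le_mul_of_one_le_left (norm_nonneg _) (one_le_weight x)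
          have h2 : (1 + x ^ 2) * ‖u x‖ ≤ a x :=
            mul_le_mul_of_nonneg_right (one_add_sq_le_weight x) (norm_nonneg _)
          have h3 := neg_le_of_abs_le
            (Complex.abs_re_le_norm (deriv (deriv u) x * (starRingEnd ℂ) (u x)))
          rw [norm_mul, RCLike.norm_conj] at h3
          have h4 : ‖u x‖ ^ 2 ≤ a x ^ 2 := by gcongr
          have h5 : -((1 + x ^ 2) * (deriv (deriv u) x * (starRingEnd ℂ) (u x)).re) ≤
              ‖deriv (deriv u) x‖ * a x := by
            calc _ = (1 + x ^ 2) * -(deriv (deriv u) x * (starRingEnd ℂ) (u x)).re := by ring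
              _ ≤ (1 + x ^ 2) * (‖deriv (deriv u) x‖ * ‖u x‖) := by gcongr; linarith
              _ = ‖deriv (deriv u) x‖ * ((1 + x ^ 2) * ‖u x‖) := by ring
              _ ≤ _ := by gcongr
          change ‖u x‖ ^ 2 - _ ≤ a x ^ 2 + ‖deriv (deriv u) x‖ * a x
          linarith
      _ = (∫ x, a x ^ 2) + ∫ x, ‖deriv (deriv u) x‖ * a x := integral_add ia iab
      _ ≤ ‖emb hu‖ ^ 2 + √(∫ x, ‖deriv (deriv u) x‖ ^ 2) * √(∫ x, a x ^ 2) :=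
          add_le_add (integral_weight_norm_sq hu)
            (integral_mul_le_sqrt (fun x => norm_nonneg _) ha0 mb ma)
      _ ≤ ‖emb hu‖ ^ 2 + √(‖emb hu‖ ^ 2) * √(‖emb hu‖ ^ 2) := by
          gcongr
          · exact integral_norm_sq_deriv_deriv hu
          · exact integral_weight_norm_sq hu
      _ = _ := by rw [Real.mul_self_sqrt (by positivity)]; ring
  have m1 : MemLp (fun x : ℝ => √(1 + x ^ 2) * ‖deriv u x‖) 2 :=
    Continuous.memLp_of_hasCompactSupport (by fun_prop) hu.deriv.supp.norm.mul_left
  calc ∫ x, ‖deriv u x‖ = ∫ x : ℝ, √((1 + x ^ 2)⁻¹) * (√(1 + x ^ 2) * ‖deriv u x‖) := by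
        congr 1
        ext x
        rw [← mul_assoc, ← Real.sqrt_mul (by positivity), inv_mul_cancel₀ (by positivity)]
        simp
    _ ≤ √(∫ x : ℝ, √((1 + x ^ 2)⁻¹) ^ 2) * √(∫ x, (√(1 + x ^ 2) * ‖deriv u x‖) ^ 2) :=
        integral_mul_le_sqrt (fun x => Real.sqrt_nonneg _) (fun x => by positivity)
          memLp_sqrt_inv_weight m1
    _ = √Real.pi * √(∫ x, (1 + x ^ 2) * ‖deriv u x‖ ^ 2) := by
        rw [integral_sqrt_inv_weight_sq]
        congr 3
        ext x
        rw [mul_pow, Real.sq_sqrt (by positivity)]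
    _ ≤ √Real.pi * √(2 * ‖emb hu‖ ^ 2) := by gcongr
    _ = _ := by
        rw [Real.sqrt_mul (by norm_num), Real.sqrt_sq (norm_nonneg _),
          Real.sqrt_mul (by norm_num)]
        ring

lemma norm_le_integral_norm_deriv (hu : IsTest u) (x : ℝ) : ‖u x‖ ≤ ∫ y, ‖deriv u y‖ := by
  have h := HasCompactSupport.integral_Iic_deriv_eq (hu.smooth.of_le (by simp)) hu.supp x
  rw [← h]
  exact (norm_integral_le_integral_norm _).trans (setIntegral_le_integral
    hu.deriv.integrable.norm (Eventually.of_forall fun y => norm_nonneg _))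

end Sobolev

end

end DNLS

namespace DNLS

noncomputable section

/-! ### Gauge equivalence of the Kaup–Newell and Zakharov–Shabat systems -/

section Gauge

open Set

attribute [local instance] Matrix.linftyOpNormedRing Matrix.linftyOpNormedAlgebra normTopology

/-- The second potential of the Zakharov–Shabat system that is gauge equivalent to the
Kaup–Newell system with potential `u`. -/
def dual (u : ℝ → ℂ) (x : ℝ) : ℂ :=
  Complex.I / 2 * (starRingEnd ℂ) (deriv u x) -
    1 / 4 * (u x * (starRingEnd ℂ) (u x)) * (starRingEnd ℂ) (u x)

/-- The scattering coefficient of a test function, as an entire function. -/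
def testA (u : ℝ → ℂ) (l : ℂ) : ℂ := zsScat u (dual u) l 0 0

variable {u v : ℝ → ℂ}

lemma contDiff_dual (hu : IsTest u) : ContDiff ℝ ∞ (dual u) := by
  have hs : ContDiff ℝ ∞ (fun z : ℂ => (starRingEnd ℂ) z) := Complex.conjCLE.contDiff
  have h0 := hs.comp hu.smooth
  have h1 := hs.comp hu.smooth_deriv
  exact (contDiff_const.mul h1).sub ((contDiff_const.mul (hu.smooth.mul h0)).mul h0)

lemma isTestPair_dual (hu : IsTest u) : IsTestPair u (dual u) := by
  refine ⟨hu.continuous, (contDiff_dual hu).continuous, hu.supp, ?_⟩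
  refine HasCompactSupport.sub ?_ ?_
  · exact (hu.deriv.supp.comp_left (g := fun z => (starRingEnd ℂ) z) (map_zero _)).mul_left
  · exact (hu.supp.comp_left (g := fun z => (starRingEnd ℂ) z) (map_zero _)).mul_left

lemma differentiable_testA (hu : IsTest u) : Differentiable ℂ (testA u) := fun l =>
  (entry 0 0).differentiableAt.comp l (differentiable_zsScat (isTestPair_dual hu) l)

lemma exists_norm_testA_sub_one_le (hu : IsTest u) :
    ∃ C : ℝ, ∀ l : ℂ, 0 ≤ l.im → l ≠ 0 → ‖testA u l - 1‖ ≤ C / ‖l‖ := by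
  have h := contDiff_dual hu
  exact exists_norm_zsScat_sub_one_le (isTestPair_dual hu) (dp := deriv (dual u))
    (fun x => ((h.differentiable (by simp)) x).hasDerivAt)
    (contDiff_infty_iff_deriv.1 h).2.continuous

lemma norm_dual_le {S : ℝ} (x : ℝ) (hS : ‖u x‖ ≤ S) :
    ‖dual u x‖ ≤ 1 / 2 * ‖deriv u x‖ + 1 / 4 * S ^ 2 * ‖u x‖ := by
  refine (norm_sub_le _ _).trans ?_
  simp only [norm_mul, norm_div, RCLike.norm_conj, Complex.norm_I, Complex.norm_ofNat, norm_one]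
  have hS0 : 0 ≤ S := (norm_nonneg _).trans hS
  have : ‖u x‖ * ‖u x‖ ≤ S ^ 2 := by rw [sq]; gcongr
  gcongr

/-- The cubic term is changed one factor at a time; three differences, each at most
$\frac14S^2|u-v|$, give the coefficient $3/4$. -/
lemma norm_dual_sub_le (hu : IsTest u) (hv : IsTest v) {S : ℝ} (x : ℝ) (hS : ‖u x‖ ≤ S)
    (hS' : ‖v x‖ ≤ S) : ‖dual u x - dual v x‖ ≤
      1 / 2 * ‖deriv (fun x => u x - v x) x‖ + 3 / 4 * S ^ 2 * ‖u x - v x‖ := by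
  have hd : deriv (fun x => u x - v x) x = deriv u x - deriv v x :=
    ((hu.hasDerivAt x).sub (hv.hasDerivAt x)).deriv
  rw [hd]
  set s : ℂ → ℂ := DFunLike.coe (starRingEnd ℂ) with hs
  have hn : ∀ z, ‖s z‖ = ‖z‖ := fun z => RCLike.norm_conj z
  have e : dual u x - dual v x = Complex.I / 2 * s (deriv u x - deriv v x) -
      1 / 4 * ((u x - v x) * s (u x) * s (u x) + v x * s (u x - v x) * s (u x) +
        v x * s (v x) * s (u x - v x)) := by
    simp only [dual, hs, map_sub]
    ring
  have hS0 : 0 ≤ S := (norm_nonneg _).trans hS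
  rw [e]
  calc _ ≤ ‖Complex.I / 2 * s (deriv u x - deriv v x)‖ +
        ‖1 / 4 * ((u x - v x) * s (u x) * s (u x) + v x * s (u x - v x) * s (u x) +
        v x * s (v x) * s (u x - v x))‖ := norm_sub_le _ _
    _ ≤ 1 / 2 * ‖deriv u x - deriv v x‖ + 1 / 4 * (‖u x - v x‖ * S * S + S * ‖u x - v x‖ * S +
        S * S * ‖u x - v x‖) := by
      rw [norm_mul, norm_mul (1 / 4 : ℂ)]
      simp only [norm_div, Complex.norm_I, Complex.norm_ofNat, norm_one, hn]
      gcongr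
      refine (norm_add₃_le).trans ?_
      simp only [norm_mul, hn]
      gcongr
    _ = _ := by ring

/-- Continuity of the scattering coefficient in the `H^{2,2}` norm, uniformly in the closed upper
half-plane. -/
lemma exists_norm_testA_sub_le (K : ℝ) : ∃ C : ℝ, 0 ≤ C ∧ ∀ (u v : ℝ → ℂ) (hu : IsTest u)
    (hv : IsTest v), ‖emb hu‖ ≤ K → ‖emb hv‖ ≤ K → ∀ l : ℂ, 0 ≤ l.im →
      ‖testA u l - testA v l‖ ≤ C * ‖emb hu - emb hv‖ := by
  rcases lt_or_ge K 0 with hK | hK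
  · exact ⟨0, le_rfl, fun u v hu hv h => absurd (h.trans_lt hK) (not_lt.2 (norm_nonneg _))⟩
  set c := √Real.pi with hc
  set d := √(2 * Real.pi) with hd
  -- On the ball of radius $K$: $S$ bounds the sup norm of $u$, $K'$ the $L^1$ norm of $u$ together
  -- with its dual, and $D$ is a Lipschitz constant of $u\mapsto(u,\text{dual of }u)$ into $L^1$.
  set S := d * K with hS
  set K' := c * K + (1 / 2 * (d * K) + 1 / 4 * S ^ 2 * (c * K)) with hK'
  set D := c + (1 / 2 * d + 3 / 4 * S ^ 2 * c) with hD
  have sup_le : ∀ (u : ℝ → ℂ) (hu : IsTest u), ‖emb hu‖ ≤ K → ∀ x, ‖u x‖ ≤ S := fun u hu h x =>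
    (norm_le_integral_norm_deriv hu x).trans ((integral_norm_deriv_le_emb hu).trans
      (mul_le_mul_of_nonneg_left h (Real.sqrt_nonneg _)))
  have bound : ∀ (u : ℝ → ℂ) (hu : IsTest u), ‖emb hu‖ ≤ K → ∫ y, (‖u y‖ + ‖dual u y‖) ≤ K' := by
    intro u hu h
    have iu := hu.integrable.norm
    have idu := hu.deriv.integrable.norm
    have b0 : ∫ y, ‖u y‖ ≤ c * K := (integral_norm_le_emb hu).trans (by gcongr)
    have b1 : ∫ y, ‖deriv u y‖ ≤ d * K :=
      (integral_norm_deriv_le_emb hu).trans (mul_le_mul_of_nonneg_left h (Real.sqrt_nonneg _))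
    rw [integral_add iu (isTestPair_dual hu).integrable_right.norm]
    refine add_le_add b0 ?_
    calc ∫ y, ‖dual u y‖ ≤ ∫ y, (1 / 2 * ‖deriv u y‖ + 1 / 4 * S ^ 2 * ‖u y‖) :=
          integral_mono (isTestPair_dual hu).integrable_right.norm
            ((idu.const_mul _).add (iu.const_mul _)) fun y => norm_dual_le y (sup_le u hu h y)
      _ = 1 / 2 * (∫ y, ‖deriv u y‖) + 1 / 4 * S ^ 2 * ∫ y, ‖u y‖ := by
          rw [integral_add (idu.const_mul _) (iu.const_mul _), integral_const_mul,
            integral_const_mul]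
      _ ≤ _ := by gcongr
  refine ⟨D * (1 + K' * Real.exp K') * Real.exp K', by positivity, fun u v hu hv hKu hKv l hl => ?_⟩
  have h1 := norm_zsScat_sub_le (isTestPair_dual hu) (isTestPair_dual hv) hl (bound u hu hKu)
    (bound v hv hKv)
  have hw := hu.sub hv
  have iw := hw.integrable.norm
  have idw := hw.deriv.integrable.norm
  have h2 : ∫ y, (‖u y - v y‖ + ‖dual u y - dual v y‖) ≤ D * ‖emb hw‖ := by
    have i2 : Integrable fun y => ‖dual u y - dual v y‖ :=
      ((isTestPair_dual hu).integrable_right.sub (isTestPair_dual hv).integrable_right).norm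
    rw [integral_add iw i2]
    have h3 : ∫ y, ‖dual u y - dual v y‖ ≤
        1 / 2 * (d * ‖emb hw‖) + 3 / 4 * S ^ 2 * (c * ‖emb hw‖) := by
      calc _ ≤ ∫ y, (1 / 2 * ‖deriv (fun x => u x - v x) y‖ + 3 / 4 * S ^ 2 * ‖u y - v y‖) :=
            integral_mono i2 ((idw.const_mul _).add (iw.const_mul _)) fun y =>
              norm_dual_sub_le hu hv y (sup_le u hu hKu y) (sup_le v hv hKv y)
        _ = 1 / 2 * (∫ y, ‖deriv (fun x => u x - v x) y‖) + 3 / 4 * S ^ 2 * ∫ y, ‖u y - v y‖ := by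
            rw [integral_add (idw.const_mul _) (iw.const_mul _), integral_const_mul,
              integral_const_mul]
        _ ≤ _ := by
            gcongr
            · exact integral_norm_deriv_le_emb hw
            · exact integral_norm_le_emb hw
    calc _ ≤ c * ‖emb hw‖ + (1 / 2 * (d * ‖emb hw‖) + 3 / 4 * S ^ 2 * (c * ‖emb hw‖)) :=
          add_le_add (integral_norm_le_emb hw) h3
      _ = _ := by rw [hD]; ring
  rw [emb_sub]
  calc _ ≤ _ := h1
    _ ≤ D * ‖emb hw‖ * (1 + K' * Real.exp K') * Real.exp K' := by gcongr
    _ = _ := by ring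

/-- The Kaup–Newell potential in the interaction picture. -/
def knPot (q : ℝ → ℂ) (l : ℝ) (x : ℝ) : M2 :=
  !![Complex.I / 2 * (q x * (starRingEnd ℂ) (q x)), q x * Complex.exp (2 * Complex.I * l * x);
    -(l * (starRingEnd ℂ) (q x)) * Complex.exp (-(2 * Complex.I * l * x)),
    -(Complex.I / 2 * (q x * (starRingEnd ℂ) (q x)))]

/-- The Kaup–Newell and the Zakharov–Shabat systems have the same scattering matrix. -/
lemma scat_knPot (hu : IsTest u) (l : ℝ) (hi : Integrable (knPot u l)) :
    scat (knPot u l) = zsScat u (dual u) l := by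
  have hz := integrable_zsPot (isTestPair_dual hu) l
  set N := evo (zsPot u (dual u) l) with hN
  set s : ℂ → ℂ := DFunLike.coe (starRingEnd ℂ) with hs
  -- Differentiating the phase in the lower left entry produces exactly $-\lambda\bar ue^{-2i\lambda
  -- x}$, the entry of the Kaup–Newell potential that grows with $\lambda$. Since $G=I$ off the
  -- support of $u$, the limits at both ends are unchanged.
  set G : ℝ → M2 := fun x =>
    !![1, 0; Complex.exp (-(2 * Complex.I * l * x)) * s (u x) / (2 * Complex.I), 1] with hG
  have hGd : ∀ x : ℝ, HasDerivAt G (!![0, 0; (Complex.exp (-(2 * Complex.I * l * x)) *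
      (-(2 * Complex.I * l)) * s (u x) + Complex.exp (-(2 * Complex.I * l * x)) * s (deriv u x)) /
        (2 * Complex.I), 0]) x := by
    intro x
    have he : HasDerivAt (fun y : ℝ => Complex.exp (-(2 * Complex.I * l * y)))
        (Complex.exp (-(2 * Complex.I * l * x)) * (-(2 * Complex.I * l))) x := by
      have h1 : HasDerivAt (fun y : ℝ => -(2 * Complex.I * l * (y : ℂ))) (-(2 * Complex.I * l)) x := by
        have := (((hasDerivAt_id x).ofReal_comp).const_mul (2 * Complex.I * (l : ℂ))).fun_neg
        simpa using this
      exact h1.cexp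
    have h1 := (he.mul (hasDerivAt_star (hu.hasDerivAt x))).div_const (2 * Complex.I)
    refine hasDerivAt_of_entries fun i j => ?_
    fin_cases i <;> fin_cases j
    · exact hasDerivAt_const x _
    · exact hasDerivAt_const x _
    · exact h1
    · exact hasDerivAt_const x _
  have hGc : Continuous G := continuous_iff_continuousAt.2 fun x => (hGd x).continuousAt
  obtain ⟨R, -, hR⟩ := exists_support_bound hu.supp
  have hG1 : ∀ x, R < |x| → G x = 1 := fun x hx => by
    ext i j
    fin_cases i <;> fin_cases j <;> simp [hG, hs, hR x hx]
  obtain ⟨C, hC⟩ : ∃ C, ∀ x, ‖G x‖ ≤ C := by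
    obtain ⟨C, hC⟩ := (isCompact_Icc (a := -R) (b := R)).exists_bound_of_continuousOn hGc.continuousOn
    refine ⟨max C 1, fun x => ?_⟩
    rcases lt_or_ge R |x| with hx | hx
    · rw [hG1 x hx, norm_M2_one]; exact le_max_right _ _
    · exact (hC x (abs_le.1 hx)).trans (le_max_left _ _)
  have hGN : (fun x => G x * N x) = evo (knPot u l) := by
    refine eq_evo_of_hasDerivAt hi (C := C * ‖N‖) (fun x => ?_) (fun x => ?_) ?_
    · have := (norm_nonneg _).trans (hC x)
      refine (norm_mul_le _ _).trans ?_
      gcongr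
      · exact hC x
      · exact N.norm_coe_le_norm x
    · have h := (hGd x).mul (hasDerivAt_evo hz (continuous_zsPot (isTestPair_dual hu) l) x)
      refine h.congr_deriv ?_
      rw [← hN, ← mul_assoc, ← mul_assoc, ← add_mul]
      congr 1
      ext i j
      have e1 : Complex.exp (-(2 * Complex.I * l * x)) * Complex.exp (2 * Complex.I * l * x) = 1 := by
        rw [← Complex.exp_add, neg_add_cancel, Complex.exp_zero]
      have e2 := Complex.I_mul_I
      have hI : ∀ a : ℂ, a / (2 * Complex.I) = -(Complex.I / 2) * a := fun a => by
        rw [div_eq_iff (by simp)]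
        linear_combination a * e2
      fin_cases i <;> fin_cases j <;>
        simp [hG, zsPot, knPot, dual, Matrix.mul_apply, Fin.sum_univ_two] <;> rw [← hs]
      · rw [hI]
        linear_combination (Complex.I / 2 * u x * s (u x)) * e1
      · rw [hI, hI]
        linear_combination (l * s (u x) * Complex.exp (-(2 * Complex.I * l * x)) -
          1 / 4 * u x * s (u x) * s (u x) * Complex.exp (-(2 * Complex.I * l * x))) * e2
      · rw [hI]
        linear_combination (-(Complex.I / 2 * u x * s (u x))) * e1
    · have h1 : Tendsto G atBot (𝓝 1) := by
        refine tendsto_const_nhds.congr' ?_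
        filter_upwards [eventually_lt_atBot (-R)] with y hy
        exact (hG1 y (by rw [lt_abs]; right; linarith)).symm
      simpa using h1.mul (tendsto_evo_atBot hz)
  refine tendsto_nhds_unique (tendsto_evo_atTop hi) ?_
  rw [← hGN]
  have h1 : Tendsto G atTop (𝓝 1) := by
    refine tendsto_const_nhds.congr' ?_
    filter_upwards [eventually_gt_atTop R] with y hy
    exact (hG1 y (lt_of_lt_of_le hy (le_abs_self _))).symm
  have := h1.mul (tendsto_evo_atTop hz)
  rw [one_mul] at this
  exact this

end Gauge

end

end DNLS

namespace DNLS

noncomputable section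

/-! ### A product rule for indefinite integrals -/

section ProductRule

open Set

/-- Increments of $F$ are dominated by those of the real primitive of $|\varphi|$, whose absolute
continuity is therefore inherited. -/
lemma absolutelyContinuousOnInterval_of_integral {F φ : ℝ → ℂ}
    (hφ : ∀ a b, IntervalIntegrable φ volume a b)
    (hF : ∀ x y, F y - F x = ∫ s in x..y, φ s) (a b : ℝ) : AbsolutelyContinuousOnInterval F a b := by
  have h := (hφ a b).norm.absolutelyContinuousOnInterval_intervalIntegral (c := a) left_mem_uIcc
  rw [absolutelyContinuousOnInterval_iff] at h ⊢
  intro ε hε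
  obtain ⟨δ, hδ, H⟩ := h ε hε
  refine ⟨δ, hδ, fun E hE hs => lt_of_le_of_lt (Finset.sum_le_sum fun i _ => ?_) (H E hE hs)⟩
  rw [dist_comm, dist_eq_norm, hF, dist_comm, Real.dist_eq,
    intervalIntegral.integral_interval_sub_left ((hφ _ _).norm) ((hφ _ _).norm)]
  exact intervalIntegral.norm_integral_le_abs_integral_norm

lemma ae_hasDerivAt_of_integral {F φ : ℝ → ℂ}
    (hφ : ∀ a b, IntervalIntegrable φ volume a b)
    (hF : ∀ x y, F y - F x = ∫ s in x..y, φ s) (a b : ℝ) :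
    ∀ᵐ x, x ∈ uIcc a b → HasDerivAt F (φ x) x := by
  filter_upwards [(hφ a b).ae_hasDerivAt_integral] with x hx hxab
  have e : F = fun x => F a + ∫ s in a..x, φ s := by
    ext y; rw [← hF]; ring
  rw [e]
  exact (hx hxab a left_mem_uIcc).const_add _

/-- The product rule for a continuously differentiable function and an indefinite integral. -/
lemma mul_sub_mul_eq_integral {w w' F φ : ℝ → ℂ} (hw : ∀ x, HasDerivAt w (w' x) x)
    (hw' : Continuous w') (hφ : ∀ a b, IntervalIntegrable φ volume a b) (hFc : Continuous F)
    (hF : ∀ x y, F y - F x = ∫ s in x..y, φ s) (a b : ℝ) :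
    w b * F b - w a * F a = ∫ s in a..b, (w' s * F s + w s * φ s) := by
  have hwc : Continuous w := continuous_iff_continuousAt.2 fun x => (hw x).continuousAt
  have hwF : ∀ x y, w y - w x = ∫ s in x..y, w' s := fun x y =>
    (intervalIntegral.integral_eq_sub_of_hasDerivAt (fun s _ => hw s)
      (hw'.intervalIntegrable _ _)).symm
  have hψ : ∀ a b, IntervalIntegrable (fun s => w' s * F s + w s * φ s) volume a b := fun a b =>
    ((hw'.mul hFc).intervalIntegrable a b).add ((hφ a b).continuousOn_mul hwc.continuousOn)
  set Ψ : ℝ → ℂ := fun x => ∫ s in a..x, (w' s * F s + w s * φ s) with hΨ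
  have hΨd : ∀ x y, Ψ y - Ψ x = ∫ s in x..y, (w' s * F s + w s * φ s) := fun x y =>
    intervalIntegral.integral_interval_sub_left (hψ _ _) (hψ _ _)
  -- The difference of the two sides, as a function of the upper endpoint, is absolutely continuous
  -- with derivative zero almost everywhere, hence constant.
  have hac : AbsolutelyContinuousOnInterval (fun x => w x • F x - Ψ x) a b :=
    ((absolutelyContinuousOnInterval_of_integral (fun a b => hw'.intervalIntegrable a b) hwF a b).fun_smul
      (absolutelyContinuousOnInterval_of_integral hφ hF a b)).fun_sub
      (absolutelyContinuousOnInterval_of_integral hψ hΨd a b)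
  obtain ⟨C, hC⟩ := hac.const_of_ae_hasDerivAt_zero (by
    filter_upwards [ae_hasDerivAt_of_integral hφ hF a b, ae_hasDerivAt_of_integral hψ hΨd a b]
      with x h1 h2 hx
    have := ((hw x).mul (h1 hx)).sub (h2 hx)
    exact this.congr_deriv (sub_self _))
  have ha := hC a left_mem_uIcc
  have hb := hC b right_mem_uIcc
  have hΨa : Ψ a = 0 := intervalIntegral.integral_same
  simp only [smul_eq_mul] at ha hb
  change _ = Ψ b
  rw [hΨa] at ha
  linear_combination hb - ha

end ProductRule

/-! ### Jost solutions and the transition matrix for real spectral parameter -/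

section RealLine

open Set

attribute [local instance] Matrix.linftyOpNormedRing Matrix.linftyOpNormedAlgebra normTopology

variable {q : ℝ → ℂ} {l : ℝ}

lemma integrable_conj (h1 : Integrable q) : Integrable fun x => (starRingEnd ℂ) (q x) :=
  Complex.conjCLE.toContinuousLinearMap.integrable_comp h1

lemma integrable_mul_conj (h2 : MemLp q 2) : Integrable fun x => q x * (starRingEnd ℂ) (q x) := by
  refine ((memLp_two_iff_integrable_sq_norm h2.1).1 h2).ofReal.congr
    (Eventually.of_forall fun x => ?_)
  dsimp only
  rw [Complex.mul_conj, Complex.normSq_eq_norm_sq]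
  rfl

lemma integrable_knPot (h1 : Integrable q) (h2 : MemLp q 2) (l : ℝ) : Integrable (knPot q l) := by
  have hs := integrable_conj h1
  have hq := integrable_mul_conj h2
  have he : ∀ s : ℝ, ∀ᵐ x : ℝ, ‖Complex.exp (s * (2 * Complex.I * l * x))‖ ≤ 1 := fun s => by
    refine Eventually.of_forall fun x => le_of_eq ?_
    rw [show (s : ℂ) * (2 * Complex.I * l * x) = ((s * (2 * l * x) : ℝ) : ℂ) * Complex.I by
      push_cast; ring]
    exact Complex.norm_exp_ofReal_mul_I _
  have he1 := he 1
  have he2 := he (-1)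
  simp only [Complex.ofReal_one, one_mul, Complex.ofReal_neg, neg_mul] at he1 he2
  refine integrable_of_entries fun i j => ?_
  fin_cases i <;> fin_cases j
  · exact hq.const_mul _
  · exact h1.mul_bdd (by fun_prop) he1
  · exact (hs.const_mul (l : ℂ)).neg.mul_bdd (by fun_prop) he2
  · exact (hq.const_mul _).neg

lemma continuous_expSigma (z : ℂ) : Continuous (expSigma z) := by
  refine continuous_of_entries fun i j => ?_
  fin_cases i <;> fin_cases j <;> simp [expSigma] <;> fun_prop

lemma expSigma_mul_neg (z : ℂ) (x : ℝ) : expSigma z x * expSigma z (-x) = 1 := by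
  ext i j
  fin_cases i <;> fin_cases j <;>
    simp [expSigma, Matrix.mul_apply, Fin.sum_univ_two, ← Complex.exp_add]

lemma expSigma_neg_mul (z : ℂ) (x : ℝ) : expSigma z (-x) * expSigma z x = 1 := by
  ext i j
  fin_cases i <;> fin_cases j <;>
    simp [expSigma, Matrix.mul_apply, Fin.sum_univ_two, ← Complex.exp_add]

lemma norm_expSigma_le (l x : ℝ) : ‖expSigma l x‖ ≤ 2 := by
  refine (norm_le_sum_entries _).trans (le_of_eq ?_)
  have h : ∀ t : ℝ, ‖Complex.exp (Complex.I * t)‖ = 1 := fun t => by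
    rw [mul_comm]; exact Complex.norm_exp_ofReal_mul_I t
  have h1 : ‖Complex.exp (Complex.I * l * x)‖ = 1 := by
    have := h (l * x); push_cast at this; rw [← this]; congr 2; ring
  have h2 : ‖Complex.exp (-(Complex.I * l * x))‖ = 1 := by
    have := h (-(l * x)); push_cast at this; rw [← this]; congr 2; ring
  simp [expSigma, h1, h2]
  norm_num

/-- Conjugation by the unitary matrices `e^{iλxσ₃}` preserves convergence to the identity. -/
lemma tendsto_conj_one {B : ℝ → M2} {F : Filter ℝ} (hB : Tendsto B F (𝓝 1)) (l : ℝ)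
    {s : ℝ → ℝ} : Tendsto (fun x => expSigma l (-s x) * B x * expSigma l (s x)) F (𝓝 1) := by
  rw [tendsto_iff_norm_sub_tendsto_zero] at hB ⊢
  refine squeeze_zero (fun x => norm_nonneg _) (fun x => ?_) (by simpa using hB.const_mul 4)
  have : expSigma l (-s x) * B x * expSigma l (s x) - 1 =
      expSigma l (-s x) * (B x - 1) * expSigma l (s x) := by
    rw [mul_sub, sub_mul, mul_one, expSigma_neg_mul]
  rw [this]
  calc _ ≤ ‖expSigma l (-s x)‖ * ‖B x - 1‖ * ‖expSigma l (s x)‖ :=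
        (norm_mul_le _ _).trans (by gcongr; exact norm_mul_le _ _)
    _ ≤ 2 * ‖B x - 1‖ * 2 := by gcongr <;> exact norm_expSigma_le _ _
    _ = _ := by ring

lemma Lmat_mul_zero (q : ℂ) (l : ℂ) (M : M2) (j : Fin 2) : (Lmat (-1) l q * M) 0 j =
    (-(Complex.I * l) + Complex.I / 2 * (q * (starRingEnd ℂ) q)) * M 0 j + q * M 1 j := by
  simp [Lmat, sigma3, Qlam, Qmat, Matrix.mul_apply, Fin.sum_univ_two, pow_two]

lemma Lmat_mul_one (q : ℂ) (l : ℂ) (M : M2) (j : Fin 2) : (Lmat (-1) l q * M) 1 j =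
    -(l * (starRingEnd ℂ) q) * M 0 j +
      (Complex.I * l - Complex.I / 2 * (q * (starRingEnd ℂ) q)) * M 1 j := by
  simp [Lmat, sigma3, Qlam, Qmat, Matrix.mul_apply, Fin.sum_univ_two, pow_two]
  left
  ring

lemma knPot_mul_zero (q : ℝ → ℂ) (l x : ℝ) (M : M2) (j : Fin 2) : (knPot q l x * M) 0 j =
    Complex.I / 2 * (q x * (starRingEnd ℂ) (q x)) * M 0 j +
      q x * Complex.exp (2 * Complex.I * l * x) * M 1 j := by
  simp [knPot, Matrix.mul_apply, Fin.sum_univ_two]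

lemma knPot_mul_one (q : ℝ → ℂ) (l x : ℝ) (M : M2) (j : Fin 2) : (knPot q l x * M) 1 j =
    -(l * (starRingEnd ℂ) (q x)) * Complex.exp (-(2 * Complex.I * l * x)) * M 0 j +
      -(Complex.I / 2 * (q x * (starRingEnd ℂ) (q x))) * M 1 j := by
  simp [knPot, Matrix.mul_apply, Fin.sum_univ_two]

lemma expSigma_mul_zero (z : ℂ) (x : ℝ) (M : M2) (j : Fin 2) :
    (expSigma z x * M) 0 j = Complex.exp (Complex.I * z * x) * M 0 j := by
  simp [expSigma, Matrix.mul_apply, Fin.sum_univ_two]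

lemma expSigma_mul_one (z : ℂ) (x : ℝ) (M : M2) (j : Fin 2) :
    (expSigma z x * M) 1 j = Complex.exp (-(Complex.I * z * x)) * M 1 j := by
  simp [expSigma, Matrix.mul_apply, Fin.sum_univ_two]

lemma hasDerivAt_exp_mul (c : ℂ) (x : ℝ) :
    HasDerivAt (fun y : ℝ => Complex.exp (c * y)) (c * Complex.exp (c * x)) x := by
  have h1 : HasDerivAt (fun y : ℝ => c * (y : ℂ)) c x := by
    simpa using ((hasDerivAt_id x).ofReal_comp).const_mul c
  exact h1.cexp.congr_deriv (mul_comm _ _)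

/-- `B` solves the system in the interaction picture. -/
def IsInteraction (q : ℝ → ℂ) (l : ℝ) (B : ℝ → M2) : Prop :=
  Continuous B ∧ ∀ x y : ℝ, ∀ i j : Fin 2, B y i j - B x i j =
    ∫ s in x..y, (knPot q l s * B s) i j

lemma intervalIntegrable_knPot_mul (hi : Integrable (knPot q l)) {B : ℝ → M2} (hB : Continuous B)
    (i j : Fin 2) (a b : ℝ) : IntervalIntegrable (fun s => (knPot q l s * B s) i j) volume a b := by
  have h : IntervalIntegrable (fun s => knPot q l s * B s) volume a b :=
    hi.intervalIntegrable.mul_continuousOn hB.continuousOn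
  rw [intervalIntegrable_iff] at h ⊢
  exact (entry i j).integrable_comp h

/-- Differentiating $e^{-i\lambda x\sigma_3}$ restores the diagonal term $-i\lambda\sigma_3$, and
its entries cancel the phases in the potential. As $q$ is merely integrable, the product rule has to
be used in integral form. -/
lemma isSolution_of_isInteraction (hi : Integrable (knPot q l)) {B : ℝ → M2}
    (hB : IsInteraction q l B) : IsSolution (-1) q l fun x => expSigma l (-x) * B x := by
  have hc : Continuous fun x => expSigma l (-x) * B x :=
    ((continuous_expSigma l).comp continuous_neg).mul hB.1
  refine ⟨hc, fun x y i j => ?_⟩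
  have hBc : ∀ i j, Continuous fun s => B s i j := fun i j => (continuous_entry i j).comp hB.1
  have key : ∀ (c : ℂ) (i : Fin 2), Complex.exp (c * y) * B y i j - Complex.exp (c * x) * B x i j =
      ∫ s in x..y, (c * Complex.exp (c * s) * B s i j +
        Complex.exp (c * s) * (knPot q l s * B s) i j) := fun c i =>
    mul_sub_mul_eq_integral (hasDerivAt_exp_mul c) (by fun_prop)
      (intervalIntegrable_knPot_mul hi hB.1 i j) (hBc i j) (fun x y => hB.2 x y i j) x y
  fin_cases i
  · have h := key (-(Complex.I * l)) 0
    simp only [Fin.zero_eta, expSigma_mul_zero]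
    have e : ∀ t : ℝ, Complex.I * l * ((-t : ℝ) : ℂ) = -(Complex.I * l) * t := fun t => by
      push_cast; ring
    rw [e, e, h]
    refine intervalIntegral.integral_congr fun s _ => ?_
    simp only [Lmat_mul_zero, knPot_mul_zero, expSigma_mul_zero, expSigma_mul_one, e]
    rw [show 2 * Complex.I * l * s = Complex.I * l * s + Complex.I * l * s by ring,
      Complex.exp_add, show -(-(Complex.I * l) * (s:ℂ)) = Complex.I * l * s by ring]
    have e1 : Complex.exp (-(Complex.I * l) * s) * Complex.exp (Complex.I * l * s) = 1 := by
      rw [← Complex.exp_add]; simp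
    linear_combination (q s * Complex.exp (Complex.I * l * s) * B s 1 j) * e1
  · have h := key (Complex.I * l) 1
    simp only [Fin.mk_one, expSigma_mul_one]
    have e : ∀ t : ℝ, -(Complex.I * l * ((-t : ℝ) : ℂ)) = Complex.I * l * t := fun t => by
      push_cast; ring
    rw [e, e, h]
    refine intervalIntegral.integral_congr fun s _ => ?_
    simp only [Lmat_mul_one, knPot_mul_one, expSigma_mul_zero, expSigma_mul_one, e]
    rw [show -(2 * Complex.I * l * s) = Complex.I * l * ((-s : ℝ) : ℂ) +
      Complex.I * l * ((-s : ℝ) : ℂ) by push_cast; ring, Complex.exp_add]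
    have e1 : Complex.exp (Complex.I * l * s) * Complex.exp (Complex.I * l * ((-s : ℝ) : ℂ)) = 1 := by
      rw [← Complex.exp_add]; simp
    linear_combination (-(l * (starRingEnd ℂ) (q s)) * Complex.exp (Complex.I * l * ((-s : ℝ) : ℂ)) *
      B s 0 j) * e1

lemma isInteraction_of_isSolution (hq : Integrable q)
    (hq2 : MemLp q 2) {Ψ : ℝ → M2}
    (hΨ : IsSolution (-1) q l Ψ) : IsInteraction q l fun x => expSigma l x * Ψ x := by
  have hc : Continuous fun x => expSigma l x * Ψ x := (continuous_expSigma l).mul hΨ.1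
  refine ⟨hc, fun x y i j => ?_⟩
  have hΨc : ∀ i j, Continuous fun s => Ψ s i j := fun i j => (continuous_entry i j).comp hΨ.1
  have hL : ∀ i a b, IntervalIntegrable (fun s => (Lmat (-1) l (q s) * Ψ s) i j) volume a b := by
    intro i a b
    have h1 : ∀ i, IntervalIntegrable (fun s => q s * Ψ s i j) volume a b := fun i =>
      hq.intervalIntegrable.mul_continuousOn (hΨc i j).continuousOn
    have h2 : ∀ i, IntervalIntegrable (fun s => (starRingEnd ℂ) (q s) * Ψ s i j) volume a b :=
      fun i => (integrable_conj hq).intervalIntegrable.mul_continuousOn (hΨc i j).continuousOn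
    have h3 : ∀ i, IntervalIntegrable (fun s => q s * (starRingEnd ℂ) (q s) * Ψ s i j) volume a b :=
      fun i => (integrable_mul_conj hq2).intervalIntegrable.mul_continuousOn (hΨc i j).continuousOn
    have h4 : ∀ i, IntervalIntegrable (fun s => Ψ s i j) volume a b := fun i =>
      (hΨc i j).intervalIntegrable a b
    fin_cases i
    · refine (((h4 0).const_mul (-(Complex.I * l))).add
        (((h3 0).const_mul (Complex.I / 2)).add (h1 1))).congr fun s _ => ?_
      simp only [Fin.zero_eta, Lmat_mul_zero]
      ring
    · refine (((h2 0).const_mul (-(l : ℂ))).add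
        (((h4 1).const_mul (Complex.I * l)).sub ((h3 1).const_mul (Complex.I / 2)))).congr
          fun s _ => ?_
      simp only [Fin.mk_one, Lmat_mul_one]
      ring
  have key : ∀ (c : ℂ) (i : Fin 2), Complex.exp (c * y) * Ψ y i j - Complex.exp (c * x) * Ψ x i j =
      ∫ s in x..y, (c * Complex.exp (c * s) * Ψ s i j +
        Complex.exp (c * s) * (Lmat (-1) l (q s) * Ψ s) i j) := fun c i =>
    mul_sub_mul_eq_integral (hasDerivAt_exp_mul c) (by fun_prop)
      (hL i) (hΨc i j) (fun x y => hΨ.2 x y i j) x y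
  fin_cases i
  · have h := key (Complex.I * l) 0
    simp only [Fin.zero_eta, expSigma_mul_zero]
    rw [h]
    refine intervalIntegral.integral_congr fun s _ => ?_
    simp only [Lmat_mul_zero, knPot_mul_zero, expSigma_mul_zero, expSigma_mul_one]
    rw [show 2 * Complex.I * l * s = Complex.I * l * s + Complex.I * l * s by ring,
      Complex.exp_add]
    have e1 : Complex.exp (-(Complex.I * l * s)) * Complex.exp (Complex.I * l * s) = 1 := by
      rw [← Complex.exp_add]; simp
    linear_combination (-(q s * Complex.exp (Complex.I * l * s) * Ψ s 1 j)) * e1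
  · have h := key (-(Complex.I * l)) 1
    simp only [Fin.mk_one, expSigma_mul_one]
    have e : ∀ t : ℝ, -(Complex.I * l * t) = -(Complex.I * l) * t := fun t => by ring
    rw [e, e, h]
    refine intervalIntegral.integral_congr fun s _ => ?_
    simp only [Lmat_mul_one, knPot_mul_one, expSigma_mul_zero, expSigma_mul_one]
    rw [show -(2 * Complex.I * l * s) = -(Complex.I * l) * s +
      -(Complex.I * l) * s by ring, Complex.exp_add, e]
    have e1 : Complex.exp (Complex.I * l * s) * Complex.exp (-(Complex.I * l) * s) = 1 := by
      rw [← Complex.exp_add]; simp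
    linear_combination ((l * (starRingEnd ℂ) (q s)) * Complex.exp (-(Complex.I * l) * s) *
      Ψ s 0 j) * e1

lemma intervalIntegral_entry {f : ℝ → M2} {a b : ℝ} (hf : IntervalIntegrable f volume a b)
    (i j : Fin 2) : (∫ s in a..b, f s) i j = ∫ s in a..b, f s i j :=
  ((entry i j).intervalIntegral_comp_comm hf).symm

lemma isInteraction_evo (hi : Integrable (knPot q l)) (T : M2) :
    IsInteraction q l fun x => evo (knPot q l) x * T := by
  refine ⟨(evo (knPot q l)).continuous.mul continuous_const, fun x y i j => ?_⟩
  have hint : ∀ i k, IntervalIntegrable (fun s => (knPot q l s * evo (knPot q l) s) i k)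
    volume x y := fun i k => intervalIntegrable_knPot_mul hi (evo (knPot q l)).continuous i k x y
  have hV : IntervalIntegrable (fun s => knPot q l s * evo (knPot q l) s) volume x y :=
    hi.intervalIntegrable.mul_continuousOn (evo (knPot q l)).continuous.continuousOn
  have h : ∀ i k, evo (knPot q l) y i k - evo (knPot q l) x i k =
      ∫ s in x..y, (knPot q l s * evo (knPot q l) s) i k := by
    intro i k
    rw [← Matrix.sub_apply, evo_sub hi, intervalIntegral_entry hV]
  simp only [← mul_assoc]
  have e : ∀ M : M2, (M * T) i j = M i 0 * T 0 j + M i 1 * T 1 j := fun M => by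
    simp [Matrix.mul_apply, Fin.sum_univ_two]
  simp only [e]
  rw [intervalIntegral.integral_add ((hint i 0).mul_const _) ((hint i 1).mul_const _),
    intervalIntegral.integral_mul_const, intervalIntegral.integral_mul_const, ← h, ← h]
  ring

/-- The solution normalized at `-∞` is determined on every half-line by the potential there. -/
lemma eq_evo_indicator (hi : Integrable (knPot q l)) {B : ℝ → M2} (hB : IsInteraction q l B)
    (hlim : Tendsto B atBot (𝓝 1)) (c : ℝ) : B c = evo ((Iic c).indicator (knPot q l)) c := by
  have hV : Integrable ((Iic c).indicator (knPot q l)) := hi.indicator measurableSet_Iic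
  obtain ⟨C, hC⟩ : ∃ C, ∀ x ≤ c, ‖B x‖ ≤ C := by
    have h1 : ∀ᶠ x in atBot, ‖B x‖ ≤ 2 := by
      have := hlim.norm
      rw [norm_M2_one] at this
      exact this.eventually_le_const (by norm_num)
    obtain ⟨a, ha⟩ := eventually_atBot.1 h1
    obtain ⟨C, hC⟩ := (isCompact_Icc (a := a) (b := c)).exists_bound_of_continuousOn
      hB.1.continuousOn
    refine ⟨max C 2, fun x hx => ?_⟩
    rcases le_total x a with h | h
    · exact (ha x h).trans (le_max_right _ _)
    · exact (hC x ⟨h, hx⟩).trans (le_max_left _ _)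
  -- Uniqueness holds among bounded functions, while $B$ is known to be bounded only left of $c$.
  -- Freezing $B$ beyond $c$ gives a bounded solution for the potential cut off at $c$.
  set f : ℝ → M2 := fun x => B (min x c) with hf
  have hfc : Continuous f := hB.1.comp (continuous_id.min continuous_const)
  have hfC : ∀ x, ‖f x‖ ≤ C := fun x => hC _ (min_le_right _ _)
  have hVf : Integrable fun y => (Iic c).indicator (knPot q l) y * f y :=
    hV.mul_bdd hfc.aestronglyMeasurable (Eventually.of_forall hfC)
  have hmain : ∀ x ≤ c, B x = 1 + ∫ y in Iic x, (Iic c).indicator (knPot q l) y * f y := by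
    intro x hx
    have h1 := intervalIntegral_tendsto_integral_Iic x hVf.integrableOn (tendsto_id (x := atBot))
    have h2 : ∀ᶠ a in atBot, B x - B a = ∫ y in a..x, (Iic c).indicator (knPot q l) y * f y := by
      filter_upwards [eventually_le_atBot x] with a ha
      ext i j
      rw [Matrix.sub_apply, hB.2, intervalIntegral_entry hVf.intervalIntegrable]
      refine intervalIntegral.integral_congr fun s hs => ?_
      rw [uIcc_of_le ha] at hs
      have hsc : s ≤ c := hs.2.trans hx
      simp only [hf, min_eq_left hsc, indicator_of_mem (mem_Iic.2 hsc)]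
    have h3 : Tendsto (fun a => B x - B a) atBot (𝓝 (B x - 1)) := hlim.const_sub _
    have h4 := tendsto_nhds_unique (h3.congr' h2) h1
    rw [← h4]; abel
  have hfe : f = evo ((Iic c).indicator (knPot q l)) := by
    refine eq_evo hV hfc hfC fun x => ?_
    rcases le_total x c with hx | hx
    · change B (min x c) = _
      rw [min_eq_left hx]
      exact hmain x hx
    · change B (min x c) = _
      rw [min_eq_right hx, hmain c le_rfl]
      congr 1
      refine (setIntegral_eq_of_subset_of_forall_sdiff_eq_zero measurableSet_Iic
        (Iic_subset_Iic.2 hx) fun y hy => ?_).symm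
      rw [indicator_of_notMem hy.2, zero_mul]
  have := congrFun hfe c
  simpa [hf] using this

lemma eq_evo_of_isInteraction (hi : Integrable (knPot q l)) {B : ℝ → M2} (hB : IsInteraction q l B)
    (hlim : Tendsto B atBot (𝓝 1)) (x : ℝ) : B x = evo (knPot q l) x := by
  rw [eq_evo_indicator hi hB hlim]
  have h := isInteraction_evo hi 1
  simp only [mul_one] at h
  exact (eq_evo_indicator hi h (tendsto_evo_atBot hi) x).symm

/-- The transition matrix is the inverse of the scattering matrix of the interaction picture. -/
lemma isTransition_iff (hq : Integrable q) (hq2 : MemLp q 2) (T : M2) :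
    IsTransition (-1) q l T ↔ scat (knPot q l) * T = 1 := by
  have hi := integrable_knPot hq hq2 l
  constructor
  · rintro ⟨Ψp, Ψm, ⟨hp, hplim⟩, ⟨hm, hmlim⟩, h⟩
    -- The Jost normalization has the exponential on the right, the interaction picture on the left.
    -- The two differ by conjugation with unitary matrices, which does not affect convergence to
    -- $I$.
    have back : ∀ {Ψ : ℝ → M2} {F : Filter ℝ},
        Tendsto (fun x => Ψ x * expSigma l x) F (𝓝 1) →
        Tendsto (fun x => expSigma l x * Ψ x) F (𝓝 1) := by
      intro Ψ F h
      refine (tendsto_conj_one h l (s := fun x => -x)).congr fun x => ?_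
      rw [neg_neg, mul_assoc, mul_assoc, expSigma_mul_neg, mul_one]
    have hm2 := eq_evo_of_isInteraction hi (isInteraction_of_isSolution hq hq2 hm) (back hmlim)
    have h1 : Tendsto (fun x => evo (knPot q l) x * T) atTop (𝓝 1) := by
      refine (back hplim).congr fun x => ?_
      rw [h, ← mul_assoc, hm2]
    exact tendsto_nhds_unique ((tendsto_evo_atTop hi).mul_const T) h1
  · intro hT
    have fwd : ∀ {B : ℝ → M2} {F : Filter ℝ}, Tendsto B F (𝓝 1) →
        Tendsto (fun x => expSigma l (-x) * B x * expSigma l x) F (𝓝 1) := fun h =>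
      tendsto_conj_one h l (s := fun x => x)
    have hm := isInteraction_evo hi 1
    simp only [mul_one] at hm
    refine ⟨_, _, ⟨isSolution_of_isInteraction hi (isInteraction_evo hi T), fwd ?_⟩,
      ⟨isSolution_of_isInteraction hi hm, fwd (tendsto_evo_atBot hi)⟩, fun x => ?_⟩
    · rw [← hT]
      exact (tendsto_evo_atTop hi).mul_const T
    · exact (mul_assoc _ _ _).symm

end RealLine

end

end DNLS

namespace DNLS

noncomputable section

/-! ### The scattering coefficient on $H^{2,2}$ as a uniform limit -/

section General

attribute [local instance] Matrix.linftyOpNormedRing Matrix.linftyOpNormedAlgebra normTopology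

/-- The growth in $|l|$ makes this useless for uniform bounds. It serves to identify the limit of
the scattering matrices at each fixed real point, where no derivative of the potential is needed. -/
lemma norm_knPot_sub_le (p q : ℝ → ℂ) (l x : ℝ) : ‖knPot p l x - knPot q l x‖ ≤
    (‖p x‖ + ‖q x‖) * ‖p x - q x‖ + (1 + |l|) * ‖p x - q x‖ := by
  have hs : ‖p x * (starRingEnd ℂ) (p x) - q x * (starRingEnd ℂ) (q x)‖ ≤
      (‖p x‖ + ‖q x‖) * ‖p x - q x‖ := by
    rw [show p x * (starRingEnd ℂ) (p x) - q x * (starRingEnd ℂ) (q x) =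
      p x * (starRingEnd ℂ) (p x - q x) + (p x - q x) * (starRingEnd ℂ) (q x) by
        rw [map_sub]; ring]
    refine (norm_add_le _ _).trans ?_
    rw [norm_mul, norm_mul, RCLike.norm_conj, RCLike.norm_conj]
    apply le_of_eq; ring
  have he : ∀ s : ℝ, ‖Complex.exp (s * (2 * Complex.I * l * x))‖ = 1 := fun s => by
    rw [show (s : ℂ) * (2 * Complex.I * l * x) = ((s * (2 * l * x) : ℝ) : ℂ) * Complex.I by
      push_cast; ring]
    exact Complex.norm_exp_ofReal_mul_I _
  have he1 := he 1
  have he2 := he (-1)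
  simp only [Complex.ofReal_one, one_mul, Complex.ofReal_neg, neg_mul] at he1 he2
  refine (norm_le_sum_entries _).trans ?_
  have e00 : (knPot p l x - knPot q l x) 0 0 = Complex.I / 2 *
      (p x * (starRingEnd ℂ) (p x) - q x * (starRingEnd ℂ) (q x)) := by
    simp only [knPot, Matrix.sub_apply, Matrix.of_apply, Matrix.cons_val]; ring
  have e11 : (knPot p l x - knPot q l x) 1 1 = -(Complex.I / 2) *
      (p x * (starRingEnd ℂ) (p x) - q x * (starRingEnd ℂ) (q x)) := by
    simp only [knPot, Matrix.sub_apply, Matrix.of_apply, Matrix.cons_val]; ring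
  have e01 : (knPot p l x - knPot q l x) 0 1 =
      (p x - q x) * Complex.exp (2 * Complex.I * l * x) := by
    simp only [knPot, Matrix.sub_apply, Matrix.of_apply, Matrix.cons_val]; ring
  have e10 : (knPot p l x - knPot q l x) 1 0 =
      -(l * (starRingEnd ℂ) (p x - q x)) * Complex.exp (-(2 * Complex.I * l * x)) := by
    simp only [knPot, Matrix.sub_apply, Matrix.of_apply, Matrix.cons_val, map_sub]; ring
  rw [e00, e11, e01, e10, norm_mul, norm_mul, norm_mul, norm_mul, he1, he2, norm_neg, norm_neg,
    norm_mul, RCLike.norm_conj, Complex.norm_real, Real.norm_eq_abs]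
  have hI : ‖Complex.I / 2‖ = 1 / 2 := by simp
  rw [hI]
  linarith

lemma integral_norm_knPot_sub_le (q r : H22) (l : ℝ) :
    ∫ x, ‖knPot (potential q) l x - knPot (potential r) l x‖ ≤
      (‖q‖ + ‖r‖ + (1 + |l|) * √Real.pi) * ‖q - r‖ := by
  have hsub := potential_sub q r
  have i1 : Integrable fun x => ‖potential (q - r) x‖ := (integrable_potential _).norm
  have m : ∀ p : H22, MemLp (fun x => ‖potential p x‖) 2 := fun p => (memLp_potential p).norm
  have i2 : ∀ p : H22, Integrable fun x => ‖potential p x‖ * ‖potential (q - r) x‖ := fun p =>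
    (m p).integrable_mul (m (q - r))
  have hb : ∀ p : H22, ∫ x, ‖potential p x‖ * ‖potential (q - r) x‖ ≤ ‖p‖ * ‖q - r‖ := by
    intro p
    refine (integral_mul_le_sqrt (fun _ => norm_nonneg _) (fun _ => norm_nonneg _)
      (m p) (m (q - r))).trans ?_
    gcongr
    · exact Real.sqrt_le_iff.2 ⟨norm_nonneg _, integral_norm_sq_potential_le p⟩
    · exact Real.sqrt_le_iff.2 ⟨norm_nonneg _, integral_norm_sq_potential_le _⟩
  calc _ ≤ ∫ x, (‖potential q x‖ * ‖potential (q - r) x‖ + ‖potential r x‖ *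
        ‖potential (q - r) x‖ + (1 + |l|) * ‖potential (q - r) x‖) := by
        refine integral_mono_ae ?_ (((i2 q).add (i2 r)).add (i1.const_mul _)) ?_
        · exact ((integrable_knPot (integrable_potential q) (memLp_potential q) l).sub
            (integrable_knPot (integrable_potential r) (memLp_potential r) l)).norm
        · filter_upwards [hsub] with x hx
          rw [hx]
          exact (norm_knPot_sub_le _ _ l x).trans (le_of_eq (by ring))
    _ = (∫ x, ‖potential q x‖ * ‖potential (q - r) x‖) +
        (∫ x, ‖potential r x‖ * ‖potential (q - r) x‖) +
        (1 + |l|) * ∫ x, ‖potential (q - r) x‖ := by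
        have i3 : Integrable fun x => ‖potential q x‖ * ‖potential (q - r) x‖ +
          ‖potential r x‖ * ‖potential (q - r) x‖ := (i2 q).add (i2 r)
        rw [integral_add i3 (i1.const_mul _), integral_add (i2 q) (i2 r),
          integral_const_mul]
    _ ≤ ‖q‖ * ‖q - r‖ + ‖r‖ * ‖q - r‖ + (1 + |l|) * (√Real.pi * ‖q - r‖) := by
        gcongr
        · exact hb q
        · exact hb r
        · exact integral_norm_potential_le _
    _ = _ := by ring

lemma integrable_knPot_test {u : ℝ → ℂ} (hu : IsTest u) (l : ℝ) : Integrable (knPot u l) :=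
  integrable_knPot hu.integrable hu.memLp l

lemma tendsto_zsScat_of_tendsto_emb {u : ℕ → ℝ → ℂ} (hu : ∀ n, IsTest (u n)) {q : H22}
    (h : Tendsto (fun n => emb (hu n)) atTop (𝓝 q)) (l : ℝ) :
    Tendsto (fun n => zsScat (u n) (dual (u n)) l) atTop (𝓝 (scat (knPot (potential q) l))) := by
  have h0 : Tendsto (fun n => ∫ y, ‖knPot (u n) l y - knPot (potential q) l y‖) atTop (𝓝 0) := by
    have h1 : Tendsto (fun n => (‖emb (hu n)‖ + ‖q‖ + (1 + |l|) * √Real.pi) * ‖emb (hu n) - q‖)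
        atTop (𝓝 ((‖q‖ + ‖q‖ + (1 + |l|) * √Real.pi) * 0)) := by
      refine Tendsto.mul ((h.norm.add_const _).add_const _) ?_
      exact tendsto_iff_norm_sub_tendsto_zero.1 h
    rw [mul_zero] at h1
    refine squeeze_zero (fun n => integral_nonneg fun _ => norm_nonneg _) (fun n => ?_) h1
    refine le_trans (le_of_eq (integral_congr_ae ?_)) (integral_norm_knPot_sub_le (emb (hu n)) q l)
    filter_upwards [potential_emb (hu n)] with x hx
    simp only [knPot, hx]
  refine (tendsto_scat (integrable_knPot (integrable_potential q) (memLp_potential q) l)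
    (fun n => integrable_knPot_test (hu n) l) h0).congr fun n => ?_
  exact scat_knPot (hu n) l (integrable_knPot_test (hu n) l)

/-- With determinant one the adjugate is the inverse, so the lower right entry of the transition
matrix is the upper left entry of the scattering matrix. -/
lemma isTransition_adjugate {q : ℝ → ℂ} (hq : Integrable q) (hq2 : MemLp q 2) {l : ℝ}
    (hdet : (scat (knPot q l)).det = 1) :
    IsTransition (-1) q l (scat (knPot q l)).adjugate := by
  rw [isTransition_iff hq hq2, Matrix.mul_adjugate, hdet, one_smul]

/-- The transition matrix is unique. -/
lemma IsTransition.eq {q : H22} {l : ℝ} {T T' : M2} (h : IsTransition (-1) (potential q) l T)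
    (h' : IsTransition (-1) (potential q) l T') : T = T' := by
  rw [isTransition_iff (integrable_potential q) (memLp_potential q)] at h h'
  rw [mul_eq_one_comm] at h
  calc T = T * (scat (knPot (potential q) l) * T') := by rw [h', mul_one]
    _ = T' := by rw [← mul_assoc, h, one_mul]

lemma exists_seq_tendsto (q : H22) : ∃ (u : ℕ → ℝ → ℂ) (hu : ∀ n, IsTest (u n)),
    (∀ n, ‖emb (hu n) - q‖ ≤ 1) ∧ Tendsto (fun n => emb (hu n)) atTop (𝓝 q) := by
  choose u hu h using fun n : ℕ => exists_emb_near q (ε := 1 / ((n : ℝ) + 1)) (by positivity)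
  refine ⟨u, hu, fun n => (h n).le.trans ?_, ?_⟩
  · rw [div_le_one (by positivity)]
    have : (0 : ℝ) ≤ n := by positivity
    linarith
  · rw [tendsto_iff_norm_sub_tendsto_zero]
    exact squeeze_zero (fun n => norm_nonneg _) (fun n => (h n).le)
      tendsto_one_div_add_atTop_nhds_zero_nat

/-- The scattering coefficient exists, and it is the uniform limit of those of test functions. -/
theorem exists_isAlphaBreve (q : H22) : ∃ a : ℂ → ℂ, IsAlphaBreve (-1) (potential q) a ∧
    ∀ ε > 0, ∃ δ > 0, ∀ (u : ℝ → ℂ) (hu : IsTest u), ‖emb hu - q‖ < δ →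
      ∀ l : ℂ, 0 ≤ l.im → ‖a l - testA u l‖ ≤ ε := by
  obtain ⟨u, hu, hu1, hlim⟩ := exists_seq_tendsto q
  -- One Lipschitz constant for the ball of radius $\|q\|+1$, which contains all approximants used
  -- below.
  obtain ⟨C, hC0, hC⟩ := exists_norm_testA_sub_le (‖q‖ + 1)
  have hK : ∀ {v : ℝ → ℂ} (hv : IsTest v), ‖emb hv - q‖ ≤ 1 → ‖emb hv‖ ≤ ‖q‖ + 1 := by
    intro v hv h
    have := norm_le_norm_add_norm_sub' (emb hv) q
    linarith
  have hex : ∀ l : ℂ, 0 ≤ l.im → ∃ z, Tendsto (fun n => testA (u n) l) atTop (𝓝 z) := by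
    intro l hl
    refine cauchySeq_tendsto_of_complete (Metric.cauchySeq_iff.2 fun ε hε => ?_)
    obtain ⟨N, hN⟩ := Metric.cauchySeq_iff.1 hlim.cauchySeq (ε / (C + 1)) (by positivity)
    refine ⟨N, fun m hm n hn => ?_⟩
    have h1 := hN m hm n hn
    rw [dist_eq_norm] at h1 ⊢
    refine (hC _ _ (hu m) (hu n) (hK _ (hu1 m)) (hK _ (hu1 n)) l hl).trans_lt ?_
    rw [lt_div_iff₀ (by positivity)] at h1
    nlinarith [norm_nonneg (emb (hu m) - emb (hu n))]
  choose! a ha using hex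
  have hbound : ∀ (v : ℝ → ℂ) (hv : IsTest v), ‖emb hv - q‖ ≤ 1 → ∀ l : ℂ, 0 ≤ l.im →
      ‖testA v l - a l‖ ≤ C * ‖emb hv - q‖ := by
    intro v hv h l hl
    refine le_of_tendsto_of_tendsto' ((ha l hl).const_sub _).norm
      ((hlim.const_sub (emb hv)).norm.const_mul C) fun n => ?_
    exact hC _ _ hv (hu n) (hK _ h) (hK _ (hu1 n)) l hl
  have happrox : ∀ ε > 0, ∃ δ > 0, ∀ (u : ℝ → ℂ) (hu : IsTest u), ‖emb hu - q‖ < δ →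
      ∀ l : ℂ, 0 ≤ l.im → ‖a l - testA u l‖ ≤ ε := by
    intro ε hε
    refine ⟨min 1 (ε / (C + 1)), by positivity, fun v hv h l hl => ?_⟩
    have h1 := h.le.trans (min_le_left _ _)
    have h2 := h.trans_le (min_le_right _ _)
    rw [norm_sub_rev]
    refine (hbound v hv h1 l hl).trans ?_
    rw [lt_div_iff₀ (by positivity)] at h2
    nlinarith [norm_nonneg (emb hv - q)]
  have hunif : TendstoUniformlyOn (fun n => testA (u n)) a atTop {z | 0 ≤ z.im} := by
    rw [Metric.tendstoUniformlyOn_iff]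
    intro ε hε
    obtain ⟨δ, hδ, H⟩ := happrox (ε / 2) (by positivity)
    have h1 := (tendsto_iff_norm_sub_tendsto_zero.1 hlim).eventually_lt_const hδ
    filter_upwards [h1] with n hn l hl
    rw [dist_eq_norm]
    exact (H _ (hu n) hn l hl).trans_lt (by linarith)
  refine ⟨a, ⟨?_, ?_, fun l => ?_⟩, happrox⟩
  · exact hunif.continuousOn
      (Frequently.of_forall fun n => (differentiable_testA (hu n)).continuous.continuousOn)
  · refine TendstoLocallyUniformlyOn.differentiableOn
      (hunif.mono fun z (hz : 0 < z.im) => hz.le).tendstoLocallyUniformlyOn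
      (Eventually.of_forall fun n => (differentiable_testA (hu n)).differentiableOn)
      (isOpen_lt continuous_const Complex.continuous_im)
  -- At a fixed real point the same sequence converges for a second reason, the $L^1$ convergence of
  -- the Kaup–Newell potentials; this identifies the limit with the scattering coefficient of $q$.
  · have hS := tendsto_zsScat_of_tendsto_emb hu hlim l
    have hdet : (scat (knPot (potential q) l)).det = 1 := by
      refine tendsto_nhds_unique (((Continuous.matrix_det continuous_id).tendsto _).comp hS) ?_
      refine tendsto_const_nhds.congr fun n => ?_
      exact (det_zsScat (isTestPair_dual (hu n)) l).symm
    refine ⟨_, isTransition_adjugate (integrable_potential q) (memLp_potential q) hdet, ?_⟩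
    rw [Matrix.adjugate_fin_two]
    exact tendsto_nhds_unique (ha l (by simp)) (((continuous_entry 0 0).tendsto _).comp hS)

end General

end

end DNLS

namespace DNLS

noncomputable section

/-! ### Analytic functions on the closed upper half-plane -/

section HalfPlane

open Set

lemma isOpen_upper : IsOpen {z : ℂ | 0 < z.im} := isOpen_lt continuous_const Complex.continuous_im

lemma isClosed_closedUpper : IsClosed {z : ℂ | 0 ≤ z.im} :=
  isClosed_le continuous_const Complex.continuous_im

/-- A function on the closed upper half-plane that vanishes on the real line vanishes. -/
lemma eq_zero_of_real_eq_zero {f : ℂ → ℂ} (hc : ContinuousOn f {z | 0 ≤ z.im})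
    (hd : DifferentiableOn ℂ f {z | 0 < z.im}) (h0 : ∀ x : ℝ, f x = 0) {z : ℂ} (hz : 0 ≤ z.im) :
    f z = 0 := by
  have h0' : ∀ w : ℂ, w.im = 0 → f w = 0 := fun w hw => by
    rw [show w = ((w.re : ℝ) : ℂ) by apply Complex.ext <;> simp [hw]]
    exact h0 _
  rcases hz.eq_or_lt with hz | hz
  · exact h0' z hz.symm
  set U : Set ℂ := {w | |w.re| < z.im ∧ |w.im| < z.im} with hU
  set V : Set ℂ := {w | |w.re| ≤ z.im ∧ |w.im| ≤ z.im} with hV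
  have cre : Continuous fun w : ℂ => |w.re| := Complex.continuous_re.abs
  have cim : Continuous fun w : ℂ => |w.im| := Complex.continuous_im.abs
  have hUo : IsOpen U := (isOpen_lt cre continuous_const).inter (isOpen_lt cim continuous_const)
  have hVc : IsClosed V :=
    (isClosed_le cre continuous_const).inter (isClosed_le cim continuous_const)
  have hUV : closure U ⊆ V := closure_minimal (fun w hw => ⟨hw.1.le, hw.2.le⟩) hVc
  have hUb : Bornology.IsBounded U := by
    refine (Metric.isBounded_closedBall (x := (0 : ℂ)) (r := z.im + z.im)).subset fun w hw => ?_
    rw [mem_closedBall_zero_iff]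
    exact (Complex.norm_le_abs_re_add_abs_im w).trans (add_le_add hw.1.le hw.2.le)
  -- On the square of half-side $\operatorname{Im}z$ all four arguments stay in the closed
  -- half-plane, and on each of its sides one of them is real. So $g=0$ on the boundary, and the
  -- maximum principle gives $g(0)=f(z)^4=0$.
  set g : ℂ → ℂ := fun w => f (z + w) * f (z + Complex.I * w) * (f (z - w) *
    f (z - Complex.I * w)) with hg
  have hgd : DifferentiableOn ℂ g U := by
    have h : ∀ φ : ℂ → ℂ, Differentiable ℂ φ → (∀ w ∈ U, 0 < (φ w).im) →
        DifferentiableOn ℂ (fun w => f (φ w)) U := fun φ h1 h2 => hd.comp h1.differentiableOn h2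
    refine ((h _ (by fun_prop) ?_).mul (h _ (by fun_prop) ?_)).mul
      ((h _ (by fun_prop) ?_).mul (h _ (by fun_prop) ?_)) <;>
    · rintro w ⟨h1, h2⟩
      rw [abs_lt] at h1 h2
      simp
      linarith
  have hgc : ContinuousOn g (closure U) := by
    have h : ∀ φ : ℂ → ℂ, Continuous φ → (∀ w ∈ V, 0 ≤ (φ w).im) →
        ContinuousOn (fun w => f (φ w)) (closure U) := fun φ h1 h2 =>
      (hc.comp h1.continuousOn h2).mono hUV
    refine ((h _ (by fun_prop) ?_).mul (h _ (by fun_prop) ?_)).mul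
      ((h _ (by fun_prop) ?_).mul (h _ (by fun_prop) ?_)) <;>
    · rintro w ⟨h1, h2⟩
      rw [abs_le] at h1 h2
      simp
      linarith
  have hfr : ∀ w ∈ frontier U, ‖g w‖ ≤ 0 := by
    intro w hw
    rw [hUo.frontier_eq] at hw
    obtain ⟨h1, h2⟩ := hUV hw.1
    rw [norm_le_zero_iff]
    have h3 : |w.re| = z.im ∨ |w.im| = z.im := by
      by_contra! h
      exact hw.2 ⟨lt_of_le_of_ne h1 h.1, lt_of_le_of_ne h2 h.2⟩
    have key : f (z + w) = 0 ∨ f (z + Complex.I * w) = 0 ∨ f (z - w) = 0 ∨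
        f (z - Complex.I * w) = 0 := by
      rcases h3 with h3 | h3 <;> rcases abs_choice (_ : ℝ) with h4 | h4 <;> rw [h4] at h3
      · right; right; right; apply h0'; simp [h3]
      · right; left; apply h0'; simp; linarith
      · right; right; left; apply h0'; simp [h3]
      · left; apply h0'; simp; linarith
    rcases key with h | h | h | h <;> simp [hg, h]
  have h00 : (0 : ℂ) ∈ closure U := subset_closure ⟨by simpa using hz, by simpa using hz⟩
  have := Complex.norm_le_of_forall_mem_frontier_norm_le hUb ⟨hgd, hgc⟩ hfr h00
  rw [norm_le_zero_iff] at this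
  simpa [hg] using this

/-- The scattering coefficient is determined on the closed upper half-plane. -/
lemma IsAlphaBreve.eqOn {q : H22} {a b : ℂ → ℂ} (ha : IsAlphaBreve (-1) (potential q) a)
    (hb : IsAlphaBreve (-1) (potential q) b) : EqOn a b {z | 0 ≤ z.im} := by
  intro z hz
  refine sub_eq_zero.1 (eq_zero_of_real_eq_zero (f := fun z => a z - b z)
    (ha.continuousOn.sub hb.continuousOn) (ha.analytic.sub hb.analytic) (fun x => ?_) hz)
  obtain ⟨T, hT, h1⟩ := ha.real_eq x
  obtain ⟨T', hT', h2⟩ := hb.real_eq x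
  simp only [h1, h2, hT.eq hT', sub_self]

lemma IsAlphaBreve.congr {ε : ℝ} {q : ℝ → ℂ} {a b : ℂ → ℂ} (ha : IsAlphaBreve ε q a)
    (h : EqOn a b {z | 0 ≤ z.im}) : IsAlphaBreve ε q b := by
  refine ⟨ha.continuousOn.congr h.symm, ha.analytic.congr fun z (hz : 0 < z.im) =>
    (h hz.le).symm, fun l => ?_⟩
  obtain ⟨T, hT, h1⟩ := ha.real_eq l
  exact ⟨T, hT, by rw [← h (by simp), h1]⟩

lemma isAlphaBreve_testA {u : ℝ → ℂ} (hu : IsTest u) :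
    IsAlphaBreve (-1) (potential (emb hu)) (testA u) := by
  obtain ⟨a, ha, H⟩ := exists_isAlphaBreve (emb hu)
  refine ha.congr fun z hz => ?_
  rw [← sub_eq_zero, ← norm_le_zero_iff]
  refine le_of_forall_pos_le_add fun ε hε => ?_
  obtain ⟨δ, hδ, h⟩ := H ε hε
  simpa using h u hu (by simpa using hδ) z hz

/-- Infinitely many zeros would accumulate in a compact part of the closed half-plane, at a zero
that is not real. By the identity theorem $f$ would vanish throughout the open half-plane,
contradicting its behaviour far out. -/
lemma finite_zeros {f : ℂ → ℂ} (hc : ContinuousOn f {z | 0 ≤ z.im})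
    (hd : DifferentiableOn ℂ f {z | 0 < z.im}) (hr : ∀ x : ℝ, f x ≠ 0) {M : ℝ}
    (hM : ∀ z : ℂ, 0 ≤ z.im → M < ‖z‖ → f z ≠ 0) : {z : ℂ | 0 < z.im ∧ f z = 0}.Finite := by
  by_contra hinf
  set K : Set ℂ := {z | 0 ≤ z.im} ∩ Metric.closedBall 0 M with hK
  have hKc : IsCompact K := (isCompact_closedBall _ _).inter_left isClosed_closedUpper
  have hsub : {z : ℂ | 0 < z.im ∧ f z = 0} ⊆ K := fun z hz => by
    refine ⟨hz.1.le, ?_⟩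
    rw [mem_closedBall_zero_iff]
    by_contra! h
    exact hM z hz.1.le h hz.2
  obtain ⟨z, hzK, hacc⟩ := Set.Infinite.exists_accPt_of_subset_isCompact hinf hKc hsub
  have hfreq : ∃ᶠ w in 𝓝[≠] z, 0 < w.im ∧ f w = 0 := accPt_iff_frequently_nhdsNE.1 hacc
  have hz0 : f z = 0 := by
    by_contra hne
    have h1 : ∀ᶠ w in 𝓝[{z | 0 ≤ z.im}] z, f w ≠ 0 := (hc z hzK.1).eventually_ne hne
    rw [eventually_nhdsWithin_iff] at h1
    obtain ⟨w, hw, h2⟩ := (hfreq.and_eventually (h1.filter_mono nhdsWithin_le_nhds)).exists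
    exact h2 hw.1.le hw.2
  have hzpos : 0 < z.im := by
    refine lt_of_le_of_ne hzK.1 fun h => hr z.re ?_
    rw [← hz0]
    congr 1
    apply Complex.ext <;> simp [← h]
  have hpre : IsPreconnected {z : ℂ | 0 < z.im} := (convex_halfSpace_im_gt 0).isPreconnected
  have hzero := (hd.analyticOnNhd isOpen_upper).eqOn_zero_of_preconnected_of_frequently_eq_zero
    hpre hzpos (hfreq.mono fun w hw => hw.2)
  have hp : (0 : ℝ) < |M| + 1 := by positivity
  have him : (((|M| + 1 : ℝ) : ℂ) * Complex.I).im = |M| + 1 := by simp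
  have h1 := hzero (x := ((|M| + 1 : ℝ) : ℂ) * Complex.I) (by rw [mem_ofPred_eq, him]; exact hp)
  refine hM _ (by rw [him]; exact hp.le) ?_ h1
  rw [norm_mul, Complex.norm_I, mul_one, Complex.norm_real, Real.norm_of_nonneg hp.le]
  linarith [le_abs_self M]

/-- The zero set is discrete by the identity theorem, and a discrete subset of the hereditarily
Lindelöf plane is countable. -/
lemma countable_zeros {f : ℂ → ℂ} (hf : Differentiable ℂ f) (h : ∃ z, f z ≠ 0) :
    {z | f z = 0}.Countable := by
  obtain ⟨w, hw⟩ := h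
  have ha : AnalyticOnNhd ℂ f univ := hf.differentiableOn.analyticOnNhd isOpen_univ
  rcases ha.eqOn_zero_or_eventually_ne_zero_of_preconnected isPreconnected_univ with h1 | h1
  · exact absurd (h1 (mem_univ w)) hw
  · have h2 := (mem_codiscrete'.1 h1).2
    have h3 : {z | f z ≠ 0}ᶜ = {z | f z = 0} := by ext; simp
    rw [h3] at h2
    exact (HereditarilyLindelofSpace.isLindelof _).countable_of_isDiscrete h2

end HalfPlane

/-! ### Openness -/

section Open

open Set

lemma exists_norm_sub_one_le {u : ℝ → ℂ} (hu : IsTest u) {ε : ℝ} (hε : 0 < ε) :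
    ∃ M : ℝ, 0 ≤ M ∧ ∀ z : ℂ, 0 ≤ z.im → M < ‖z‖ → ‖testA u z - 1‖ ≤ ε := by
  obtain ⟨C, hC⟩ := exists_norm_testA_sub_one_le hu
  refine ⟨|C| / ε, by positivity, fun z hz hM => ?_⟩
  have hz0 : 0 < ‖z‖ := lt_of_le_of_lt (by positivity) hM
  refine (hC z hz (norm_pos_iff.1 hz0)).trans ?_
  rw [div_le_iff₀ hz0]
  rw [div_lt_iff₀ hε] at hM
  linarith [le_abs_self C]

/-- The scattering coefficient, extended to the closed upper half-plane. -/
def alphaBreve (q : H22) : ℂ → ℂ := (exists_isAlphaBreve q).choose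

lemma isAlphaBreve_alphaBreve (q : H22) : IsAlphaBreve (-1) (potential q) (alphaBreve q) :=
  (exists_isAlphaBreve q).choose_spec.1

lemma exists_norm_alphaBreve_sub_testA_le (q : H22) {ε : ℝ} (hε : 0 < ε) :
    ∃ δ > 0, ∀ (u : ℝ → ℂ) (hu : IsTest u), ‖emb hu - q‖ < δ →
      ∀ l : ℂ, 0 ≤ l.im → ‖alphaBreve q l - testA u l‖ ≤ ε :=
  (exists_isAlphaBreve q).choose_spec.2 ε hε

/-- The approximation property compares with test functions only, so a test function close to both
`q n` and `r` serves as an intermediary. -/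
lemma tendstoUniformlyOn_alphaBreve {q : ℕ → H22} {r : H22} (h : Tendsto q atTop (𝓝 r)) :
    TendstoUniformlyOn (fun n => alphaBreve (q n)) (alphaBreve r) atTop {z | 0 ≤ z.im} := by
  rw [Metric.tendstoUniformlyOn_iff]
  intro ε hε
  obtain ⟨δ, hδ, H⟩ := exists_norm_alphaBreve_sub_testA_le r (ε := ε / 3) (by positivity)
  have h1 := (tendsto_iff_norm_sub_tendsto_zero.1 h).eventually_lt_const
    (show (0:ℝ) < δ / 2 by positivity)
  filter_upwards [h1] with n hn l hl
  obtain ⟨δ', hδ', H'⟩ := exists_norm_alphaBreve_sub_testA_le (q n) (ε := ε / 3) (by positivity)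
  obtain ⟨u, hu, hun⟩ := exists_emb_near (q n) (ε := min δ' (δ / 2)) (by positivity)
  have h2 := H' u hu (hun.trans_le (min_le_left _ _)) l hl
  have h3 : ‖emb hu - r‖ < δ := by
    calc _ = ‖(emb hu - q n) + (q n - r)‖ := by rw [sub_add_sub_cancel]
      _ ≤ _ := norm_add_le _ _
      _ < δ / 2 + δ / 2 := add_lt_add (hun.trans_le (min_le_right _ _)) hn
      _ = δ := by ring
  have h4 := H u hu h3 l hl
  rw [dist_eq_norm]
  calc _ = ‖(alphaBreve r l - testA u l) - (alphaBreve (q n) l - testA u l)‖ := by congr 1; ring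
    _ ≤ _ := norm_sub_le _ _
    _ ≤ ε / 3 + ε / 3 := add_le_add h4 h2
    _ < ε := by linarith

lemma exists_alphaBreve_near_one (q : H22) :
    ∃ M : ℝ, ∀ z : ℂ, 0 ≤ z.im → M < ‖z‖ → ‖alphaBreve q z - 1‖ ≤ 1 / 2 := by
  obtain ⟨δ, hδ, H⟩ := exists_norm_alphaBreve_sub_testA_le q (ε := 1 / 4) (by norm_num)
  obtain ⟨u, hu, hun⟩ := exists_emb_near q hδ
  obtain ⟨M, -, hM⟩ := exists_norm_sub_one_le hu (ε := 1 / 4) (by norm_num)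
  refine ⟨M, fun z hz hzM => ?_⟩
  calc _ = ‖(alphaBreve q z - testA u z) + (testA u z - 1)‖ := by rw [sub_add_sub_cancel]
    _ ≤ _ := norm_add_le _ _
    _ ≤ 1 / 4 + 1 / 4 := add_le_add (H u hu hun z hz) (hM z hz hzM)
    _ = 1 / 2 := by norm_num

/-- Finiteness is not assumed: it follows from the absence of real zeros and from closeness to $1$
far out. Membership is thus a condition on each zero separately. -/
lemma mem_genericSet_of_alphaBreve {q : H22}
    (h : ∀ z : ℂ, 0 ≤ z.im → alphaBreve q z = 0 → 0 < z.im ∧ deriv (alphaBreve q) z ≠ 0) :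
    q ∈ genericSet (-1) := by
  have ha := isAlphaBreve_alphaBreve q
  have hr : ∀ l : ℝ, alphaBreve q l ≠ 0 := fun l hl => by
    simpa using (h l (by simp) hl).1
  obtain ⟨M, hM⟩ := exists_alphaBreve_near_one q
  refine ⟨_, ha, hr, finite_zeros ha.continuousOn ha.analytic hr (M := M) fun z hz hzM h0 => ?_,
    fun z hz h0 => (h z hz.le h0).2⟩
  have := hM z hz hzM
  rw [h0] at this
  norm_num at this

lemma alphaBreve_of_mem_genericSet {q : H22} (h : q ∈ genericSet (-1)) {z : ℂ} (hz : 0 ≤ z.im)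
    (h0 : alphaBreve q z = 0) : 0 < z.im ∧ deriv (alphaBreve q) z ≠ 0 := by
  obtain ⟨a, ha, hr, -, hs⟩ := h
  have e := (isAlphaBreve_alphaBreve q).eqOn ha
  have hz' : 0 < z.im := by
    refine lt_of_le_of_ne hz fun h => hr z.re ?_
    rw [← h0, e hz]
    congr 1
    apply Complex.ext <;> simp [← h]
  refine ⟨hz', ?_⟩
  rw [EventuallyEq.deriv_eq (f := a)]
  · exact hs z hz' (by rw [← e hz, h0])
  · filter_upwards [isOpen_upper.mem_nhds hz'] with w hw using e (le_of_lt hw)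

theorem isOpen_genericSet : IsOpen (genericSet (-1)) := by
  rw [← isClosed_compl_iff, ← isSeqClosed_iff_isClosed]
  intro q r hq hlim hr
  have hunif := tendstoUniformlyOn_alphaBreve hlim
  -- A bad zero is either real or multiple. The implication records both cases at once; if the limit
  -- is not real, the second case holds eventually, and locally uniform convergence of the
  -- derivatives carries it to the limit.
  have hex : ∀ n, ∃ z : ℂ, 0 ≤ z.im ∧ alphaBreve (q n) z = 0 ∧
      (0 < z.im → deriv (alphaBreve (q n)) z = 0) := by
    intro n
    by_contra! h
    refine hq n (mem_genericSet_of_alphaBreve fun z hz h0 => h z hz h0)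
  choose z hz hz0 hzd using hex
  obtain ⟨M, hM⟩ := exists_alphaBreve_near_one r
  have hbd : ∀ᶠ n in atTop, z n ∈ {z : ℂ | 0 ≤ z.im} ∩ Metric.closedBall 0 M := by
    filter_upwards [Metric.tendstoUniformlyOn_iff.1 hunif (1 / 4) (by norm_num)] with n hn
    refine ⟨hz n, ?_⟩
    rw [mem_closedBall_zero_iff]
    by_contra! h
    have h1 := hn (z n) (hz n)
    rw [dist_eq_norm, hz0, sub_zero] at h1
    have h2 := hM (z n) (hz n) h
    have h3 := norm_sub_norm_le (1 : ℂ) (1 - alphaBreve r (z n))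
    rw [sub_sub_cancel, norm_one, norm_sub_rev] at h3
    linarith
  obtain ⟨w, hw, φ, hφ, hlimw⟩ := ((isCompact_closedBall (0 : ℂ) M).inter_left
    isClosed_closedUpper).tendsto_subseq' hbd.frequently
  have hunif' : TendstoUniformlyOn (fun n => alphaBreve (q (φ n))) (alphaBreve r) atTop
      {z | 0 ≤ z.im} := fun u hu => hφ.tendsto_atTop.eventually (hunif u hu)
  have ha := isAlphaBreve_alphaBreve r
  have hw0 : alphaBreve r w = 0 := by
    have h1 := hunif'.tendsto_comp (ha.continuousOn w hw.1) (g := fun n => z (φ n))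
      (tendsto_nhdsWithin_iff.2 ⟨hlimw, Eventually.of_forall fun n => hz _⟩)
    refine tendsto_nhds_unique h1 (tendsto_const_nhds.congr fun n => (hz0 _).symm)
  obtain ⟨hwpos, hwd⟩ := alphaBreve_of_mem_genericSet hr hw.1 hw0
  apply hwd
  have hloc : TendstoLocallyUniformlyOn (fun n => alphaBreve (q (φ n))) (alphaBreve r) atTop
      {z | 0 < z.im} :=
    (hunif'.mono fun z (hz : 0 < z.im) => hz.le).tendstoLocallyUniformlyOn
  have hder := hloc.deriv (Eventually.of_forall fun n => (isAlphaBreve_alphaBreve _).analytic)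
    isOpen_upper
  have hev : ∀ᶠ n in atTop, 0 < (z (φ n)).im := hlimw.eventually (isOpen_upper.mem_nhds hwpos)
  have h1 := hder.tendsto_comp ((ha.analytic.deriv isOpen_upper).continuousOn w hwpos) hwpos
    (g := fun n => z (φ n)) (tendsto_nhdsWithin_iff.2 ⟨hlimw, hev⟩)
  refine tendsto_nhds_unique h1 (tendsto_const_nhds.congr' ?_)
  filter_upwards [hev] with n hn
  exact (hzd _ hn).symm

lemma emb_mem_genericSet {u : ℝ → ℂ} (hu : IsTest u)
    (h : ∀ z : ℂ, 0 ≤ z.im → testA u z = 0 → 0 < z.im ∧ deriv (testA u) z ≠ 0) :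
    emb hu ∈ genericSet (-1) := by
  have ha := isAlphaBreve_testA hu
  have hr : ∀ l : ℝ, testA u l ≠ 0 := fun l hl => by
    simpa using (h l (by simp) hl).1
  obtain ⟨M, -, hM⟩ := exists_norm_sub_one_le hu (ε := 1 / 2) (by norm_num)
  refine ⟨_, ha, hr, finite_zeros ha.continuousOn ha.analytic hr (M := M) fun z hz hzM h0 => ?_,
    fun z hz h0 => (h z hz.le h0).2⟩
  have := hM z hz hzM
  rw [h0] at this
  norm_num at this

end Open

end

end DNLS

namespace DNLS

noncomputable section

/-! ### Zeros of unimodular combinations of two entire functions -/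

section Unimodular

open Set

variable {A B : ℂ → ℂ}

lemma exists_norm_eq_one_notMem {S : Set ℂ} (hS : S.Countable) : ∃ c : ℂ, ‖c‖ = 1 ∧ c ∉ S := by
  by_contra! h
  have h1 : {θ : ℝ | Complex.exp (θ * Complex.I) ∈ S}.Countable :=
    (hS.preimage_cexp.preimage (mul_left_injective₀ Complex.I_ne_zero)).preimage
      Complex.ofReal_injective
  refine Cardinal.not_countable_real (h1.mono fun θ _ => ?_)
  exact h _ (Complex.norm_exp_ofReal_mul_I θ)

/-- The Wronskian of entire functions tending to `1` and `0` in the upper half-plane vanishes only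
if the second function does. -/
lemma eq_zero_of_wronskian_eq_zero (hA : Differentiable ℂ A) (hB : Differentiable ℂ B)
    (hA1 : ∃ M, ∀ z : ℂ, 0 ≤ z.im → M < ‖z‖ → ‖A z - 1‖ ≤ 1 / 4)
    (hB0 : ∀ ε > 0, ∃ M, ∀ z : ℂ, 0 ≤ z.im → M < ‖z‖ → ‖B z‖ ≤ ε)
    (hW : ∀ z, A z * deriv B z - deriv A z * B z = 0) (z : ℂ) : B z = 0 := by
  obtain ⟨M, hM⟩ := hA1
  set s : Set ℂ := {z | max M 0 < z.im} with hs
  have hnorm : ∀ z ∈ s, M < ‖z‖ ∧ 0 ≤ z.im := fun z hz =>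
    ⟨((le_max_left _ _).trans_lt hz).trans_le ((le_abs_self _).trans (Complex.abs_im_le_norm z)),
      ((le_max_right _ _).trans_lt hz).le⟩
  have hAs : ∀ z ∈ s, 3 / 4 ≤ ‖A z‖ := by
    intro z hz
    have h1 := hM z (hnorm z hz).2 (hnorm z hz).1
    have h2 := norm_sub_norm_le (1 : ℂ) (1 - A z)
    rw [sub_sub_cancel, norm_one, norm_sub_rev] at h2
    linarith
  have hA0 : ∀ z ∈ s, A z ≠ 0 := fun z hz h => by
    have := hAs z hz
    rw [h, norm_zero] at this
    norm_num at this
  have hso : IsOpen s := isOpen_lt continuous_const Complex.continuous_im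
  have hsc : Convex ℝ s := convex_halfSpace_im_gt _
  -- The numerator of $(B/A)'$ is the Wronskian. So $B/A$ is constant on this half-plane, the
  -- constant is the limit $0$, and the identity theorem extends $B=0$ to the whole plane.
  have hd : ∀ w ∈ s, HasDerivAt (fun z => B z / A z) 0 w := by
    intro w hw
    refine ((hB w).hasDerivAt.fun_div (hA w).hasDerivAt (hA0 w hw)).congr_deriv ?_
    have := hW w
    rw [show deriv B w * A w - B w * deriv A w = 0 by linear_combination this, zero_div]
  have hconst : ∀ w ∈ s, ∀ w' ∈ s, B w / A w = B w' / A w' := fun w hw w' hw' =>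
    hsc.is_const_of_fderivWithin_eq_zero (𝕜 := ℂ)
      (fun x hx => (hd x hx).differentiableAt.differentiableWithinAt)
      (fun x hx => by
        rw [fderivWithin_of_isOpen hso hx]
        ext
        simpa using (hd x hx).deriv) hw hw'
  have hBs : ∀ w ∈ s, B w = 0 := by
    intro w hw
    have hk : ‖B w / A w‖ ≤ 0 := by
      refine le_of_forall_pos_le_add fun ε hε => ?_
      obtain ⟨M', hM'⟩ := hB0 (ε / 2) (by positivity)
      set t : ℝ := max (max M 0) |M'| + 1 with ht
      have him : ((t : ℂ) * Complex.I).im = t := by simp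
      have hts : (t : ℂ) * Complex.I ∈ s := by
        rw [hs, mem_ofPred_eq, him]
        exact (le_max_left _ _).trans_lt (lt_add_one _)
      have htn : ‖(t : ℂ) * Complex.I‖ = |t| := by simp
      have ht' : M' < ‖(t : ℂ) * Complex.I‖ := by
        rw [htn]
        have := le_max_right (max M 0) |M'|
        linarith [le_abs_self t, le_abs_self M']
      rw [hconst w hw _ hts, norm_div, zero_add]
      have h1 := hM' _ (hnorm _ hts).2 ht'
      have h2 := hAs _ hts
      rw [div_le_iff₀ (by linarith)]
      nlinarith
    rw [norm_le_zero_iff, div_eq_zero_iff] at hk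
    exact hk.resolve_right (hA0 w hw)
  have hne : ((max M 0 + 1 : ℝ) : ℂ) * Complex.I ∈ s := by
    have him : (((max M 0 + 1 : ℝ) : ℂ) * Complex.I).im = max M 0 + 1 := by simp
    rw [hs, mem_ofPred_eq, him]
    exact lt_add_one _
  exact (hB.differentiableOn.analyticOnNhd isOpen_univ).eqOn_zero_of_preconnected_of_eventuallyEq_zero
    isPreconnected_univ (mem_univ _) (mem_of_superset (hso.mem_nhds hne) hBs) (mem_univ z)

/-- A generic unimodular combination has only simple zeros, none of them real. -/
lemma exists_unimodular (hA : Differentiable ℂ A) (hB : Differentiable ℂ B)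
    (hA1 : ∃ M, ∀ z : ℂ, 0 ≤ z.im → M < ‖z‖ → ‖A z - 1‖ ≤ 1 / 4)
    (hB0 : ∀ ε > 0, ∃ M, ∀ z : ℂ, 0 ≤ z.im → M < ‖z‖ → ‖B z‖ ≤ ε)
    (hAB : ∀ z : ℂ, 0 ≤ z.im → A z = 0 → B z ≠ 0) :
    ∃ c : ℂ, ‖c‖ = 1 ∧ ∀ z : ℂ, 0 ≤ z.im → A z + c * B z = 0 →
      0 < z.im ∧ deriv A z + c * deriv B z ≠ 0 := by
  by_cases hBz : ∀ z, B z = 0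
  · refine ⟨1, norm_one, fun z hz h => ?_⟩
    rw [hBz, mul_zero, add_zero] at h
    exact absurd (hBz z) (hAB z hz h)
  set W : ℂ → ℂ := fun z => A z * deriv B z - deriv A z * B z with hWdef
  set s : ℂ → ℂ := DFunLike.coe (starRingEnd ℂ) with hs
  -- The entire extension of $|A|^2-|B|^2$ from the real axis; being entire and nonzero somewhere,
  -- it has only countably many zeros.
  set D : ℂ → ℂ := fun z => A z * s (A (s z)) - B z * s (B (s z)) with hDdef
  have hdA : Differentiable ℂ (deriv A) := hA.deriv
  have hdB : Differentiable ℂ (deriv B) := hB.deriv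
  have hW : Differentiable ℂ W := (hA.mul hdB).sub (hdA.mul hB)
  have hconj : ∀ {F : ℂ → ℂ}, Differentiable ℂ F → Differentiable ℂ fun z => s (F (s z)) := by
    intro F hF z
    exact differentiableAt_conj_conj_iff.2 (hF _)
  have hD : Differentiable ℂ D := (hA.mul (hconj hA)).sub (hB.mul (hconj hB))
  have hW0 : ∃ z, W z ≠ 0 := by
    by_contra! h
    exact hBz (eq_zero_of_wronskian_eq_zero hA hB hA1 hB0 h)
  have hD0 : ∃ z, D z ≠ 0 := by
    obtain ⟨M, hM⟩ := hA1
    obtain ⟨M', hM'⟩ := hB0 (1 / 4) (by norm_num)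
    set t : ℝ := max |M| |M'| + 1 with ht
    have htp : 0 ≤ t := by positivity
    have htn : ‖(t : ℂ)‖ = t := by rw [Complex.norm_real, Real.norm_of_nonneg htp]
    have h1 := hM t (by simp) (by rw [htn]; linarith [le_abs_self M, le_max_left |M| |M'|])
    have h2 := hM' t (by simp) (by rw [htn]; linarith [le_abs_self M', le_max_right |M| |M'|])
    have h3 := norm_sub_norm_le (1 : ℂ) (1 - A t)
    rw [sub_sub_cancel, norm_one, norm_sub_rev] at h3
    refine ⟨t, fun h => ?_⟩
    simp only [hDdef, hs, Complex.conj_ofReal, Complex.mul_conj, sub_eq_zero] at h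
    have h4 : Complex.normSq (A t) = Complex.normSq (B t) := by exact_mod_cast h
    rw [Complex.normSq_eq_norm_sq, Complex.normSq_eq_norm_sq] at h4
    nlinarith [norm_nonneg (B t)]
  -- At a zero of $A+cB$ in the closed half-plane $B\ne0$, so the zero determines $c=-A/B$. A
  -- multiple zero is a zero of $W$ and a real one a zero of $D$, so all bad $c$ lie in this
  -- countable set.
  have hS : ((fun z => -(A z / B z)) '' ({z | W z = 0} ∪ {z | D z = 0})).Countable :=
    ((countable_zeros hW hW0).union (countable_zeros hD hD0)).image _
  obtain ⟨c, hc, hcS⟩ := exists_norm_eq_one_notMem hS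
  refine ⟨c, hc, fun z hz h => ?_⟩
  have hBne : B z ≠ 0 := by
    intro hb
    rw [hb, mul_zero, add_zero] at h
    exact hAB z hz h hb
  have hcz : -(A z / B z) = c := by
    field_simp
    linear_combination -h
  have hnot : ¬ (W z = 0 ∨ D z = 0) := fun h' => hcS ⟨z, h', hcz⟩
  push Not at hnot
  constructor
  · refine lt_of_le_of_ne hz fun h0 => hnot.2 ?_
    have hsz : s z = z := Complex.conj_eq_iff_im.2 h0.symm
    have hA' : A z = -(c * B z) := by linear_combination h
    simp only [hDdef, hsz, hA']
    rw [hs, map_neg, map_mul]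
    have hcc : c * (starRingEnd ℂ) c = 1 := by
      rw [Complex.mul_conj, Complex.normSq_eq_norm_sq, hc]; simp
    linear_combination (B z * (starRingEnd ℂ) (B z)) * hcc
  · intro h'
    refine hnot.1 ?_
    simp only [hWdef]
    linear_combination deriv B z * h - B z * h'

end Unimodular

end

end DNLS

namespace DNLS

noncomputable section

/-! ### Scattering data of small bumps -/

section Bump

open Set

attribute [local instance] Matrix.linftyOpNormedRing Matrix.linftyOpNormedAlgebra normTopology

variable {u v ρ : ℝ → ℂ}

lemma emb_congr (hu : IsTest u) (hv : IsTest v) (h : u = v) : emb hu = emb hv := by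
  subst h; rfl

lemma dual_eq_zero {x : ℝ} (h : u =ᶠ[𝓝 x] 0) : dual u x = 0 := by
  have h1 : deriv u x = 0 := by rw [h.deriv_eq]; simp
  have h2 : u x = 0 := h.eq_of_nhds
  simp [dual, h1, h2]

/-- The cubic term splits since one of the functions vanishes at each point. For $|c|=1$ both the
linear and the cubic term pick up $\bar c=c^{-1}$, the factor that `zsScat_rotate` requires. -/
lemma dual_add_mul (hu : IsTest u) (hv : IsTest v) {c : ℂ} (hc : ‖c‖ = 1)
    (h : ∀ x, u x = 0 ∨ v x = 0) :
    dual (fun x => u x + c * v x) = fun x => dual u x + c⁻¹ * dual v x := by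
  have hcc : c * (starRingEnd ℂ) c = 1 := by
    rw [Complex.mul_conj, Complex.normSq_eq_norm_sq, hc]; simp
  have hc' : c⁻¹ = (starRingEnd ℂ) c := inv_eq_of_mul_eq_one_right hcc
  ext x
  have hd : deriv (fun x => u x + c * v x) x = deriv u x + c * deriv v x :=
    ((hu.hasDerivAt x).add ((hv.hasDerivAt x).const_mul c)).deriv
  rw [hc']
  simp only [dual, hd, map_add, map_mul]
  rcases h x with h0 | h0 <;> simp only [h0, map_zero, mul_zero, add_zero, zero_add]
  · linear_combination (-(1 / 4) * (starRingEnd ℂ) c * v x * (starRingEnd ℂ) (v x) *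
      (starRingEnd ℂ) (v x)) * hcc
  · ring

lemma testA_zero (l : ℂ) : testA 0 l = 1 := by
  have h : dual (0 : ℝ → ℂ) = 0 := by
    ext x
    exact dual_eq_zero EventuallyEq.rfl
  rw [testA, h, zsScat_zero]
  simp

lemma isTest_zero : IsTest (0 : ℝ → ℂ) := ⟨contDiff_const, HasCompactSupport.zero⟩

lemma norm_emb_const_mul (hu : IsTest u) (c : ℂ) : ‖emb (hu.const_mul c)‖ = ‖c‖ * ‖emb hu‖ := by
  rw [emb_const_mul, norm_smul]

lemma emb_zero : emb isTest_zero = 0 := by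
  have h := norm_emb_const_mul isTest_zero 0
  rw [emb_congr (isTest_zero.const_mul 0) isTest_zero (by ext; simp), norm_zero, zero_mul] at h
  exact norm_eq_zero.1 h

/-- Small multiples of a test function have scattering coefficients close to `1`. -/
lemma exists_testA_const_mul_near_one (hu : IsTest u) {ε : ℝ} (hε : 0 < ε) :
    ∃ δ > 0, ∀ s : ℝ, 0 ≤ s → s ≤ δ → ∀ l : ℂ, 0 ≤ l.im →
      ‖testA (fun x => (s : ℂ) * u x) l - 1‖ ≤ ε := by
  obtain ⟨C, hC0, hC⟩ := exists_norm_testA_sub_le 1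
  -- The $1$ in the minimum keeps the scaled function in the unit ball, where $C$ is valid; the
  -- $\varepsilon$ makes the Lipschitz bound against the zero function small enough.
  have hδ : 0 < min 1 ε / ((C + 1) * (‖emb hu‖ + 1)) := by positivity
  refine ⟨_, hδ, fun s hs hsδ l hl => ?_⟩
  have hn : ‖emb (hu.const_mul s)‖ = s * ‖emb hu‖ := by
    rw [norm_emb_const_mul, Complex.norm_real, Real.norm_of_nonneg hs]
  rw [le_div_iff₀ (by positivity)] at hsδ
  have h0 := norm_nonneg (emb hu)
  have h1 : (C + 1) * (s * ‖emb hu‖) ≤ min 1 ε := by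
    refine le_trans ?_ hsδ
    have : s * ‖emb hu‖ ≤ s * (‖emb hu‖ + 1) := by gcongr; linarith
    nlinarith
  have h2 : 0 ≤ s * ‖emb hu‖ := by positivity
  have h3 := hC _ _ (hu.const_mul s) isTest_zero
    (by rw [hn]; nlinarith [min_le_left 1 ε]) (by rw [emb_zero]; simp) l hl
  rw [testA_zero, emb_zero, sub_zero, hn] at h3
  refine h3.trans ?_
  nlinarith [min_le_right 1 ε]

lemma norm_dual_const_mul_le (hu : IsTest u) {s : ℝ} (hs : 0 ≤ s) (hs1 : s ≤ 1) (x : ℝ) :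
    ‖dual (fun x => (s : ℂ) * u x) x‖ ≤ s * (‖deriv u x‖ + ‖u x‖ ^ 3) := by
  have hd : deriv (fun x => (s : ℂ) * u x) x = s * deriv u x :=
    ((hu.hasDerivAt x).const_mul (s : ℂ)).deriv
  simp only [dual, hd]
  refine (norm_sub_le _ _).trans ?_
  simp only [norm_mul, RCLike.norm_conj, Complex.norm_real, Real.norm_of_nonneg hs, norm_div,
    Complex.norm_I, norm_one, RCLike.norm_ofNat]
  have h1 : s ^ 3 ≤ s := by nlinarith [mul_nonneg hs hs]
  have h2 : 0 ≤ ‖u x‖ ^ 3 := by positivity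
  have h3 : 0 ≤ s * ‖deriv u x‖ := by positivity
  nlinarith [mul_le_mul_of_nonneg_right h1 h2, mul_nonneg hs h2]

lemma norm_exp_le_of_norm_le {l : ℂ} {M x X : ℝ} (hl : ‖l‖ ≤ M) (hx : |x| ≤ X) (s : ℝ)
    (hs : |s| = 1) : ‖Complex.exp (s * (2 * Complex.I * l * x))‖ ≤ Real.exp (2 * M * X) := by
  refine (Complex.norm_exp_le_exp_norm _).trans (Real.exp_le_exp.2 ?_)
  have h0 := norm_nonneg l
  simp only [norm_mul, Complex.norm_real, Real.norm_eq_abs, hs, RCLike.norm_ofNat, Complex.norm_I]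
  have := mul_le_mul hl hx (abs_nonneg _) (h0.trans hl)
  linarith

/-- Off-diagonal scattering data of a small bump do not vanish for bounded spectral parameter. -/
lemma exists_zsScat_bump_ne_zero {a d M : ℝ} (hM : 0 ≤ M) (hd : 16 * M * d ≤ 1) (hρ : IsTest ρ)
    (hρr : ∀ x, ρ x = ‖ρ x‖) (hρ0 : ∃ x, ρ x ≠ 0) (hsupp : ∀ x, d < |x - a| → ρ x = 0) :
    ∃ δ > 0, ∀ s : ℝ, 0 < s → s ≤ δ → ∀ l : ℂ, ‖l‖ ≤ M →
      zsScat (fun x => (s : ℂ) * ρ x) (dual fun x => (s : ℂ) * ρ x) l 0 1 ≠ 0 := by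
  obtain ⟨R, hR0, hR⟩ := exists_support_bound hρ.supp
  have cρ := hρ.continuous
  have cρ' := hρ.deriv.continuous
  set E := Real.exp (2 * M * R) with hE
  have hsub : ∀ x, R < |x| → deriv ρ x = 0 := by
    intro x hx
    have : ρ =ᶠ[𝓝 x] 0 := by
      filter_upwards [(isOpen_lt continuous_const continuous_abs).mem_nhds hx] with y hy
      exact hR y hy
    rw [this.deriv_eq]; simp
  have i3 : Integrable fun x => ‖ρ x‖ ^ 3 := by
    refine Continuous.integrable_of_hasCompactSupport (by fun_prop) ?_
    exact hρ.supp.norm.comp_left (g := fun t : ℝ => t ^ 3) (by norm_num)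
  have iK : Integrable fun x => ‖ρ x‖ + (‖deriv ρ x‖ + ‖ρ x‖ ^ 3) :=
    hρ.integrable.norm.add (hρ.deriv.integrable.norm.add i3)
  set K := ∫ x, (‖ρ x‖ + (‖deriv ρ x‖ + ‖ρ x‖ ^ 3)) with hK
  have hK0 : 0 ≤ K := integral_nonneg fun x => by positivity
  -- For $s\le1$ the cubic part of the dual is bounded by a multiple of $s$, so the whole potential
  -- has $L^1$ norm at most $EsK\le1/8$.
  have hδ : 0 < min 1 (1 / (8 * (E * K + 1))) := by positivity
  refine ⟨_, hδ, fun s hs hsδ l hl => ?_⟩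
  have hs1 := hsδ.trans (min_le_left _ _)
  have hs2 := hsδ.trans (min_le_right _ _)
  rw [le_div_iff₀ (by positivity)] at hs2
  set r : ℝ → ℂ := fun x => (s : ℂ) * ρ x with hr
  have hrt : IsTest r := hρ.const_mul s
  have hp := isTestPair_dual hrt
  have hV := integrable_zsPot hp l
  have hVle : ∀ x, ‖zsPot r (dual r) l x‖ ≤
      E * s * (‖ρ x‖ + (‖deriv ρ x‖ + ‖ρ x‖ ^ 3)) := by
    intro x
    have hdl := norm_dual_const_mul_le hρ hs.le hs1 x
    have hrx : ‖r x‖ = s * ‖ρ x‖ := by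
      rw [hr, norm_mul, Complex.norm_real, Real.norm_of_nonneg hs.le]
    refine (norm_le_sum_entries _).trans ?_
    simp only [zsPot, Matrix.of_apply, Matrix.cons_val, norm_zero, zero_add, add_zero, norm_mul]
    rcases lt_or_ge R |x| with hx | hx
    · have h1 : ‖r x‖ = 0 := by rw [hrx, hR x hx]; simp
      have h2 : ‖dual r x‖ ≤ 0 := by
        refine hdl.trans (le_of_eq ?_)
        rw [hsub x hx, hR x hx]; simp
      have h3 : ‖dual r x‖ = 0 := le_antisymm h2 (norm_nonneg _)
      rw [h1, h3]
      simp only [zero_mul, add_zero]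
      positivity
    · have e1 := norm_exp_le_of_norm_le hl hx 1 (by simp)
      have e2 := norm_exp_le_of_norm_le hl hx (-1) (by simp)
      simp only [Complex.ofReal_one, one_mul, Complex.ofReal_neg, neg_mul] at e1 e2
      calc _ ≤ s * ‖ρ x‖ * E + s * (‖deriv ρ x‖ + ‖ρ x‖ ^ 3) * E := by
            rw [hrx]; gcongr
        _ = _ := by ring
  have hVint : ∫ x, ‖zsPot r (dual r) l x‖ ≤ 1 / 8 := by
    calc _ ≤ ∫ x, E * s * (‖ρ x‖ + (‖deriv ρ x‖ + ‖ρ x‖ ^ 3)) :=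
          integral_mono hV.norm (iK.const_mul _) hVle
      _ = E * s * K := integral_const_mul _ _
      _ ≤ 1 / 8 := by nlinarith
  set N := evo (zsPot r (dual r) l) with hN
  have hN1 : ∀ x, ‖N x 1 1 - 1‖ ≤ 1 / 4 := by
    intro x
    have h1 := norm_evo_sub_one_le hV hVint (by norm_num) x
    have h2 := norm_entry_le (N x - 1) 1 1
    rw [Matrix.sub_apply, Matrix.one_apply_eq] at h2
    linarith
  -- Born approximation: up to a nonzero factor the entry is $\int\rho\varphi$. On the support of
  -- $\rho$ the phase relative to the centre $a$ is at most $2Md\le1/8$ and $N_{11}$ is within $1/4$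
  -- of $1$, so $|\varphi-1|\le3/4$. As $\rho\ge0$ is not identically zero, the integral cannot
  -- vanish.
  set φ : ℝ → ℂ := fun x => Complex.exp (2 * Complex.I * l * (x - a : ℝ)) * N x 1 1 with hφ
  have hφ1 : ∀ x, |x - a| ≤ d → ‖φ x - 1‖ ≤ 3 / 4 := by
    intro x hx
    have hz : ‖2 * Complex.I * l * (x - a : ℝ)‖ ≤ 1 / 8 := by
      simp only [norm_mul, Complex.norm_real, Real.norm_eq_abs, RCLike.norm_ofNat, Complex.norm_I]
      have := mul_le_mul hl hx (abs_nonneg _) hM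
      linarith
    have h1 := Complex.norm_exp_sub_one_le (hz.trans (by norm_num))
    have h2 := norm_add_le (N x 1 1 - 1) 1
    rw [sub_add_cancel, norm_one] at h2
    have h3 := hN1 x
    calc ‖φ x - 1‖ = ‖(Complex.exp (2 * Complex.I * l * (x - a : ℝ)) - 1) * N x 1 1 +
          (N x 1 1 - 1)‖ := by congr 1; simp only [hφ]; ring
      _ ≤ 1 / 4 * (5 / 4) + 1 / 4 := by
          refine (norm_add_le _ _).trans ?_
          rw [norm_mul]
          gcongr <;> linarith
      _ ≤ 3 / 4 := by norm_num
  have cφ : Continuous φ :=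
    (by fun_prop : Continuous fun x : ℝ => Complex.exp (2 * Complex.I * l * (x - a : ℝ))).mul
      ((continuous_entry 1 1).comp N.continuous)
  have hfac : ∀ y, r y * Complex.exp (2 * Complex.I * l * y) * N y 1 1 =
      s * Complex.exp (2 * Complex.I * l * a) * (ρ y * φ y) := by
    intro y
    have : Complex.exp (2 * Complex.I * l * y) = Complex.exp (2 * Complex.I * l * a) *
        Complex.exp (2 * Complex.I * l * (y - a : ℝ)) := by
      rw [← Complex.exp_add]; congr 1; push_cast; ring
    simp only [hr, hφ, this]
    ring
  rw [(zsScat_snd_eq hp l).trans (integral_congr_ae (Eventually.of_forall hfac)),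
    integral_const_mul]
  refine mul_ne_zero (mul_ne_zero (by exact_mod_cast hs.ne') (Complex.exp_ne_zero _)) fun h0 => ?_
  have iρφ : Integrable fun y => ρ y * φ y :=
    Continuous.integrable_of_hasCompactSupport (by fun_prop) hρ.supp.mul_right
  have hpos : 0 < ∫ y, ‖ρ y‖ := by
    obtain ⟨x, hx⟩ := hρ0
    exact cρ.norm.integral_pos_of_hasCompactSupport_nonneg_nonzero hρ.supp.norm
      (fun _ => norm_nonneg _) (norm_ne_zero_iff.2 hx)
  have hdiff : ‖(∫ y, ρ y * φ y) - ∫ y, ρ y‖ ≤ 3 / 4 * ∫ y, ‖ρ y‖ := by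
    rw [← integral_sub iρφ hρ.integrable, ← integral_const_mul]
    refine norm_integral_le_of_norm_le (hρ.integrable.norm.const_mul _) (Eventually.of_forall ?_)
    intro y
    rw [show ρ y * φ y - ρ y = (φ y - 1) * ρ y by ring, norm_mul]
    rcases lt_or_ge d |y - a| with hy | hy
    · rw [hsupp y hy]; simp
    · gcongr
      exact hφ1 y hy
  have hreal : ∫ y, ρ y = ((∫ y, ‖ρ y‖ : ℝ) : ℂ) :=
    (integral_congr_ae (Eventually.of_forall hρr)).trans integral_ofReal
  rw [h0, zero_sub, norm_neg, hreal, Complex.norm_real, Real.norm_of_nonneg hpos.le] at hdiff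
  linarith

lemma exists_bump (a : ℝ) {d : ℝ} (hd : 0 < d) : ∃ ρ : ℝ → ℂ, IsTest ρ ∧ (∀ x, ρ x = ‖ρ x‖) ∧
    (∃ x, ρ x ≠ 0) ∧ ∀ x, d < |x - a| → ρ x = 0 := by
  let f : ContDiffBump a := ⟨d / 2, d, by positivity, by linarith⟩
  refine ⟨fun x => (f x : ℂ), ⟨?_, ?_⟩, fun x => ?_, ⟨a, ?_⟩, fun x hx => ?_⟩
  · exact Complex.ofRealCLM.contDiff.comp f.contDiff
  · exact f.hasCompactSupport.comp_left (g := fun t : ℝ => (t : ℂ)) Complex.ofReal_zero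
  · rw [Complex.norm_real, Real.norm_of_nonneg f.nonneg]
  · have := f.pos_of_mem_ball (x := a) (Metric.mem_ball_self hd)
    exact Complex.ofReal_ne_zero.2 this.ne'
  · exact Complex.ofReal_eq_zero.2 (f.zero_of_le_dist (by rw [Real.dist_eq]; exact hx.le))

end Bump

end

end DNLS

namespace DNLS

noncomputable section

/-! ### Density -/

section Dense

attribute [local instance] Matrix.linftyOpNormedRing Matrix.linftyOpNormedAlgebra normTopology

variable {u v : ℝ → ℂ}

/-- Rotating the right one of two separated test functions. -/
lemma testA_add_mul (hu : IsTest u) (hv : IsTest v) {R : ℝ} (hu0 : ∀ x, R ≤ x → u x = 0)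
    (hv0 : ∀ x, x ≤ R + 1 → v x = 0) {c : ℂ} (hc : ‖c‖ = 1) (l : ℂ) :
    testA (fun x => u x + c * v x) l = testA v l * testA u l +
      c * (zsScat v (dual v) l 0 1 * zsScat u (dual u) l 1 0) := by
  have hc0 : c ≠ 0 := norm_ne_zero_iff.1 (by rw [hc]; exact one_ne_zero)
  have hdu : ∀ x, R < x → dual u x = 0 := fun x hx => dual_eq_zero <| by
    filter_upwards [lt_mem_nhds hx] with y hy using hu0 y hy.le
  have hdv : ∀ x, x < R + 1 → dual v x = 0 := fun x hx => dual_eq_zero <| by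
    filter_upwards [gt_mem_nhds hx] with y hy using hv0 y hy.le
  have hd := dual_add_mul hu hv hc fun x => by
    rcases le_total R x with h | h
    · exact Or.inl (hu0 x h)
    · exact Or.inr (hv0 x (by linarith))
  have hpu := isTestPair_dual hu
  have hpv := isTestPair_dual hv
  have hpcv : IsTestPair (fun x => c * v x) (fun x => c⁻¹ * dual v x) :=
    ⟨continuous_const.mul hpv.contq, continuous_const.mul hpv.contp, hpv.suppq.mul_left,
      hpv.suppp.mul_left⟩
  -- The splitting point lies in the middle of the gap, where both functions and their duals vanish.
  have hadd := zsScat_add hpu hpcv (c := R + 1 / 2) (fun x hx => hu0 x (by linarith))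
    (fun x hx => hdu x (by linarith))
    (fun x hx => by simp only [hv0 x (by linarith), mul_zero])
    (fun x hx => by simp only [hdv x (by linarith), mul_zero]) l
  rw [testA, hd, hadd, zsScat_rotate hpv hc0]
  simp only [Matrix.mul_apply, Fin.sum_univ_two, Matrix.of_apply, Matrix.cons_val, testA]
  ring

lemma exists_mem_genericSet_near (hu : IsTest u) {ε : ℝ} (hε : 0 < ε) :
    ∃ (v : ℝ → ℂ) (hv : IsTest v), emb hv ∈ genericSet (-1) ∧ ‖emb hv - emb hu‖ < ε := by
  obtain ⟨R, hR0, hR⟩ := exists_support_bound hu.supp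
  obtain ⟨M, hM0, hM⟩ := exists_norm_sub_one_le hu (ε := 1 / 2) (by norm_num)
  -- The width satisfies $16Md\le1$ for the $M$ beyond which the coefficient of $u$ has no zeros;
  -- the added $1$ covers $M=0$ and gives $d\le1$, so that a bump centred at $R+4$ leaves a gap.
  have hd : 0 < 1 / (16 * M + 1) := by positivity
  obtain ⟨ρ, hρ, hρr, hρ0, hρs⟩ := exists_bump (R + 4) hd
  have hd1 : 1 / (16 * M + 1) ≤ 1 := by
    rw [div_le_one (by positivity)]; linarith
  obtain ⟨δ₁, hδ₁, H₁⟩ := exists_zsScat_bump_ne_zero hM0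
    (by rw [mul_one_div, div_le_one (by positivity)]; linarith) hρ hρr hρ0 hρs
  obtain ⟨δ₂, hδ₂, H₂⟩ := exists_testA_const_mul_near_one hρ (ε := 1 / 2) (by norm_num)
  set s := min (min δ₁ δ₂) (ε / (2 * (‖emb hρ‖ + 1))) with hs
  have hs0 : 0 < s := by positivity
  have hs1 : s ≤ δ₁ := (min_le_left _ _).trans (min_le_left _ _)
  have hs2 : s ≤ δ₂ := (min_le_left _ _).trans (min_le_right _ _)
  have hs3 : s * ‖emb hρ‖ < ε := by
    have h1 : s ≤ ε / (2 * (‖emb hρ‖ + 1)) := min_le_right _ _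
    rw [le_div_iff₀ (by positivity)] at h1
    nlinarith [norm_nonneg (emb hρ)]
  have hr : IsTest fun x => (s : ℂ) * ρ x := hρ.const_mul s
  set r : ℝ → ℂ := fun x => (s : ℂ) * ρ x with hrdef
  have hu0 : ∀ x, R + 1 ≤ x → u x = 0 := fun x hx => hR x <| by
    linarith [le_abs_self x]
  have hr0 : ∀ x, x ≤ R + 1 + 1 → r x = 0 := fun x hx => by
    have h : ρ x = 0 := hρs x <| hd1.trans_lt <| by
      rw [lt_abs]; right; linarith
    simp only [hrdef, h, mul_zero]
  set A : ℂ → ℂ := fun z => testA r z * testA u z with hA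
  set B : ℂ → ℂ := fun z => zsScat r (dual r) z 0 1 * zsScat u (dual u) z 1 0 with hB
  have hv : ∀ c : ℂ, IsTest fun x => u x + c * r x := fun c => hu.add (hr.const_mul c)
  have hAB : ∀ c : ℂ, ‖c‖ = 1 → testA (fun x => u x + c * r x) = fun z => A z + c * B z :=
    fun c hc => funext fun z => testA_add_mul hu hr hu0 hr0 hc z
  have hAd : Differentiable ℂ A := (differentiable_testA hr).mul (differentiable_testA hu)
  have hentry : ∀ {w : ℝ → ℂ} (_ : IsTest w) (i j : Fin 2),
      Differentiable ℂ fun z => zsScat w (dual w) z i j := fun hw i j z =>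
    (entry i j).differentiableAt.comp z (differentiable_zsScat (isTestPair_dual hw) z)
  have hBd : Differentiable ℂ B := (hentry hr 0 1).mul (hentry hu 1 0)
  have hA1 : ∀ ε > 0, ∃ M, ∀ z : ℂ, 0 ≤ z.im → M < ‖z‖ → ‖A z - 1‖ ≤ ε := by
    intro ε hε
    have hη : 0 < min 1 (ε / 3) := by positivity
    obtain ⟨M₁, -, h₁⟩ := exists_norm_sub_one_le hr hη
    obtain ⟨M₂, -, h₂⟩ := exists_norm_sub_one_le hu hη
    refine ⟨max M₁ M₂, fun z hz hzM => ?_⟩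
    have k₁ := h₁ z hz ((le_max_left _ _).trans_lt hzM)
    have k₂ := h₂ z hz ((le_max_right _ _).trans_lt hzM)
    have k₃ : ‖testA u z‖ ≤ 1 + min 1 (ε / 3) := by
      have := norm_add_le (testA u z - 1) 1
      rw [sub_add_cancel, norm_one] at this
      linarith
    calc ‖A z - 1‖ = ‖(testA r z - 1) * testA u z + (testA u z - 1)‖ := by
          congr 1; simp only [hA]; ring
      _ ≤ min 1 (ε / 3) * (1 + min 1 (ε / 3)) + min 1 (ε / 3) := by
          refine (norm_add_le _ _).trans ?_
          rw [norm_mul]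
          gcongr
      _ ≤ ε := by nlinarith [min_le_left 1 (ε / 3), min_le_right 1 (ε / 3)]
  -- Decay of the off-diagonal product comes for free: with $c=1$, $A+B$ is itself the coefficient
  -- of a test function, and both $A+B$ and $A$ tend to $1$.
  have hB0 : ∀ ε > 0, ∃ M, ∀ z : ℂ, 0 ≤ z.im → M < ‖z‖ → ‖B z‖ ≤ ε := by
    intro ε hε
    obtain ⟨M₁, h₁⟩ := hA1 (ε / 2) (by positivity)
    obtain ⟨M₂, -, h₂⟩ := exists_norm_sub_one_le (hv 1) (ε := ε / 2) (by positivity)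
    refine ⟨max M₁ M₂, fun z hz hzM => ?_⟩
    have k₁ := h₁ z hz ((le_max_left _ _).trans_lt hzM)
    have k₂ := h₂ z hz ((le_max_right _ _).trans_lt hzM)
    rw [hAB 1 norm_one] at k₂
    calc ‖B z‖ = ‖(A z + 1 * B z - 1) - (A z - 1)‖ := by congr 1; ring
      _ ≤ ε / 2 + ε / 2 := (norm_sub_le _ _).trans (add_le_add k₂ k₁)
      _ = ε := by ring
  -- The bump's diagonal coefficient stays near $1$, so the zero belongs to $u$ and lies in $|z|\le
  -- M$. There the off-diagonal entry of the bump is nonzero, and $\det S^u=1$ forces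
  -- $S^u_{10}\ne0$.
  have hcommon : ∀ z : ℂ, 0 ≤ z.im → A z = 0 → B z ≠ 0 := by
    intro z hz h0
    have hne : ∀ {w : ℂ}, ‖w - 1‖ ≤ 1 / 2 → w ≠ 0 := fun hw h => by
      rw [h] at hw; norm_num at hw
    have hu00 : testA u z = 0 :=
      (mul_eq_zero.1 h0).resolve_left (hne (H₂ s hs0.le hs2 z hz))
    have hzM : ‖z‖ ≤ M := not_lt.1 fun h => hne (hM z hz h) hu00
    have hdet := det_zsScat (isTestPair_dual hu) z
    rw [Matrix.det_fin_two, show zsScat u (dual u) z 0 0 = 0 from hu00, zero_mul, zero_sub] at hdet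
    refine mul_ne_zero (H₁ s hs0 hs1 z hzM) fun h => ?_
    rw [h, mul_zero, neg_zero] at hdet
    exact zero_ne_one hdet
  obtain ⟨c, hc, hcz⟩ := exists_unimodular hAd hBd (hA1 (1 / 4) (by norm_num)) hB0 hcommon
  refine ⟨_, hv c, emb_mem_genericSet (hv c) fun z hz h0 => ?_, ?_⟩
  · rw [hAB c hc] at h0 ⊢
    have hder : deriv (fun z => A z + c * B z) z = deriv A z + c * deriv B z :=
      ((hAd z).hasDerivAt.add ((hBd z).hasDerivAt.const_mul c)).deriv
    rw [hder]
    exact hcz z hz h0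
  · rw [emb_sub (hv c) hu, emb_congr _ ((hr.const_mul c)) (by ext x; ring),
      norm_emb_const_mul hr, hc, one_mul, norm_emb_const_mul hρ, Complex.norm_real,
      Real.norm_of_nonneg hs0.le]
    exact hs3

theorem dense_genericSet : Dense (genericSet (-1)) := by
  intro q
  rw [Metric.mem_closure_iff]
  intro ε hε
  obtain ⟨u, hu, h1⟩ := exists_emb_near q (ε := ε / 2) (by positivity)
  obtain ⟨v, hv, hmem, h2⟩ := exists_mem_genericSet_near hu (ε := ε / 2) (by positivity)
  refine ⟨_, hmem, ?_⟩
  rw [dist_comm, dist_eq_norm]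
  calc _ = ‖(emb hv - emb hu) + (emb hu - q)‖ := by rw [sub_add_sub_cancel]
    _ ≤ _ := norm_add_le _ _
    _ < ε := by linarith

end Dense

end

end DNLS

theorem theorem1p1 :
    IsOpen (DNLS.genericSet (-1)) ∧ Dense (DNLS.genericSet (-1)) :=
  ⟨DNLS.isOpen_genericSet, DNLS.dense_genericSet⟩
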